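/- Let $\Lambda$ be an artin algebra, let $\mathrm{mod}\,\Lambda$ be the category of finitely generated $\Lambda$-modules, let $n\ge 1$, and let $\mathcal M\subseteq \mathrm{mod}\,\Lambda$ be an $n$-cluster tilting subcategory, that is, a functorially finite, generating and cogenerating full subcategory with $$\mathcal M=\{A\mid \mathrm{Ext}^i_\Lambda(\mathcal M,A)=0,\ 0<i<n\}=\{A\mid \mathrm{Ext}^i_\Lambda(A,\mathcal M)=0,\ 0<i<n\}.$$ Let $\mathrm{mod}\text{-}\underline{\mathcal M}$ be the category of finitely presented contravariant functors from $\mathcal M$ to abelian groups that vanish on projective modules, and $\overline{\mathcal M}\text{-}\mathrm{mod}$ the category of finitely presented covariant functors from $\mathcal M$ to abelian groups that vanish on injective modules. Let $\underline{\mathcal M}(X,Y)$ and $\overline{\mathcal M}(X,Y)$ be the quotients of $\mathcal M(X,Y)=\mathrm{Hom}_\Lambda(X,Y)$ by the morphisms that factor through a projective, respectively injective, module in $\mathrm{mod}\,\Lambda$. A complex $\delta:\ 0\to M^0\to M^1\to\cdots\to M^n\to M^{n+1}\to 0$ in $\mathcal M$ is $n$-exact if for every $X\in\mathcal M$ the sequences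 $0\to\mathcal M(X,M^0)\to\cdots\to\mathcal M(X,M^{n+1})$ and $0\to\mathcal M(M^{n+1},X)\to\cdots\to\mathcal M(M^0,X)$ are exact. Its contravariant and covariant defects are $$\delta^*=\mathrm{Coker}\big(\mathcal M(-,M^n)\to\mathcal M(-,M^{n+1})\big),\qquad \delta_*=\mathrm{Coker}\big(\mathcal M(M^1,-)\to\mathcal M(M^0,-)\big).$$ Let $\mathcal F(\mathcal M)$ be the category of the morphisms in $\mathcal M$ that are epimorphisms of modules (its morphisms are commutative squares), let $\Theta:\mathcal F(\mathcal M)\to\mathrm{mod}\text{-}\underline{\mathcal M}$ be the functor $(f:M_1\to M_2)\mapsto\mathrm{Coker}\,\mathcal M(-,f)$, and let $\Psi':\mathcal F(\mathcal M)\to\overline{\mathcal M}\text{-}\mathrm{mod}$ be the contravariant functor that completes $f$ to an $n$-exact sequence $\delta$ with last morphism $f$ and sends $f$ to $\delta_*$, and that sends a morphism in $\mathcal F(\mathcal M)$ to the map induced by a lifting of it to the $n$-exact sequences. Then there is a duality $\Sigma:\mathrm{mod}\text{-}\underline{\mathcal M}\to\overline{\mathcal M}\text{-}\mathrm{mod}$,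 unique up to isomorphism as a contravariant functor, with $\Sigma\circ\Theta\cong\Psi'$ (that is, $\Sigma=\Psi'\circ\Theta^{-1}$). For every $n$-exact sequence $\delta$ in $\mathcal M$ we have $\Sigma(\delta^*)\cong\delta_*$ and $\Sigma^{-1}(\delta_*)\cong\delta^*$, naturally in $\delta$. Moreover: (i) The projective objects of $\mathrm{mod}\text{-}\underline{\mathcal M}$ are, up to isomorphism, exactly the functors $\underline{\mathcal M}(-,X)$ with $X\in\mathcal M$; naturally in $X$, $\Sigma(\underline{\mathcal M}(-,X))\cong\mathrm{Ext}^n_\Lambda(X,-)|_{\mathcal M}$; and $\Sigma$ restricts to a duality from the projective objects of $\mathrm{mod}\text{-}\underline{\mathcal M}$ to the injective objects of $\overline{\mathcal M}\text{-}\mathrm{mod}$. (ii) The projective objects of $\overline{\mathcal M}\text{-}\mathrm{mod}$ are, up to isomorphism, exactly the functors $\overline{\mathcal M}(X,-)$ with $X\in\mathcal M$; naturally in $X$, $\Sigma^{-1}(\overline{\mathcal M}(X,-))\cong\mathrm{Ext}^n_\Lambda(-,X)|_{\mathcal M}$; and $\Sigma^{-1}$ restricts to a duality from the projective objects of $\overline{\mathcal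 M}\text{-}\mathrm{mod}$ to the injective objects of $\mathrm{mod}\text{-}\underline{\mathcal M}$. -/

import Mathlib

open CategoryTheory CategoryTheory.Limits Opposite

universe w v u

noncomputable section

namespace HigherAuslander

/-! ## Finitely presented functors and stable Hom functors -/

section Functors

variable {C : Type u} [Category.{v} C] [Preadditive C]

/-- `f : X ⟶ Y` is sent to `Coker (C(-, X) ⟶ C(-, Y))`. -/
def contraCoker : Arrow C ⥤ Cᵒᵖ ⥤ AddCommGrpCat.{v} where
  obj f := cokernel (preadditiveYoneda.map f.hom)
  map {f g} φ := cokernel.map _ _ (preadditiveYoneda.map φ.left) (preadditiveYoneda.map φ.right)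
    (by rw [← Functor.map_comp, ← Functor.map_comp, Arrow.w])
  map_id f := by apply coequalizer.hom_ext; simp
  map_comp φ ψ := by apply coequalizer.hom_ext; simp

/-- `f : X ⟶ Y` is sent to `Coker (C(Y, -) ⟶ C(X, -))`. -/
def coCoker : (Arrow C)ᵒᵖ ⥤ C ⥤ AddCommGrpCat.{v} where
  obj f := cokernel (preadditiveCoyoneda.map f.unop.hom.op)
  map {f g} φ := cokernel.map _ _ (preadditiveCoyoneda.map φ.unop.right.op)
    (preadditiveCoyoneda.map φ.unop.left.op)
    (by rw [← Functor.map_comp, ← Functor.map_comp, ← op_comp, ← op_comp, Arrow.w])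
  map_id f := by apply coequalizer.hom_ext; simp
  map_comp φ ψ := by apply coequalizer.hom_ext; simp

/-- Finitely presented contravariant functors: there is an exact sequence
`C(-, X) ⟶ C(-, X') ⟶ F ⟶ 0`. -/
def IsFPContra (F : Cᵒᵖ ⥤ AddCommGrpCat.{v}) : Prop :=
  ∃ f : Arrow C, Nonempty (contraCoker.obj f ≅ F)

/-- Finitely presented covariant functors: there is an exact sequence
`C(X', -) ⟶ C(X, -) ⟶ F ⟶ 0`. -/
def IsFPCo (F : C ⥤ AddCommGrpCat.{v}) : Prop :=
  ∃ f : Arrow C, Nonempty (coCoker.obj (op f) ≅ F)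

/-- The ideal of `C` generated by the morphisms that factor through an object satisfying `W`. -/
def factorIdeal (W : ObjectProperty C) (X Y : C) : AddSubgroup (X ⟶ Y) :=
  AddSubgroup.closure {f | ∃ (Z : C) (a : X ⟶ Z) (b : Z ⟶ Y), W Z ∧ a ≫ b = f}

lemma factorIdeal_le_comap_rightComp (W : ObjectProperty C) {Y Z : C} (X : C) (g : Y ⟶ Z) :
    factorIdeal W X Y ≤ (factorIdeal W X Z).comap (Preadditive.rightComp X g) := by
  refine (AddSubgroup.closure_le _).2 ?_
  rintro _ ⟨K, a, b, hK, rfl⟩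
  exact AddSubgroup.subset_closure ⟨K, a, b ≫ g, hK, by simp [Preadditive.rightComp]⟩

lemma factorIdeal_le_comap_leftComp (W : ObjectProperty C) {X Y : C} (Z : C) (g : X ⟶ Y) :
    factorIdeal W Y Z ≤ (factorIdeal W X Z).comap (Preadditive.leftComp Z g) := by
  refine (AddSubgroup.closure_le _).2 ?_
  rintro _ ⟨K, a, b, hK, rfl⟩
  exact AddSubgroup.subset_closure ⟨K, g ≫ a, b, hK, by simp [Preadditive.leftComp]⟩

/-- The Hom bifunctor of the quotient of `C` by the ideal of the morphisms that factor through
objects satisfying `W`, regarded as a bifunctor on `C`. -/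
def stableHom (W : ObjectProperty C) : Cᵒᵖ ⥤ C ⥤ AddCommGrpCat.{v} where
  obj X :=
    { obj := fun Y => AddCommGrpCat.of ((X.unop ⟶ Y) ⧸ factorIdeal W X.unop Y)
      map := fun g => AddCommGrpCat.ofHom
        (QuotientAddGroup.map _ _ (Preadditive.rightComp X.unop g)
          (factorIdeal_le_comap_rightComp W X.unop g))
      map_id := fun Y => by
        ext x
        exact congrArg QuotientAddGroup.mk (Category.comp_id x)
      map_comp := fun g h => by
        ext x
        exact congrArg QuotientAddGroup.mk (Category.assoc x g h).symm }
  map g :=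
    { app := fun Y => AddCommGrpCat.ofHom
        (QuotientAddGroup.map _ _ (Preadditive.leftComp Y g.unop)
          (factorIdeal_le_comap_leftComp W Y g.unop))
      naturality := fun Y Z h => by
        ext x
        exact congrArg QuotientAddGroup.mk (Category.assoc g.unop x h).symm }
  map_id X := by
    ext Y x
    exact congrArg QuotientAddGroup.mk (Category.id_comp x)
  map_comp g h := by
    ext Y x
    exact congrArg QuotientAddGroup.mk (Category.assoc h.unop g.unop x)

end Functors

/-! ## `n`-exact sequences -/

section NExact

variable {C : Type u} [Category.{v} C] [Preadditive C]

/-- A sequence `S⁰ ⟶ S¹ ⟶ ⋯ ⟶ Sⁿ ⟶ Sⁿ⁺¹` is `n`-exact if, for every object `X`, the sequences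
of abelian groups `0 ⟶ C(X, S⁰) ⟶ ⋯ ⟶ C(X, Sⁿ⁺¹)` and `0 ⟶ C(Sⁿ⁺¹, X) ⟶ ⋯ ⟶ C(S⁰, X)` are
exact. -/
structure IsNExact {n : ℕ} (S : ComposableArrows C (n + 1)) : Prop where
  isComplex : S.IsComplex
  /-- exactness at `C(X, S⁰)` -/
  kernel_zero : ∀ (X : C) (g : X ⟶ S.obj' 0), g ≫ S.map' 0 1 = 0 → g = 0
  /-- exactness at `C(X, S¹), …, C(X, Sⁿ)` -/
  kernel_exact : ∀ (i : ℕ) (hi : i + 2 ≤ n + 1) (X : C) (g : X ⟶ S.obj' (i + 1)),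
    g ≫ S.map' (i + 1) (i + 2) = 0 → ∃ h : X ⟶ S.obj' i, h ≫ S.map' i (i + 1) = g
  /-- exactness at `C(Sⁿ⁺¹, X)` -/
  cokernel_zero : ∀ (X : C) (g : S.obj' (n + 1) ⟶ X), S.map' n (n + 1) ≫ g = 0 → g = 0
  /-- exactness at `C(Sⁿ, X), …, C(S¹, X)` -/
  cokernel_exact : ∀ (i : ℕ) (hi : i + 2 ≤ n + 1) (X : C) (g : S.obj' (i + 1) ⟶ X),
    S.map' i (i + 1) ≫ g = 0 → ∃ h : S.obj' (i + 2) ⟶ X, S.map' (i + 1) (i + 2) ≫ h = g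

variable (C) in
/-- The category of `n`-exact sequences in `C` and commutative ladders between them. -/
abbrev NExactSeq (n : ℕ) :=
  ObjectProperty.FullSubcategory (fun S : ComposableArrows C (n + 1) => IsNExact S)

/-- The arrow `Sⁱ ⟶ Sⁱ⁺¹` of a sequence. -/
def arrowAt {m : ℕ} (i : ℕ) (hi : i + 1 ≤ m) : ComposableArrows C m ⥤ Arrow C where
  obj S := Arrow.mk (S.map' i (i + 1))
  map {S T} φ := Arrow.homMk (ComposableArrows.app' φ i) (ComposableArrows.app' φ (i + 1))
    (ComposableArrows.naturality' φ i (i + 1)).symm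

/-- The last arrow `Sⁿ ⟶ Sⁿ⁺¹`. -/
def lastArrow (n : ℕ) : NExactSeq C n ⥤ Arrow C :=
  ObjectProperty.ι _ ⋙ arrowAt n le_rfl

/-- The first arrow `S⁰ ⟶ S¹`. -/
def firstArrow (n : ℕ) : NExactSeq C n ⥤ Arrow C :=
  ObjectProperty.ι _ ⋙ arrowAt 0 (Nat.le_add_left 1 n)

end NExact

/-! ## Cluster tilting subcategories -/

section ClusterTilting

variable {Λ : Type u} [Ring Λ]

/-- A full subcategory `M` of the category of finitely generated `Λ`-modules is `n`-cluster
tilting if it is functorially finite, generating and cogenerating, and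
`M = {A | Extⁱ(M, A) = 0 for 0 < i < n} = {A | Extⁱ(A, M) = 0 for 0 < i < n}`. (In particular
`M` is closed under isomorphisms, finite direct sums and direct summands.) -/
structure IsNClusterTilting (n : ℕ) (M : ObjectProperty (ModuleCat.{u} Λ)) : Prop where
  finite : ∀ A, M A → Module.Finite Λ A
  contravariantlyFinite : ∀ A : ModuleCat.{u} Λ, Module.Finite Λ A →
    ∃ (X : ModuleCat.{u} Λ) (p : X ⟶ A), M X ∧
      ∀ (Y : ModuleCat.{u} Λ) (g : Y ⟶ A), M Y → ∃ h : Y ⟶ X, h ≫ p = g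
  covariantlyFinite : ∀ A : ModuleCat.{u} Λ, Module.Finite Λ A →
    ∃ (X : ModuleCat.{u} Λ) (q : A ⟶ X), M X ∧
      ∀ (Y : ModuleCat.{u} Λ) (g : A ⟶ Y), M Y → ∃ h : X ⟶ Y, q ≫ h = g
  generating : ∀ A : ModuleCat.{u} Λ, Module.Finite Λ A →
    ∃ (X : ModuleCat.{u} Λ) (p : X ⟶ A), M X ∧ Epi p
  cogenerating : ∀ A : ModuleCat.{u} Λ, Module.Finite Λ A →
    ∃ (X : ModuleCat.{u} Λ) (q : A ⟶ X), M X ∧ Mono q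
  mem_iff_right : ∀ A : ModuleCat.{u} Λ, Module.Finite Λ A →
    (M A ↔ ∀ X : ModuleCat.{u} Λ, M X → ∀ i : ℕ, 0 < i → i < n →
      Subsingleton (Abelian.Ext X A i))
  mem_iff_left : ∀ A : ModuleCat.{u} Λ, Module.Finite Λ A →
    (M A ↔ ∀ X : ModuleCat.{u} Λ, M X → ∀ i : ℕ, 0 < i → i < n →
      Subsingleton (Abelian.Ext A X i))

variable (M : ObjectProperty (ModuleCat.{u} Λ))

/-- The objects of `M` that are projective `Λ`-modules. -/
def projObj : ObjectProperty M.FullSubcategory := fun P => Projective P.obj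

/-- The objects of `M` that are injective `Λ`-modules. -/
def injObj : ObjectProperty M.FullSubcategory := fun I => Injective I.obj

/-- Finitely presented contravariant functors on `M` that vanish on projective modules. -/
def IsModUnder : ObjectProperty (M.FullSubcategoryᵒᵖ ⥤ AddCommGrpCat.{u}) := fun F =>
  IsFPContra F ∧ ∀ P : M.FullSubcategory, projObj M P → IsZero (F.obj (op P))

/-- Finitely presented covariant functors on `M` that vanish on injective modules. -/
def IsOverMod : ObjectProperty (M.FullSubcategory ⥤ AddCommGrpCat.{u}) := fun F =>
  IsFPCo F ∧ ∀ I : M.FullSubcategory, injObj M I → IsZero (F.obj I)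

/-- `mod-M̲`. -/
abbrev ModUnder := (IsModUnder M).FullSubcategory

/-- `M̄-mod`. -/
abbrev OverMod := (IsOverMod M).FullSubcategory

/-- The epimorphism category `𝓕(M)`: morphisms in `M` that are epimorphisms of modules. -/
abbrev EpiCat := ObjectProperty.FullSubcategory
  (fun f : Arrow M.FullSubcategory => Epi f.hom.hom)

/-- The functor `X ↦ M̲(-, X)`: morphisms modulo those factoring through projectives. -/
def underHom : M.FullSubcategory ⥤ M.FullSubcategoryᵒᵖ ⥤ AddCommGrpCat.{u} :=
  (stableHom (projObj M)).flip

/-- The functor `X ↦ M̄(X, -)`: morphisms modulo those factoring through injectives. -/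
def overHom : M.FullSubcategoryᵒᵖ ⥤ M.FullSubcategory ⥤ AddCommGrpCat.{u} :=
  stableHom (injObj M)

/-- The functor `X ↦ Extⁿ(X, -)|_M`. -/
def extCo (n : ℕ) : M.FullSubcategoryᵒᵖ ⥤ M.FullSubcategory ⥤ AddCommGrpCat.{u} :=
  M.ι.op ⋙ Abelian.extFunctor n ⋙ (Functor.whiskeringLeft _ _ _).obj M.ι

/-- The functor `X ↦ Extⁿ(-, X)|_M`. -/
def extContra (n : ℕ) : M.FullSubcategory ⥤ M.FullSubcategoryᵒᵖ ⥤ AddCommGrpCat.{u} :=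
  (extCo M n).flip

variable {M}

lemma isZero_cokernel_of_surjective {A B : AddCommGrpCat.{u}} (f : A ⟶ B)
    (hf : Function.Surjective f) : IsZero (cokernel f) := by
  have : Epi f := (AddCommGrpCat.epi_iff_surjective f).2 hf
  exact isZero_cokernel_of_epi f

lemma isModUnder_contraCoker (f : EpiCat M) : IsModUnder M (contraCoker.obj f.obj) := by
  refine ⟨⟨f.obj, ⟨Iso.refl _⟩⟩, fun P hP => ?_⟩
  have : Epi f.obj.hom.hom := f.property
  have : Projective P.obj := hP
  refine IsZero.of_iso (isZero_cokernel_of_surjective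
    ((preadditiveYoneda.map f.obj.hom).app (op P)) ?_)
    (PreservesCokernel.iso ((evaluation _ _).obj (op P)) (preadditiveYoneda.map f.obj.hom))
  intro g
  refine ⟨ObjectProperty.homMk (Projective.factorThru g.hom f.obj.hom.hom), ?_⟩
  apply ObjectProperty.hom_ext
  exact Projective.factorThru_comp g.hom f.obj.hom.hom

lemma isOverMod_coCoker (f : Arrow M.FullSubcategory) (hf : Mono f.hom.hom) :
    IsOverMod M (coCoker.obj (op f)) := by
  refine ⟨⟨f, ⟨Iso.refl _⟩⟩, fun I hI => ?_⟩
  have : Injective I.obj := hI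
  refine IsZero.of_iso (isZero_cokernel_of_surjective
    ((preadditiveCoyoneda.map f.hom.op).app I) ?_)
    (PreservesCokernel.iso ((evaluation _ _).obj I) (preadditiveCoyoneda.map f.hom.op))
  intro g
  refine ⟨ObjectProperty.homMk (Injective.factorThru g.hom f.hom.hom), ?_⟩
  apply ObjectProperty.hom_ext
  exact Injective.comp_factorThru g.hom f.hom.hom

variable (M) in
/-- The functor `Θ : 𝓕(M) ⥤ mod-M̲`, `(f : M₁ ⟶ M₂) ↦ Coker (M(-, M₁) ⟶ M(-, M₂))`. -/
def theta : EpiCat M ⥤ ModUnder M :=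
  (IsModUnder M).lift (ObjectProperty.ι _ ⋙ contraCoker) isModUnder_contraCoker

variable {n : ℕ}

/-- The last morphism of an `n`-exact sequence in `M` is an epimorphism of modules. -/
lemma epi_lastArrow (hM : IsNClusterTilting n M) (S : NExactSeq M.FullSubcategory n) :
    Epi ((lastArrow n).obj S).hom.hom := by
  set f := ((lastArrow n).obj S).hom with hf
  have hfin : Module.Finite Λ ((lastArrow n).obj S).right.obj :=
    hM.finite _ (ObjectProperty.FullSubcategory.property _)
  have hQ : Module.Finite Λ (cokernel f.hom : ModuleCat.{u} Λ) :=
    Module.Finite.of_surjective (cokernel.π f.hom).hom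
      ((ModuleCat.epi_iff_surjective _).1 inferInstance)
  obtain ⟨X, q, hX, hq⟩ := hM.cogenerating _ hQ
  refine Preadditive.epi_of_cokernel_zero ?_
  rw [← cancel_mono q, zero_comp]
  have h := S.property.cokernel_zero ⟨X, hX⟩
    (ObjectProperty.homMk (cokernel.π f.hom ≫ q)) (by
      apply ObjectProperty.hom_ext
      exact (cokernel.condition_assoc f.hom q).trans zero_comp)
  exact congrArg (fun g => g.hom) h

/-- The first morphism of an `n`-exact sequence in `M` is a monomorphism of modules. -/
lemma mono_firstArrow (hM : IsNClusterTilting n M) (S : NExactSeq M.FullSubcategory n) :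
    Mono ((firstArrow n).obj S).hom.hom := by
  set f := ((firstArrow n).obj S).hom with hf
  obtain ⟨X, p, hX, hp⟩ := hM.generating (ModuleCat.of Λ Λ) (Module.Finite.self Λ)
  rw [ModuleCat.mono_iff_injective, injective_iff_map_eq_zero]
  intro k hk
  let g : ModuleCat.of Λ Λ ⟶ ((firstArrow n).obj S).left.obj :=
    ModuleCat.ofHom (LinearMap.toSpanSingleton Λ _ k)
  have hg : g ≫ f.hom = 0 := by
    ext
    simpa [g] using hk
  have h := S.property.kernel_zero ⟨X, hX⟩ (ObjectProperty.homMk (p ≫ g)) (by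
    apply ObjectProperty.hom_ext
    exact (Category.assoc p g f.hom).trans (by rw [hg, comp_zero]; rfl))
  have h' : p ≫ g = 0 := congrArg (fun g => g.hom) h
  have h0 : g = 0 := by rwa [← cancel_epi p, comp_zero]
  have h1 : g.hom (1 : Λ) = 0 := by rw [h0]; rfl
  simpa [g] using h1

/-- The functor sending an `n`-exact sequence in `M` to its last morphism. -/
def lastEpi (hM : IsNClusterTilting n M) : NExactSeq M.FullSubcategory n ⥤ EpiCat M :=
  ObjectProperty.lift _ (lastArrow n) (epi_lastArrow hM)

/-- The contravariant defect `δ ↦ δ^* = Coker (M(-, Mⁿ) ⟶ M(-, Mⁿ⁺¹))`. -/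
def contraDefect (hM : IsNClusterTilting n M) : NExactSeq M.FullSubcategory n ⥤ ModUnder M :=
  (IsModUnder M).lift (lastArrow n ⋙ contraCoker)
    (fun S => isModUnder_contraCoker ((lastEpi hM).obj S))

/-- The covariant defect `δ ↦ δ_* = Coker (M(M¹, -) ⟶ M(M⁰, -))`. -/
def coDefect (hM : IsNClusterTilting n M) : (NExactSeq M.FullSubcategory n)ᵒᵖ ⥤ OverMod M :=
  (IsOverMod M).lift ((firstArrow n).op ⋙ coCoker)
    (fun S => isOverMod_coCoker _ (mono_firstArrow hM S.unop))

/-- `Ψ'` is the functor `𝓕(M)ᵒᵖ ⥤ M̄-mod` that completes an epimorphism `f` to an `n`-exact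
sequence `0 ⟶ M⁰ ⟶ M¹ ⟶ ⋯ ⟶ Mⁿ ⟶ Mⁿ⁺¹ ⟶ 0` with last morphism `f`, sends `f` to
`Coker (M(M¹, -) ⟶ M(M⁰, -))`, and sends a morphism of epimorphisms to the map that is induced
by any of its liftings to the `n`-exact sequences. It is determined up to isomorphism. -/
def IsPsiPrime (hM : IsNClusterTilting n M) (Ψ : (EpiCat M)ᵒᵖ ⥤ OverMod M) : Prop :=
  Nonempty ((lastEpi hM).op ⋙ Ψ ≅ coDefect hM)

/-- `Σ = Ψ' ∘ Θ⁻¹`, that is, `Σ ∘ Θ ≅ Ψ'`. -/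
def IsSigma (hM : IsNClusterTilting n M) (S : (ModUnder M)ᵒᵖ ⥤ OverMod M) : Prop :=
  ∃ Ψ : (EpiCat M)ᵒᵖ ⥤ OverMod M, IsPsiPrime hM Ψ ∧ Nonempty ((theta M).op ⋙ S ≅ Ψ)

end ClusterTilting

/-! ## Restriction of a contravariant functor to projective objects -/

section Restriction

/-- The functor from projective objects to injective objects induced by a contravariant functor
that sends projective objects to injective objects. -/
def projToInj {A B : Type*} [Category* A] [Category* B] (S : Aᵒᵖ ⥤ B)
    (h : ∀ F : A, Projective F → Injective (S.obj (op F))) :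
    (ObjectProperty.FullSubcategory (fun F : A => Projective F))ᵒᵖ ⥤
      ObjectProperty.FullSubcategory (fun G : B => Injective G) :=
  ObjectProperty.lift _ ((ObjectProperty.ι _).op ⋙ S) (fun F => h F.unop.obj F.unop.property)

end Restriction

end HigherAuslander

end

open CategoryTheory CategoryTheory.Limits Opposite

noncomputable section

/-! The two defects are functors on the category of `n`-exact sequences, and the duality exists
because, up to variance, both are quotients of that category by the same congruence.

Density: a finitely presented functor that vanishes on projectives is `Coker M(-, f)` with `f` an
epimorphism, and every epimorphism in `M` ends an `n`-exact sequence, built from successive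
`M`-approximations of kernels; Ext vanishing forces the last kernel into `M`
(`exists_lastArrow_iso`, dually `exists_firstArrow_iso`). Fullness: by Yoneda a map of cokernels
comes from a map of arrows, and `n`-exactness extends that to a ladder.

Same congruence: ladders `φ, ψ : S ⟶ T` agree on `δ^*` iff `φⁿ⁺¹ - ψⁿ⁺¹` factors through `Tⁿ ⟶
Tⁿ⁺¹`, and on `δ_*` iff `φ⁰ - ψ⁰` factors through `S⁰ ⟶ S¹`. As Ext between objects of `M` vanishes
in degrees strictly between `0` and `n`, these say that the pullback of the Yoneda class of `T`,
respectively the pushforward of the Yoneda class of `S`, is zero in `Extⁿ(Sⁿ⁺¹, T⁰)`. Naturality of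
the class makes the two elements equal (`contraDefect_map_eq_iff`).

If `Sⁿ` is projective, then `δ^*` is the stable Hom functor of `Sⁿ⁺¹` and `δ_*` is `Extⁿ(Sⁿ⁺¹, -)`,
generated by the Yoneda class; dually if `S¹` is injective. Stable Hom functors are projective
because epimorphisms are pointwise surjective; conversely a projective object is a retract of one,
and Fitting's lemma lifts the idempotent to `M`. The artin hypothesis provides Fitting
decompositions, finitely generated kernels and finitely generated injective hulls. -/

namespace HigherAuslander

/-! ### Full and essentially surjective functors, and quotients by a congruence. -/

section FullDense

variable {N A B : Type*} [Category* N] [Category* A] [Category* B]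

/-- A functor isomorphism after precomposition with a full and essentially surjective functor
descends. -/
def isoOfPrecompIso (L : N ⥤ A) [L.Full] [L.EssSurj] {F G : A ⥤ B} (α : L ⋙ F ≅ L ⋙ G) :
    F ≅ G :=
  NatIso.ofComponents
    (fun X => F.mapIso (L.objObjPreimageIso X).symm ≪≫ α.app _ ≪≫
      G.mapIso (L.objObjPreimageIso X))
    (fun {X Y} f => by
      -- One lift `g` of the conjugate of `f` suffices: naturality of `α` at `g` turns into
      -- naturality at `f` once the conjugation is undone.
      obtain ⟨g, hg⟩ := L.map_surjective
        ((L.objObjPreimageIso X).hom ≫ f ≫ (L.objObjPreimageIso Y).inv)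
      have h := α.hom.naturality g
      have h1 : F.map f ≫ F.map (L.objObjPreimageIso Y).inv =
          F.map (L.objObjPreimageIso X).inv ≫ F.map (L.map g) := by
        rw [hg, ← F.map_comp, ← F.map_comp]; simp
      have h2 : G.map (L.map g) ≫ G.map (L.objObjPreimageIso Y).hom =
          G.map (L.objObjPreimageIso X).hom ≫ G.map f := by
        rw [hg, ← G.map_comp, ← G.map_comp]; simp
      simp only [Functor.comp_map] at h
      simp only [Iso.trans_hom, Functor.mapIso_hom, Iso.symm_hom, Iso.app_hom, Category.assoc]
      rw [reassoc_of% h1, reassoc_of% h, h2])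

/-- Both functors induce equivalences out of the quotient of `N` by the common congruence
`D.homRel`: fullness and density are inherited, and faithfulness is the definition of the
congruence. -/
lemma exists_equivalence_of_homRel_iff (D : N ⥤ A) [D.Full] [D.EssSurj] (G : N ⥤ B) [G.Full]
    [G.EssSurj] (h : ∀ ⦃X Y : N⦄ (f g : X ⟶ Y), D.map f = D.map g ↔ G.map f = G.map g) :
    ∃ S : A ≌ B, Nonempty (D ⋙ S.functor ≅ G) := by
  let q := CategoryTheory.Quotient.functor D.homRel
  let D' : CategoryTheory.Quotient D.homRel ⥤ A :=
    CategoryTheory.Quotient.lift _ D (fun _ _ _ _ h => h)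
  let G' : CategoryTheory.Quotient D.homRel ⥤ B :=
    CategoryTheory.Quotient.lift _ G (fun _ _ _ _ h' => (h _ _).1 h')
  let eD : q ⋙ D' ≅ D := CategoryTheory.Quotient.lift.isLift _ D _
  let eG : q ⋙ G' ≅ G := CategoryTheory.Quotient.lift.isLift _ G _
  have hD : D'.IsEquivalence := {
    full := ⟨fun {X Y} f => by
      obtain ⟨g, hg⟩ := D.map_surjective (X := X.as) (Y := Y.as) f
      exact ⟨q.map g, hg⟩⟩
    faithful := ⟨fun {X Y} f g hfg => by
      obtain ⟨f, rfl⟩ := q.map_surjective f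
      obtain ⟨g, rfl⟩ := q.map_surjective g
      exact CategoryTheory.Quotient.sound _ hfg⟩
    essSurj := ⟨fun Y => ⟨q.obj (D.objPreimage Y), ⟨D.objObjPreimageIso Y⟩⟩⟩ }
  have hG : G'.IsEquivalence := {
    full := ⟨fun {X Y} f => by
      obtain ⟨g, hg⟩ := G.map_surjective (X := X.as) (Y := Y.as) f
      exact ⟨q.map g, hg⟩⟩
    faithful := ⟨fun {X Y} f g hfg => by
      obtain ⟨f, rfl⟩ := q.map_surjective f
      obtain ⟨g, rfl⟩ := q.map_surjective g
      exact CategoryTheory.Quotient.sound _ ((h _ _).2 hfg)⟩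
    essSurj := ⟨fun Y => ⟨q.obj (G.objPreimage Y), ⟨G.objObjPreimageIso Y⟩⟩⟩ }
  refine ⟨D'.asEquivalence.symm.trans G'.asEquivalence, ⟨?_⟩⟩
  exact Functor.isoWhiskerRight eD.symm _ ≪≫ Functor.associator _ _ _ ≪≫
    Functor.isoWhiskerLeft q ((Functor.associator _ _ _).symm ≪≫
      Functor.isoWhiskerRight D'.asEquivalence.unitIso.symm G' ≪≫ Functor.leftUnitor _) ≪≫ eG

lemma injective_obj_op_iff (S : Aᵒᵖ ⥤ B) [S.IsEquivalence] (F : A) :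
    Injective (S.obj (op F)) ↔ Projective F := by
  exact (S.asEquivalence.map_injective_iff (op F)).trans Injective.projective_iff_injective_op.symm

lemma isEquivalence_projToInj (S : Aᵒᵖ ⥤ B) [S.IsEquivalence]
    (h : ∀ F : A, Projective F → Injective (S.obj (op F))) :
    (projToInj S h).IsEquivalence where
  full := by unfold projToInj; infer_instance
  faithful := by unfold projToInj; infer_instance
  essSurj := ⟨fun Y => by
    have hY : Projective (S.objPreimage Y.obj).unop := by
      rw [← injective_obj_op_iff S]
      exact Injective.of_iso (S.objObjPreimageIso Y.obj).symm Y.property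
    exact ⟨op ⟨(S.objPreimage Y.obj).unop, hY⟩,
      ⟨ObjectProperty.isoMk _ (S.objObjPreimageIso Y.obj)⟩⟩⟩

end FullDense

/-! ### Functors given by one generator and one relation; covariant theory, applied to a category
and to its opposite. -/

section Presents

lemma exists_app_of_cokernel_app_eq_zero {D : Type*} [Category* D] {F G : D ⥤ AddCommGrpCat.{v}}
    (α : F ⟶ G) {T : D} (b : G.obj T) (hb : (cokernel.π α).app T b = 0) : ∃ a, α.app T a = b := by
  have h := (ShortComplex.exact_cokernel α).map ((evaluation _ _).obj T)
  rw [ShortComplex.ab_exact_iff] at h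
  exact h b hb

lemma cokernel_app_app_eq_zero {D : Type*} [Category* D] {F G : D ⥤ AddCommGrpCat.{v}}
    (α : F ⟶ G) {T : D} (a : F.obj T) : (cokernel.π α).app T (α.app T a) = 0 := by
  rw [← ConcreteCategory.comp_apply, ← NatTrans.comp_app, cokernel.condition]
  rfl

lemma cokernel_app_surjective {D : Type*} [Category* D] {F G : D ⥤ AddCommGrpCat.{v}}
    (α : F ⟶ G) (T : D) : Function.Surjective ((cokernel.π α).app T) := by
  rw [← AddCommGrpCat.epi_iff_surjective]
  infer_instance

variable {D : Type u} [Category.{v} D] [Preadditive D]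

/-- The element `x : F X` induces an exact sequence `D(X', -) ⟶ D(X, -) ⟶ F ⟶ 0`, where the
first map is given by `g : X ⟶ X'`. -/
structure Presents (F : D ⥤ AddCommGrpCat.{v}) {X X' : D} (g : X ⟶ X') (x : F.obj X) : Prop where
  map_add : ∀ (Y : D) (f f' : X ⟶ Y), F.map (f + f') x = F.map f x + F.map f' x
  surj : ∀ (Y : D) (y : F.obj Y), ∃ f : X ⟶ Y, F.map f x = y
  zero_iff : ∀ (Y : D) (f : X ⟶ Y), F.map f x = 0 ↔ ∃ h : X' ⟶ Y, g ≫ h = f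

namespace Presents

variable {F G : D ⥤ AddCommGrpCat.{v}} {X X' Y Y' : D} {g : X ⟶ X'} {x : F.obj X} {g' : Y ⟶ Y'}
  {y : G.obj Y}

lemma additive (hF : Presents F g x) : F.Additive where
  map_add {Z W f f'} := by
    ext z
    obtain ⟨h, rfl⟩ := hF.surj _ z
    have := hF.map_add _ (h ≫ f) (h ≫ f')
    rw [← Preadditive.comp_add, F.map_comp, F.map_comp, F.map_comp] at this
    exact this

lemma map_sub (hF : Presents F g x) {Z : D} (f f' : X ⟶ Z) :
    F.map (f - f') x = F.map f x - F.map f' x := by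
  have := hF.additive
  rw [F.map_sub]
  rfl

lemma map_eq_iff (hF : Presents F g x) {Z : D} (f f' : X ⟶ Z) :
    F.map f x = F.map f' x ↔ ∃ h : X' ⟶ Z, g ≫ h = f - f' := by
  rw [← hF.zero_iff, hF.map_sub, sub_eq_zero]

lemma map_self (hF : Presents F g x) : F.map g x = 0 :=
  (hF.zero_iff _ _).2 ⟨𝟙 _, Category.comp_id _⟩

lemma hom_ext (hF : Presents F g x) {α β : F ⟶ G} (h : α.app X x = β.app X x) : α = β := by
  ext Z z
  obtain ⟨f, rfl⟩ := hF.surj _ z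
  rw [NatTrans.naturality_apply, NatTrans.naturality_apply, h]

/-- Yoneda for a cokernel: the map sends `F.map f x` to `G.map f z`. Two choices of `f` differ by a
multiple of `g`, which kills `z`, so the arbitrary section `s` is harmless. -/
lemma exists_hom (hF : Presents F g x) [G.Additive] (z : G.obj X) (hz : G.map g z = 0) :
    ∃ α : F ⟶ G, α.app X x = z := by
  choose s hs using hF.surj
  have key : ∀ (Z : D) (f f' : X ⟶ Z), F.map f x = F.map f' x → G.map f z = G.map f' z := by
    intro Z f f' h
    obtain ⟨k, hk⟩ := (hF.map_eq_iff f f').1 h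
    have : G.map (f - f') z = 0 := by
      rw [← hk, G.map_comp]
      simp [hz]
    rw [G.map_sub] at this
    exact sub_eq_zero.1 this
  refine ⟨{ app := fun Z => AddCommGrpCat.ofHom
              (AddMonoidHom.mk' (fun a => G.map (s Z a) z) fun a b => ?_)
            naturality := fun Z W f => ?_ }, ?_⟩
  · rw [← show G.map (s Z a + s Z b) z = G.map (s Z a) z + G.map (s Z b) z by
      rw [G.map_add]; rfl]
    exact key _ _ _ (by rw [hF.map_add, hs, hs, hs])
  · ext a
    change G.map (s W (F.map f a)) z = G.map f (G.map (s Z a) z)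
    rw [← ConcreteCategory.comp_apply, ← G.map_comp]
    refine key _ _ _ ?_
    rw [hs, F.map_comp, ConcreteCategory.comp_apply, hs]
  · change G.map (s X x) z = z
    have h := key X (s X x) (𝟙 X) (by rw [hs]; simp)
    simpa using h

lemma exists_iso {y : G.obj X} (hF : Presents F g x) (hG : Presents G g y) :
    ∃ e : F ≅ G, e.hom.app X x = y := by
  have := hF.additive
  have := hG.additive
  obtain ⟨α, hα⟩ := hF.exists_hom y hG.map_self
  obtain ⟨β, hβ⟩ := hG.exists_hom x hF.map_self
  refine ⟨⟨α, β, hF.hom_ext ?_, hG.hom_ext ?_⟩, hα⟩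
  · simp [hα, hβ]
  · simp [hα, hβ]

lemma of_iso (hF : Presents F g x) (e : F ≅ G) : Presents G g (e.hom.app X x) where
  map_add Y f f' := by
    simp only [← NatTrans.naturality_apply, hF.map_add, _root_.map_add]
  surj Y y := by
    obtain ⟨f, hf⟩ := hF.surj _ (e.inv.app Y y)
    refine ⟨f, ?_⟩
    rw [← NatTrans.naturality_apply, hf]
    simp
  zero_iff Y f := by
    rw [← hF.zero_iff, ← NatTrans.naturality_apply]
    refine ⟨fun h => ?_, fun h => by rw [h, map_zero]⟩
    simpa using congrArg (e.inv.app Y) h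

end Presents

/-- Two families of functors with compatible presentations are naturally isomorphic. -/
lemma nonempty_iso_of_presents {N : Type*} [Category* N] {Φ Ψ : N ⥤ D ⥤ AddCommGrpCat.{v}}
    (X X' : N → D) (g : ∀ S, X S ⟶ X' S) (x : ∀ S, (Φ.obj S).obj (X S))
    (y : ∀ S, (Ψ.obj S).obj (X S)) (hx : ∀ S, Presents (Φ.obj S) (g S) (x S))
    (hy : ∀ S, Presents (Ψ.obj S) (g S) (y S))
    (h : ∀ {S T : N} (φ : S ⟶ T), ∃ u : X T ⟶ X S,
      (Φ.map φ).app _ (x S) = (Φ.obj T).map u (x T) ∧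
      (Ψ.map φ).app _ (y S) = (Ψ.obj T).map u (y T)) : Nonempty (Φ ≅ Ψ) := by
  choose e he using fun S => (hx S).exists_iso (hy S)
  -- Naturality need only be checked on the generator, and there both families transport it along
  -- the same `u`.
  refine ⟨NatIso.ofComponents e fun {S T} φ => (hx S).hom_ext ?_⟩
  obtain ⟨u, hu, hu'⟩ := h φ
  simp [hu, hu', he, NatTrans.naturality_apply]

/-! ### Presented functors that vanish on a class of objects -/

variable (W : ObjectProperty D) {Q : ObjectProperty (D ⥤ AddCommGrpCat.{v})}

/-- `i : X ⟶ P` is a left approximation of `X` by objects satisfying `W`. -/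
def IsLeftApprox {X P : D} (i : X ⟶ P) : Prop :=
  W P ∧ ∀ (P' : D) (f : X ⟶ P'), W P' → ∃ h, i ≫ h = f

/-- Finitely presented functors that vanish on the objects satisfying `W`. -/
def IsPresentedVanishing : ObjectProperty (D ⥤ AddCommGrpCat.{v}) := fun F =>
  (∃ (X X' : D) (g : X ⟶ X') (x : F.obj X), Presents F g x) ∧ ∀ P, W P → IsZero (F.obj P)

variable (D) in
/-- Any two morphisms with the same source factor through a common morphism. -/
def HasJointFactorization : Prop :=
  ∀ {Y A B : D} (g : Y ⟶ A) (u : Y ⟶ B), ∃ (Z : D) (m : Y ⟶ Z), ∀ (T : D) (f : Y ⟶ T),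
    (∃ h, m ≫ h = f) ↔ ∃ (k : A ⟶ T) (l : B ⟶ T), f = g ≫ k + u ≫ l

variable (D) in
/-- Every endomorphism has a Fitting decomposition. -/
def HasFittingDecomposition : Prop :=
  ∀ {X : D} (e : End X), ∃ (Y : D) (r : X ⟶ Y) (s : Y ⟶ X), s ≫ r = 𝟙 Y ∧
    (∃ b : X ⟶ X, r ≫ s = e ≫ b) ∧ ∃ N : ℕ, e ^ N = (e ^ N : X ⟶ X) ≫ r ≫ s

/-- The relations of the cokernel are that of `G` and the arrow `u` representing the image of the
generator of `F`; joint factorization merges `g'` and `u` into a single arrow `m`. -/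
lemma Presents.exists_presents_cokernel (hD : HasJointFactorization D)
    {F G : D ⥤ AddCommGrpCat.{v}} {X X' Y Y' : D} {g : X ⟶ X'} {x : F.obj X} {g' : Y ⟶ Y'}
    {y : G.obj Y} (hF : Presents F g x) (hG : Presents G g' y) (α : F ⟶ G) :
    ∃ (Z : D) (m : Y ⟶ Z), Presents (cokernel α) m ((cokernel.π α).app Y y) := by
  obtain ⟨u, hu⟩ := hG.surj _ (α.app X x)
  obtain ⟨Z, m, hm⟩ := hD g' u
  refine ⟨Z, m, fun T f f' => ?_, fun T b => ?_, fun T f => ?_⟩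
  · simp only [← NatTrans.naturality_apply, hG.map_add, _root_.map_add]
  · obtain ⟨b, rfl⟩ := cokernel_app_surjective α T b
    obtain ⟨f, rfl⟩ := hG.surj _ b
    exact ⟨f, (NatTrans.naturality_apply _ _ _).symm⟩
  · rw [← NatTrans.naturality_apply, hm]
    have := hG.additive
    constructor
    · intro h
      obtain ⟨a, ha⟩ := exists_app_of_cokernel_app_eq_zero α _ h
      obtain ⟨l, rfl⟩ := hF.surj _ a
      rw [NatTrans.naturality_apply, ← hu, ← ConcreteCategory.comp_apply, ← G.map_comp] at ha
      obtain ⟨k, hk⟩ := (hG.map_eq_iff f (u ≫ l)).1 ha.symm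
      exact ⟨k, l, by rw [hk]; abel⟩
    · rintro ⟨k, l, rfl⟩
      rw [hG.map_add, _root_.map_add]
      have h1 : G.map (g' ≫ k) y = 0 := (hG.zero_iff _ _).2 ⟨k, rfl⟩
      have h2 : G.map (u ≫ l) y = α.app T (F.map l x) := by
        rw [NatTrans.naturality_apply, ← hu, ← ConcreteCategory.comp_apply, ← G.map_comp]
      rw [h1, h2, cokernel_app_app_eq_zero, _root_.map_zero, add_zero]

variable {W}

/-- The pointwise cokernel of `α` is again presented and vanishes on `W`, so it belongs to the
subcategory, where the epimorphism `α` forces it to be zero. -/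
lemma surjective_of_epi (hQ : Q = IsPresentedVanishing W) (hD : HasJointFactorization D)
    {F G : Q.FullSubcategory} (α : F ⟶ G) [Epi α] (T : D) :
    Function.Surjective (α.hom.app T) := by
  subst hQ
  obtain ⟨⟨X, X', g, x, hF⟩, -⟩ := F.property
  obtain ⟨⟨Y, Y', g', y, hG⟩, hG0⟩ := G.property
  obtain ⟨Z, m, hm⟩ := hF.exists_presents_cokernel hD hG α.hom
  have hc : IsPresentedVanishing W (cokernel α.hom) := by
    refine ⟨⟨_, _, _, _, hm⟩, fun P hP => ?_⟩
    exact (hG0 P hP).of_epi ((cokernel.π α.hom).app P)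
  let π : G ⟶ ⟨_, hc⟩ := ObjectProperty.homMk (cokernel.π α.hom)
  have hπ : π = 0 := by
    rw [← cancel_epi α, comp_zero]
    exact ObjectProperty.hom_ext _ (cokernel.condition α.hom)
  have h0 : cokernel.π α.hom = 0 := congrArg (fun f => f.hom) hπ
  have : Epi α.hom := Preadditive.epi_of_cokernel_zero h0
  rw [← AddCommGrpCat.epi_iff_surjective]
  infer_instance

/-- A map out of `F` is an element killed by `i`, a condition that is automatic for functors
vanishing at `P`. Lifting against an epimorphism is thus lifting one element. -/
lemma projective_of_presents (hQ : Q = IsPresentedVanishing W) (hD : HasJointFactorization D)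
    (F : Q.FullSubcategory) {X P : D} {i : X ⟶ P} (hP : W P) {x : F.obj.obj X}
    (hF : Presents F.obj i x) : Projective F where
  factors {G' G} α ε _ := by
    obtain ⟨y, hy⟩ := surjective_of_epi hQ hD ε X (α.hom.app X x)
    obtain ⟨⟨_, _, _, _, hG⟩, hG0⟩ := (congrFun hQ _).mp G'.property
    have := hG.additive
    obtain ⟨β, hβ⟩ := hF.exists_hom y
      ((AddCommGrpCat.subsingleton_of_isZero (hG0 P hP)).elim _ _)
    exact ⟨ObjectProperty.homMk β, ObjectProperty.hom_ext _ (hF.hom_ext (by simp [hβ, hy]))⟩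

/-- A projective object is presented by a left approximation, if endomorphisms have Fitting
decompositions. -/
lemma exists_presents_of_projective (hQ : Q = IsPresentedVanishing W)
    (hD : HasFittingDecomposition D) (F : Q.FullSubcategory) [Projective F]
    (hW : ∀ X : D, ∃ (P : D) (i : X ⟶ P) (H : Q.FullSubcategory) (h : H.obj.obj X),
      IsLeftApprox W i ∧ Presents H.obj i h) :
    ∃ Y : D, ∀ (P : D) (i : Y ⟶ P), IsLeftApprox W i → ∃ y : F.obj.obj Y, Presents F.obj i y := by
  obtain ⟨⟨X, X', g, x, hF⟩, hF0⟩ := (congrFun hQ _).mp F.property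
  obtain ⟨P, i, H, h, ⟨hP, hi⟩, hH⟩ := hW X
  have hHadd := hH.additive
  have hFadd := hF.additive
  have F0 : ∀ {P : D} (hP : W P) (a : F.obj.obj P), a = 0 := fun hP a =>
    (AddCommGrpCat.subsingleton_of_isZero (hF0 _ hP)).elim _ _
  obtain ⟨π, hπ⟩ := hH.exists_hom x (F0 hP _)
  let π' : H ⟶ F := ObjectProperty.homMk π
  have hepi : Epi π' := by
    have hs : ∀ T, Function.Surjective (π.app T) := fun T a => by
      obtain ⟨f, rfl⟩ := hF.surj _ a
      exact ⟨H.obj.map f h, by rw [NatTrans.naturality_apply, hπ]⟩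
    have : ∀ T, Epi (π.app T) := fun T => (AddCommGrpCat.epi_iff_surjective _).2 (hs T)
    have : Epi π := NatTrans.epi_of_epi_app _
    exact Q.ι.epi_of_epi_map (f := π') this
  let σ : F.obj ⟶ H.obj := (Projective.factorThru (𝟙 F) π').hom
  have hσπ : σ ≫ π = 𝟙 _ := congrArg (fun f => f.hom) (Projective.factorThru_comp (𝟙 F) π')
  have hσ : ∀ {T : D} (a : F.obj.obj T), π.app T (σ.app T a) = a := fun {T} a => by
    rw [← ConcreteCategory.comp_apply, ← NatTrans.comp_app, hσπ]
    rfl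
  -- `e` represents the idempotent `π ≫ σ` of `H`, but is itself idempotent only modulo the
  -- relation. Fitting's decomposition replaces it by the honest idempotent `r ≫ s`.
  obtain ⟨e, he⟩ := hH.surj _ (σ.app X x)
  have hcomp : ∀ {A B C : D} (f : A ⟶ B) (k : B ⟶ C) (a : H.obj.obj A),
      H.obj.map (f ≫ k) a = H.obj.map k (H.obj.map f a) := fun f k a => by
    rw [H.obj.map_comp]; rfl
  have hcomp' : ∀ {A B C : D} (f : A ⟶ B) (k : B ⟶ C) (a : F.obj.obj A),
      F.obj.map (f ≫ k) a = F.obj.map k (F.obj.map f a) := fun f k a => by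
    rw [F.obj.map_comp]; rfl
  have hex : F.obj.map e x = x := by
    rw [← hπ, ← NatTrans.naturality_apply, he, hσ, hπ]
  set v := σ.app X x with hv
  have hev : H.obj.map e v = v := by
    rw [hv, ← NatTrans.naturality_apply, hex]
  obtain ⟨Y, r, s, hsr, ⟨b, hb⟩, N, hN⟩ := hD (e : End X)
  have hpow : ∀ N : ℕ, H.obj.map (HPow.hPow (α := End X) e N) v = v := by
    intro N
    induction N with
    | zero => rw [pow_zero, End.one_def, H.obj.map_id]; rfl
    | succ k ih => rw [pow_succ, End.mul_def, hcomp, hev, ih]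
  have hpv : H.obj.map (r ≫ s) v = v := by
    have := hpow N
    rw [hN, hcomp, hpow N] at this
    exact this
  -- `r ≫ s` induces the same idempotent of `H` as `e`: since `r ≫ s = e ≫ b` and `e` sends both `h`
  -- and `v` to `v`, the arrow `r ≫ s` has the same value on `h` as on `v`.
  have hph : H.obj.map (r ≫ s) h = v := by
    rw [hb, hcomp, he]
    rw [hb, hcomp, hev] at hpv
    exact hpv
  have hpx : F.obj.map s (F.obj.map r x) = x := by
    rw [← hcomp', ← hπ, ← NatTrans.naturality_apply, hph, hσ, hπ]
  refine ⟨Y, fun P' i' ⟨hP', hi'⟩ => ⟨F.obj.map r x, fun T f f' => ?_, fun T y => ?_,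
    fun T f => ⟨fun hf => ?_, ?_⟩⟩⟩
  · rw [F.obj.map_add]; rfl
  · obtain ⟨f, rfl⟩ := hF.surj _ y
    exact ⟨s ≫ f, by rw [hcomp', hpx]⟩
  · have h1 : H.obj.map (r ≫ f) h = 0 := by
      have : r ≫ f = (r ≫ s) ≫ r ≫ f := by
        rw [Category.assoc, reassoc_of% hsr]
      rw [this, hcomp, hph, hv, ← NatTrans.naturality_apply, hcomp', hf, map_zero]
    obtain ⟨k, hk⟩ := (hH.zero_iff _ _).1 h1
    -- The relation found so far goes through the approximation `i` of `X`; extending `s ≫ i` along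
    -- `i'` moves it to the approximation of the summand `Y`.
    obtain ⟨l, hl⟩ := hi' P (s ≫ i) hP
    refine ⟨l ≫ k, ?_⟩
    rw [reassoc_of% hl, hk, reassoc_of% hsr]
  · rintro ⟨k, rfl⟩
    rw [hcomp', F0 hP' (F.obj.map i' _), map_zero]

end Presents

/-! ### Cokernel functors and stable Hom functors as presented functors. -/

section Interface

variable {C : Type u} [Category.{v} C] [Preadditive C]

/-- The generator of `Coker (C(-, X) ⟶ C(-, Y))`. -/
def contraGen (f : Arrow C) : (contraCoker.obj f).obj (op f.right) :=
  (cokernel.π (preadditiveYoneda.map f.hom)).app (op f.right) (𝟙 f.right)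

/-- The generator of `Coker (C(Y, -) ⟶ C(X, -))`. -/
def coGen (f : Arrow C) : (coCoker.obj (op f)).obj f.left :=
  (cokernel.π (preadditiveCoyoneda.map f.hom.op)).app f.left (𝟙 f.left)

lemma contraCoker_map_contraGen (f : Arrow C) {Y : C} (a : Y ⟶ f.right) :
    (contraCoker.obj f).map a.op (contraGen f) =
      (cokernel.π (preadditiveYoneda.map f.hom)).app (op Y) a := by
  refine (NatTrans.naturality_apply (cokernel.π (preadditiveYoneda.map f.hom)) a.op _).symm.trans ?_
  exact congrArg _ (Category.comp_id a)

lemma coCoker_map_coGen (f : Arrow C) {Y : C} (a : f.left ⟶ Y) :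
    (coCoker.obj (op f)).map a (coGen f) =
      (cokernel.π (preadditiveCoyoneda.map f.hom.op)).app Y a := by
  refine (NatTrans.naturality_apply (cokernel.π (preadditiveCoyoneda.map f.hom.op)) a _).symm.trans ?_
  exact congrArg _ (Category.id_comp a)

lemma presents_contraCoker (f : Arrow C) :
    Presents (contraCoker.obj f) f.hom.op (contraGen f) where
  map_add Y a b := by
    obtain ⟨a, rfl⟩ : ∃ k, a = Quiver.Hom.op k := ⟨a.unop, rfl⟩
    obtain ⟨b, rfl⟩ : ∃ k, b = Quiver.Hom.op k := ⟨b.unop, rfl⟩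
    rw [← op_add, contraCoker_map_contraGen, contraCoker_map_contraGen, contraCoker_map_contraGen]
    exact map_add ((cokernel.π (preadditiveYoneda.map f.hom)).app Y).hom a b
  surj Y y := by
    obtain ⟨a, rfl⟩ := cokernel_app_surjective _ _ y
    exact ⟨Quiver.Hom.op a, contraCoker_map_contraGen f a⟩
  zero_iff Y a := by
    obtain ⟨a, rfl⟩ : ∃ k, a = Quiver.Hom.op k := ⟨a.unop, rfl⟩
    rw [contraCoker_map_contraGen]
    constructor
    · intro h
      obtain ⟨b, hb⟩ := exists_app_of_cokernel_app_eq_zero _ _ h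
      exact ⟨Quiver.Hom.op b, Quiver.Hom.unop_inj hb⟩
    · rintro ⟨b, hb⟩
      obtain rfl : b.unop ≫ f.hom = a := congrArg Quiver.Hom.unop hb
      exact cokernel_app_app_eq_zero (preadditiveYoneda.map f.hom) b.unop

lemma presents_coCoker (f : Arrow C) : Presents (coCoker.obj (op f)) f.hom (coGen f) where
  map_add Y a b := by
    rw [coCoker_map_coGen, coCoker_map_coGen, coCoker_map_coGen]
    exact map_add ((cokernel.π (preadditiveCoyoneda.map f.hom.op)).app Y).hom a b
  surj Y y := by
    obtain ⟨a, rfl⟩ := cokernel_app_surjective _ _ y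
    exact ⟨a, coCoker_map_coGen f a⟩
  zero_iff Y a := by
    rw [coCoker_map_coGen]
    constructor
    · intro h
      obtain ⟨b, hb⟩ := exists_app_of_cokernel_app_eq_zero _ _ h
      exact ⟨b, hb⟩
    · rintro ⟨b, rfl⟩
      exact cokernel_app_app_eq_zero (preadditiveCoyoneda.map f.hom.op) b

lemma contraCoker_map_app_contraGen {f g : Arrow C} (φ : f ⟶ g) :
    (contraCoker.map φ).app _ (contraGen f) = (contraCoker.obj g).map φ.right.op (contraGen g) := by
  rw [contraCoker_map_contraGen]
  have h : cokernel.π (preadditiveYoneda.map f.hom) ≫ contraCoker.map φ =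
      preadditiveYoneda.map φ.right ≫ cokernel.π (preadditiveYoneda.map g.hom) :=
    cokernel.π_desc _ _ _
  have h' := ConcreteCategory.congr_hom (NatTrans.congr_app h (op f.right)) (𝟙 f.right)
  refine h'.trans ?_
  exact congrArg _ (Category.id_comp φ.right)

lemma coCoker_map_app_coGen {f g : Arrow C} (φ : f ⟶ g) :
    (coCoker.map φ.op).app _ (coGen g) = (coCoker.obj (op f)).map φ.left (coGen f) := by
  rw [coCoker_map_coGen]
  have h : cokernel.π (preadditiveCoyoneda.map g.hom.op) ≫ coCoker.map φ.op =
      preadditiveCoyoneda.map φ.left.op ≫ cokernel.π (preadditiveCoyoneda.map f.hom.op) :=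
    cokernel.π_desc _ _ _
  have h' := ConcreteCategory.congr_hom (NatTrans.congr_app h g.left) (𝟙 g.left)
  refine h'.trans ?_
  exact congrArg _ (Category.comp_id φ.left)

lemma isFPContra_iff (F : Cᵒᵖ ⥤ AddCommGrpCat.{v}) :
    IsFPContra F ↔ ∃ (X X' : Cᵒᵖ) (g : X ⟶ X') (x : F.obj X), Presents F g x := by
  constructor
  · rintro ⟨f, ⟨e⟩⟩
    exact ⟨_, _, _, _, (presents_contraCoker f).of_iso e⟩
  · rintro ⟨X, X', g, x, h⟩
    obtain ⟨e, -⟩ := (presents_contraCoker (Arrow.mk g.unop)).exists_iso h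
    exact ⟨_, ⟨e⟩⟩

lemma isFPCo_iff (F : C ⥤ AddCommGrpCat.{v}) :
    IsFPCo F ↔ ∃ (X X' : C) (g : X ⟶ X') (x : F.obj X), Presents F g x := by
  constructor
  · rintro ⟨f, ⟨e⟩⟩
    exact ⟨_, _, _, _, (presents_coCoker f).of_iso e⟩
  · rintro ⟨X, X', g, x, h⟩
    obtain ⟨e, -⟩ := (presents_coCoker (Arrow.mk g)).exists_iso h
    exact ⟨_, ⟨e⟩⟩

/-- Every generator of the ideal factors through the approximation `i`, and the multiples of `i`
already form a subgroup. -/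
lemma mem_factorIdeal_iff_of_left {W : ObjectProperty C} {X P : C} {i : X ⟶ P}
    (hi : IsLeftApprox W i) {Y : C} (f : X ⟶ Y) : f ∈ factorIdeal W X Y ↔ ∃ h, i ≫ h = f := by
  constructor
  · intro hf
    induction hf using AddSubgroup.closure_induction with
    | mem f hf =>
      obtain ⟨Z, a, b, hZ, rfl⟩ := hf
      obtain ⟨h, rfl⟩ := hi.2 Z a hZ
      exact ⟨h ≫ b, by simp⟩
    | zero => exact ⟨0, comp_zero⟩
    | add f g _ _ hf hg =>
      obtain ⟨h, rfl⟩ := hf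
      obtain ⟨k, rfl⟩ := hg
      exact ⟨h + k, by simp⟩
    | neg f _ hf =>
      obtain ⟨h, rfl⟩ := hf
      exact ⟨-h, by simp⟩
  · rintro ⟨h, rfl⟩
    exact AddSubgroup.subset_closure ⟨P, i, h, hi.1, rfl⟩

lemma mem_factorIdeal_iff_of_right {W : ObjectProperty C} {X P : C} {p : P ⟶ X}
    (hp : IsLeftApprox W.op p.op) {Y : C} (f : Y ⟶ X) :
    f ∈ factorIdeal W Y X ↔ ∃ h, h ≫ p = f := by
  constructor
  · intro hf
    induction hf using AddSubgroup.closure_induction with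
    | mem f hf =>
      obtain ⟨Z, a, b, hZ, rfl⟩ := hf
      obtain ⟨h, hh⟩ := hp.2 (op Z) b.op hZ
      exact ⟨a ≫ h.unop, by rw [Category.assoc]; exact congrArg _ (congrArg Quiver.Hom.unop hh)⟩
    | zero => exact ⟨0, zero_comp⟩
    | add f g _ _ hf hg =>
      obtain ⟨h, rfl⟩ := hf
      obtain ⟨k, rfl⟩ := hg
      exact ⟨h + k, by simp⟩
    | neg f _ hf =>
      obtain ⟨h, rfl⟩ := hf
      exact ⟨-h, by simp⟩
  · rintro ⟨h, rfl⟩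
    exact AddSubgroup.subset_closure ⟨P, h, p, hp.1, rfl⟩

/-- The class of the identity. -/
def stableId (W : ObjectProperty C) (X : C) : ((stableHom W).obj (op X)).obj X :=
  QuotientAddGroup.mk (𝟙 X)

lemma stableHom_map_stableId (W : ObjectProperty C) {X Y : C} (f : X ⟶ Y) :
    ((stableHom W).obj (op X)).map f (stableId W X) = QuotientAddGroup.mk f :=
  congrArg QuotientAddGroup.mk (Category.id_comp f)

lemma stableHom_flip_map_stableId (W : ObjectProperty C) {X Y : C} (f : Y ⟶ X) :
    ((stableHom W).flip.obj X).map f.op (stableId W X) = QuotientAddGroup.mk f :=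
  congrArg QuotientAddGroup.mk (Category.comp_id f)

lemma presents_stableHom {W : ObjectProperty C} {X P : C} {i : X ⟶ P} (hi : IsLeftApprox W i) :
    Presents ((stableHom W).obj (op X)) i (stableId W X) where
  map_add Y f f' := by
    rw [stableHom_map_stableId, stableHom_map_stableId, stableHom_map_stableId]
    rfl
  surj Y y := by
    obtain ⟨f, rfl⟩ := QuotientAddGroup.mk_surjective y
    exact ⟨f, stableHom_map_stableId W f⟩
  zero_iff Y f := by
    rw [stableHom_map_stableId, ← mem_factorIdeal_iff_of_left hi]
    exact QuotientAddGroup.eq_zero_iff f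

lemma presents_stableHom_flip {W : ObjectProperty C} {X P : C} {p : P ⟶ X}
    (hp : IsLeftApprox W.op p.op) :
    Presents ((stableHom W).flip.obj X) p.op (stableId W X) where
  map_add Y f f' := by
    obtain ⟨f, rfl⟩ : ∃ k, f = Quiver.Hom.op k := ⟨f.unop, rfl⟩
    obtain ⟨f', rfl⟩ : ∃ k, f' = Quiver.Hom.op k := ⟨f'.unop, rfl⟩
    rw [← op_add, stableHom_flip_map_stableId, stableHom_flip_map_stableId,
      stableHom_flip_map_stableId]
    rfl
  surj Y y := by
    obtain ⟨f, rfl⟩ := QuotientAddGroup.mk_surjective y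
    exact ⟨Quiver.Hom.op f, stableHom_flip_map_stableId W f⟩
  zero_iff Y f := by
    obtain ⟨f, rfl⟩ : ∃ k, f = Quiver.Hom.op k := ⟨f.unop, rfl⟩
    rw [stableHom_flip_map_stableId]
    refine (QuotientAddGroup.eq_zero_iff f).trans ((mem_factorIdeal_iff_of_right hp f).trans ?_)
    exact ⟨fun ⟨h, hh⟩ => ⟨h.op, congrArg Quiver.Hom.op hh⟩,
      fun ⟨h, hh⟩ => ⟨h.unop, congrArg Quiver.Hom.unop hh⟩⟩

lemma stableHom_map_app_stableId (W : ObjectProperty C) {X Y : C} (f : X ⟶ Y) :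
    ((stableHom W).map f.op).app _ (stableId W Y) =
      ((stableHom W).obj (op X)).map f (stableId W X) :=
  (stableHom_flip_map_stableId W f).trans (stableHom_map_stableId W f).symm

lemma stableHom_flip_map_app_stableId (W : ObjectProperty C) {X Y : C} (f : X ⟶ Y) :
    ((stableHom W).flip.map f).app _ (stableId W X) =
      ((stableHom W).flip.obj Y).map f.op (stableId W Y) :=
  (stableHom_map_stableId W f).trans (stableHom_flip_map_stableId W f).symm

end Interface

section

variable {Λ : Type u} [Ring Λ] (M : ObjectProperty (ModuleCat.{u} Λ))

lemma isModUnder_eq : IsModUnder M = IsPresentedVanishing (projObj M).op := by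
  ext F
  exact and_congr (isFPContra_iff F)
    ⟨fun h P hP => h P.unop hP, fun h P hP => h (op P) hP⟩

lemma isOverMod_eq : IsOverMod M = IsPresentedVanishing (injObj M) := by
  ext F
  exact and_congr (isFPCo_iff F) Iff.rfl

end

open Abelian

/-! ### Yoneda classes of long exact sequences. -/

section LongExact

variable {A : Type u} [Category.{v} A] [Abelian A] {n : ℕ}

/-- The sequence `0 ⟶ S⁰ ⟶ S¹ ⟶ ⋯ ⟶ Sⁿ⁺¹ ⟶ 0` is exact. -/
structure IsLongExact (S : ComposableArrows A (n + 1)) : Prop where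
  exact : S.Exact
  mono : Mono (S.map' 0 1)
  epi : Epi (S.map' n (n + 1))

variable {S T : ComposableArrows A (n + 1)}

variable (S) in
/-- The image of `Sⁱ ⟶ Sⁱ⁺¹`. -/
def imageObj (i : ℕ) (hi : i ≤ n := by omega) : A := image (S.map' i (i + 1))

variable (S) in
/-- The inclusion of the image of `Sⁱ ⟶ Sⁱ⁺¹` into `Sⁱ⁺¹`. -/
def imageIncl (i : ℕ) (hi : i ≤ n := by omega) : imageObj S i ⟶ S.obj' (i + 1) :=
  image.ι (S.map' i (i + 1))

variable (S) in
/-- The projection of `Sⁱ` onto the image of `Sⁱ ⟶ Sⁱ⁺¹`. -/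
def imageProj (i : ℕ) (hi : i ≤ n := by omega) : S.obj' i ⟶ imageObj S i :=
  factorThruImage (S.map' i (i + 1))

@[simp]
lemma imageProj_comp_imageIncl (i : ℕ) (hi : i ≤ n) :
    imageProj S i hi ≫ imageIncl S i hi = S.map' i (i + 1) :=
  image.fac _

instance (i : ℕ) (hi : i ≤ n) : Mono (imageIncl S i hi) :=
  inferInstanceAs (Mono (Limits.image.ι (S.map (homOfLE _))))

instance (i : ℕ) (hi : i ≤ n) : Epi (imageProj S i hi) :=
  inferInstanceAs (Epi (factorThruImage (S.map (homOfLE _))))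

lemma IsLongExact.isIso_imageIncl (hS : IsLongExact S) : IsIso (imageIncl S n le_rfl) := by
  have := hS.epi
  have : Epi (imageIncl S n le_rfl) := by
    have h : Epi (imageProj S n le_rfl ≫ imageIncl S n le_rfl) := by
      rw [imageProj_comp_imageIncl]; exact hS.epi
    exact epi_of_epi (imageProj S n le_rfl) _
  exact isIso_of_mono_of_epi _

lemma IsLongExact.isIso_imageProj (hS : IsLongExact S) : IsIso (imageProj S 0 (Nat.zero_le n)) := by
  have : Mono (imageProj S 0 (Nat.zero_le n)) := by
    have h : Mono (imageProj S 0 (Nat.zero_le n) ≫ imageIncl S 0 (Nat.zero_le n)) := by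
      rw [imageProj_comp_imageIncl]; exact hS.mono
    exact mono_of_mono _ (imageIncl S 0 (Nat.zero_le n))
  exact isIso_of_mono_of_epi _

lemma imageIncl_comp_imageProj (hS : S.IsComplex) (i : ℕ) (hi : i + 1 ≤ n) :
    imageIncl S i ≫ imageProj S (i + 1) = 0 := by
  rw [← cancel_epi (imageProj S i), ← cancel_mono (imageIncl S (i + 1)), comp_zero, zero_comp,
    Category.assoc, Category.assoc, imageProj_comp_imageIncl, ← Category.assoc,
    imageProj_comp_imageIncl]
  exact hS.zero i

/-- The short exact sequence `0 ⟶ Im dⁱ ⟶ Sⁱ⁺¹ ⟶ Im dⁱ⁺¹ ⟶ 0`. -/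
abbrev imageSC (hS : S.IsComplex) (i : ℕ) (hi : i + 1 ≤ n) : ShortComplex A :=
  ShortComplex.mk (imageIncl S i) (imageProj S (i + 1)) (imageIncl_comp_imageProj hS i hi)

/-- Exactness at the middle term is unchanged when the left term is replaced along an epimorphism
(`φ`) or the right term along a monomorphism (`ψ`). -/
lemma imageSC_shortExact (hS : S.Exact) (i : ℕ) (hi : i + 1 ≤ n) :
    (imageSC hS.toIsComplex i hi).ShortExact where
  exact := by
    let φ : S.sc hS.toIsComplex i ⟶ ShortComplex.mk (imageIncl S i) (S.map' (i + 1) (i + 2))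
        (by rw [← imageProj_comp_imageIncl (i + 1) hi, ← Category.assoc,
          imageIncl_comp_imageProj hS.toIsComplex i hi, zero_comp]) :=
      { τ₁ := imageProj S i, τ₂ := 𝟙 _, τ₃ := 𝟙 _ }
    let ψ : imageSC hS.toIsComplex i hi ⟶ ShortComplex.mk (imageIncl S i) (S.map' (i + 1) (i + 2))
        (by rw [← imageProj_comp_imageIncl (i + 1) hi, ← Category.assoc,
          imageIncl_comp_imageProj hS.toIsComplex i hi, zero_comp]) :=
      { τ₁ := 𝟙 _, τ₂ := 𝟙 _, τ₃ := imageIncl S (i + 1) }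
    have : Epi φ.τ₁ := inferInstanceAs (Epi (imageProj S i))
    have : IsIso φ.τ₂ := inferInstanceAs (IsIso (𝟙 _))
    have : Mono φ.τ₃ := inferInstanceAs (Mono (𝟙 _))
    have : Epi ψ.τ₁ := inferInstanceAs (Epi (𝟙 _))
    have : IsIso ψ.τ₂ := inferInstanceAs (IsIso (𝟙 _))
    have : Mono ψ.τ₃ := inferInstanceAs (Mono (imageIncl S (i + 1)))
    rw [ShortComplex.exact_iff_of_epi_of_isIso_of_mono ψ,
      ← ShortComplex.exact_iff_of_epi_of_isIso_of_mono φ]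
    exact hS.exact i

/-- The map induced on images by a morphism of sequences. -/
def imageMap (φ : S ⟶ T) (i : ℕ) (hi : i ≤ n := by omega) : imageObj S i ⟶ imageObj T i :=
  image.map (f := Arrow.mk (S.map' i (i + 1))) (g := Arrow.mk (T.map' i (i + 1)))
    (Arrow.homMk (ComposableArrows.app' φ i) (ComposableArrows.app' φ (i + 1))
      (ComposableArrows.naturality' φ i (i + 1)).symm)

lemma imageMap_comp_imageIncl (φ : S ⟶ T) (i : ℕ) (hi : i ≤ n) :
    imageMap φ i ≫ imageIncl T i = imageIncl S i ≫ ComposableArrows.app' φ (i + 1) :=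
  image.map_ι _

lemma imageProj_comp_imageMap (φ : S ⟶ T) (i : ℕ) (hi : i ≤ n) :
    imageProj S i ≫ imageMap φ i = ComposableArrows.app' φ i ≫ imageProj T i :=
  image.factor_map (f := Arrow.mk (S.map' i (i + 1))) (g := Arrow.mk (T.map' i (i + 1)))
    (Arrow.homMk (ComposableArrows.app' φ i) (ComposableArrows.app' φ (i + 1))
      (ComposableArrows.naturality' φ i (i + 1)).symm)

variable [HasExt.{w} A]

/-- The class of `0 ⟶ Im dⁱ ⟶ Sⁱ⁺¹ ⟶ Im dⁱ⁺¹ ⟶ 0`. -/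
def imageClass (hS : S.Exact) (i : ℕ) (hi : i + 1 ≤ n) :
    Ext.{w} (imageObj S (i + 1)) (imageObj S i) 1 :=
  (imageSC_shortExact hS i hi).extClass

lemma imageClass_naturality (hS : S.Exact) (hT : T.Exact) (φ : S ⟶ T) (i : ℕ) (hi : i + 1 ≤ n) :
    (imageClass hS i hi).comp (Ext.mk₀ (imageMap φ i)) (add_zero 1) =
      (Ext.mk₀ (imageMap φ (i + 1))).comp (imageClass hT i hi) (zero_add 1) :=
  ShortComplex.ShortExact.extClass_naturality (imageSC_shortExact hS i hi)
    (imageSC_shortExact hT i hi)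
    { τ₁ := imageMap φ i
      τ₂ := ComposableArrows.app' φ (i + 1)
      τ₃ := imageMap φ (i + 1)
      comm₁₂ := imageMap_comp_imageIncl φ i (by omega)
      comm₂₃ := (imageProj_comp_imageMap φ (i + 1) hi).symm }

section Sequences

variable (hS : S.Exact) {i : ℕ} (hi : i + 1 ≤ n) {k k' : ℕ}

lemma exists_of_comp_imageClass_eq_zero {X : A} (z : Ext.{w} X (imageObj S (i + 1)) k)
    (hk : k + 1 = k') (hz : z.comp (imageClass hS i hi) hk = 0) :
    ∃ y : Ext X (S.obj' (i + 1)) k, y.comp (Ext.mk₀ (imageProj S (i + 1))) (add_zero k) = z :=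
  Ext.covariant_sequence_exact₃ X (imageSC_shortExact hS i hi) z hk hz

lemma exists_comp_imageClass_eq {X : A} (z : Ext.{w} X (imageObj S i) k')
    (hk : k + 1 = k') (hz : z.comp (Ext.mk₀ (imageIncl S i)) (add_zero k') = 0) :
    ∃ y : Ext X (imageObj S (i + 1)) k, y.comp (imageClass hS i hi) hk = z :=
  Ext.covariant_sequence_exact₁ X (imageSC_shortExact hS i hi) z hz hk

lemma exists_of_imageClass_comp_eq_zero {Y : A} (z : Ext.{w} (imageObj S i) Y k)
    (hk : 1 + k = k') (hz : (imageClass hS i hi).comp z hk = 0) :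
    ∃ y : Ext (S.obj' (i + 1)) Y k, (Ext.mk₀ (imageIncl S i)).comp y (zero_add k) = z :=
  Ext.contravariant_sequence_exact₁ (imageSC_shortExact hS i hi) Y z hk hz

lemma exists_imageClass_comp_eq {Y : A} (z : Ext.{w} (imageObj S (i + 1)) Y k')
    (hk : 1 + k = k') (hz : (Ext.mk₀ (imageProj S (i + 1))).comp z (zero_add k') = 0) :
    ∃ y : Ext (imageObj S i) Y k, (imageClass hS i hi).comp y hk = z :=
  Ext.contravariant_sequence_exact₃ (imageSC_shortExact hS i hi) Y z hz hk

lemma imageClass_comp_mk₀_imageIncl_comp {Y : A} (y : Ext.{w} (S.obj' (i + 1)) Y k)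
    (hk : 1 + k = k') :
    (imageClass hS i hi).comp ((Ext.mk₀ (imageIncl S i)).comp y (zero_add k)) hk = 0 :=
  (imageSC_shortExact hS i hi).extClass_comp_assoc y

lemma mk₀_imageProj_comp_imageClass :
    (Ext.mk₀ (imageProj S (i + 1))).comp (imageClass hS i hi) (zero_add 1) = 0 :=
  (imageSC_shortExact hS i hi).comp_extClass

end Sequences

/-- The product of the classes of the first `i` short exact sequences. -/
def partialClass (hS : S.Exact) : ∀ (i : ℕ) (hi : i ≤ n), Ext.{w} (imageObj S i) (imageObj S 0) i
  | 0, _ => Ext.mk₀ (𝟙 _)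
  | i + 1, hi => (imageClass hS i hi).comp (partialClass hS i (by omega)) (add_comm 1 i)

lemma partialClass_naturality (hS : S.Exact) (hT : T.Exact) (φ : S ⟶ T) :
    ∀ (i : ℕ) (hi : i ≤ n),
    (partialClass.{w} hS i hi).comp (Ext.mk₀ (imageMap φ 0)) (add_zero i) =
      (Ext.mk₀ (imageMap φ i)).comp (partialClass hT i hi) (zero_add i)
  | 0, _ => by simp [partialClass]
  | i + 1, hi => by
    rw [partialClass, Ext.comp_assoc_of_third_deg_zero, partialClass_naturality hS hT φ i,
      partialClass, ← Ext.comp_assoc_of_second_deg_zero, imageClass_naturality hS hT φ i hi,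
      Ext.comp_assoc (a₁₂ := 1) (a₂₃ := i + 1)]
    all_goals omega

/-- The one-step classes are peeled off from the right end of the sequence. Each time the
obstruction comes from `Extⁱ⁺¹(Sⁱ⁺², Y) = 0`; what remains is a single class, whose product with `f`
is the obstruction to extending `f` from `Im d⁰` to `S¹`. -/
lemma partialClass_comp_eq_zero_imp (hS : S.Exact) {Y : A} (f : imageObj S 0 ⟶ Y)
    (hY : ∀ i (hi : i ≤ n + 1) k, 0 < k → k < n → Subsingleton (Ext.{w} (S.obj' i) Y k)) :
    ∀ (i : ℕ) (hi : i + 1 ≤ n),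
      (partialClass.{w} hS (i + 1) hi).comp (Ext.mk₀ f) (add_zero _) = 0 →
      ∃ h : S.obj' 1 ⟶ Y, imageIncl S 0 ≫ h = f
  | 0, hi, h => by
    simp only [partialClass, Ext.comp_mk₀_id] at h
    obtain ⟨y, hy⟩ := exists_of_imageClass_comp_eq_zero hS hi (Ext.mk₀ f) (add_zero 1) h
    obtain ⟨y, rfl⟩ := (Ext.mk₀_bijective _ _).2 y
    rw [Ext.mk₀_comp_mk₀] at hy
    exact ⟨y, (Ext.mk₀_bijective _ _).1 hy⟩
  | i + 1, hi, h => by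
    rw [partialClass, Ext.comp_assoc_of_third_deg_zero] at h
    obtain ⟨y, hy⟩ := exists_of_imageClass_comp_eq_zero hS hi _ _ h
    refine partialClass_comp_eq_zero_imp hS f hY i (by omega) ?_
    have := hY (i + 1 + 1) (by omega) (i + 1) (by omega) (by omega)
    rw [← hy, Subsingleton.elim y 0, Ext.comp_zero]

lemma partialClass_comp_eq_zero (hS : S.Exact) {Y : A} (h : S.obj' 1 ⟶ Y) :
    ∀ (i : ℕ) (hi : i + 1 ≤ n),
      (partialClass.{w} hS (i + 1) hi).comp (Ext.mk₀ (imageIncl S 0 ≫ h)) (add_zero _) = 0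
  | 0, hi => by
    simp only [partialClass, Ext.comp_mk₀_id]
    rw [← Ext.mk₀_comp_mk₀]
    exact imageClass_comp_mk₀_imageIncl_comp hS hi _ _
  | i + 1, hi => by
    rw [partialClass, Ext.comp_assoc_of_third_deg_zero, partialClass_comp_eq_zero hS h i,
      Ext.comp_zero]

/-- Only the outermost step needs the hypothesis on `z`; at the inner ones the corresponding element
lies in an Ext group of degree strictly between `0` and `n`, hence is zero. -/
lemma exists_partialClass_comp_eq (hS : S.Exact) {Y : A}
    (hY : ∀ i (hi : i ≤ n + 1) k, 0 < k → k < n → Subsingleton (Ext.{w} (S.obj' i) Y k)) :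
    ∀ (i : ℕ) (hi : i + 1 ≤ n) (z : Ext (imageObj S (i + 1)) Y (i + 1))
      (_ : (Ext.mk₀ (imageProj S (i + 1))).comp z (zero_add _) = 0),
      ∃ f, (partialClass.{w} hS (i + 1) hi).comp (Ext.mk₀ f) (add_zero _) = z
  | 0, hi, z, hz => by
    obtain ⟨y, hy⟩ := exists_imageClass_comp_eq hS hi z (add_zero 1) hz
    obtain ⟨y, rfl⟩ := (Ext.mk₀_bijective _ _).2 y
    refine ⟨y, ?_⟩
    simpa only [partialClass, Ext.comp_mk₀_id] using hy
  | i + 1, hi, z, hz => by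
    obtain ⟨y, rfl⟩ := exists_imageClass_comp_eq hS hi z (add_comm _ _) hz
    have := hY (i + 1) (by omega) (i + 1) (by omega) (by omega)
    obtain ⟨f, rfl⟩ := exists_partialClass_comp_eq hS hY i (by omega) y (Subsingleton.elim _ _)
    exact ⟨f, by rw [partialClass, Ext.comp_assoc_of_third_deg_zero]⟩

/-- At each step the kernel is the image of `Extʲ(X, Sⁱ⁺¹)`, which vanishes for `0 < j < n`. Degree
`j = 0` is a genuine exception; the next lemma treats it by splitting off one class and using
injectivity from degree `1`. -/
lemma comp_partialClass_injective (hS : S.Exact) {X : A}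
    (hX : ∀ i (hi : i ≤ n + 1) k, 0 < k → k < n → Subsingleton (Ext.{w} X (S.obj' i) k)) :
    ∀ (i : ℕ) (hi : i ≤ n) (j m : ℕ) (_ : j + i = m) (_ : m ≤ n) (_ : 0 < j)
      (z : Ext X (imageObj S i) j), z.comp (partialClass.{w} hS i hi) ‹_› = 0 → z = 0
  | 0, _, j, m, hm, _, _, z, hz => by
    obtain rfl : j = m := hm
    simpa [partialClass] using hz
  | i + 1, hi, j, m, hm, hmn, hj, z, hz => by
    rw [partialClass, ← Ext.comp_assoc (a₁₂ := j + 1) _ _ _ rfl (by omega) (by omega)] at hz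
    have h := comp_partialClass_injective hS hX i (by omega) (j + 1) m (by omega) hmn (by omega)
      _ hz
    obtain ⟨y, rfl⟩ := exists_of_comp_imageClass_eq_zero hS hi z rfl h
    have := hX (i + 1) (by omega) j hj (by omega)
    rw [Subsingleton.elim y 0, Ext.zero_comp]

lemma mk₀_comp_partialClass_eq_zero_imp (hS : S.Exact) {X : A}
    (hX : ∀ i (hi : i ≤ n + 1) k, 0 < k → k < n → Subsingleton (Ext.{w} X (S.obj' i) k))
    (i : ℕ) (hi : i + 1 ≤ n) (g : X ⟶ imageObj S (i + 1))
    (hg : (Ext.mk₀ g).comp (partialClass.{w} hS (i + 1) hi) (zero_add _) = 0) :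
    ∃ h : X ⟶ S.obj' (i + 1), h ≫ imageProj S (i + 1) = g := by
  rw [partialClass, ← Ext.comp_assoc (a₁₂ := 1) _ _ _ (by omega) (by omega) (by omega)] at hg
  have h := comp_partialClass_injective hS hX i (by omega) 1 (i + 1) (by omega) hi (by omega)
    _ hg
  obtain ⟨y, hy⟩ := exists_of_comp_imageClass_eq_zero hS hi _ _ h
  obtain ⟨y, rfl⟩ := (Ext.mk₀_bijective _ _).2 y
  rw [Ext.mk₀_comp_mk₀] at hy
  exact ⟨y, (Ext.mk₀_bijective _ _).1 hy⟩

lemma mk₀_comp_partialClass_eq_zero (hS : S.Exact) {X : A} (i : ℕ) (hi : i + 1 ≤ n)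
    (h : X ⟶ S.obj' (i + 1)) :
    (Ext.mk₀ (h ≫ imageProj S (i + 1))).comp (partialClass.{w} hS (i + 1) hi) (zero_add _) = 0 := by
  rw [partialClass, ← Ext.comp_assoc (a₁₂ := 1) _ _ _ (by omega) (by omega) (by omega),
    ← Ext.mk₀_comp_mk₀, Ext.comp_assoc_of_second_deg_zero, mk₀_imageProj_comp_imageClass,
    Ext.comp_zero, Ext.zero_comp]

/-- `hz` is needed only at `i = 0`, where the obstruction lies in `Extⁿ(X, S¹)`; afterwards the
obstructions have degree strictly between `0` and `n`. -/
lemma exists_comp_partialClass_eq (hS : S.Exact) {X : A}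
    (hX : ∀ i (hi : i ≤ n + 1) k, 0 < k → k < n → Subsingleton (Ext.{w} X (S.obj' i) k))
    (z : Ext X (imageObj S 0) n) (hz : z.comp (Ext.mk₀ (imageIncl S 0)) (add_zero n) = 0) :
    ∀ (i : ℕ) (hi : i ≤ n) (j : ℕ) (_ : j + i = n),
      ∃ y : Ext X (imageObj S i) j, y.comp (partialClass.{w} hS i hi) ‹_› = z
  | 0, _, j, hj => by
    obtain rfl : j = n := hj
    exact ⟨z, by simp [partialClass]⟩
  | i + 1, hi, j, hj => by
    obtain ⟨y, hy⟩ := exists_comp_partialClass_eq hS hX z hz i (by omega) (j + 1) (by omega)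
    have hy' : y.comp (Ext.mk₀ (imageIncl S i)) (add_zero _) = 0 := by
      obtain rfl | hi' := Nat.eq_zero_or_pos i
      · obtain rfl : j + 1 = n := hj
        have : y = z := by simpa [partialClass] using hy
        rw [this, hz]
      · have := hX (i + 1) (by omega) (j + 1) (by omega) (by omega)
        exact Subsingleton.elim _ _
    obtain ⟨x, rfl⟩ := exists_comp_imageClass_eq hS hi y rfl hy'
    refine ⟨x, ?_⟩
    rw [← hy, partialClass, Ext.comp_assoc]
    omega

/-- The Yoneda class in `Extⁿ(Sⁿ⁺¹, S⁰)` of an exact sequence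
`0 ⟶ S⁰ ⟶ S¹ ⟶ ⋯ ⟶ Sⁿ⁺¹ ⟶ 0`. -/
def yonedaClass (hS : IsLongExact S) : Ext.{w} (S.obj' (n + 1)) (S.obj' 0) n :=
  have := hS.isIso_imageIncl
  have := hS.isIso_imageProj
  (Ext.mk₀ (inv (imageIncl S n le_rfl))).comp ((partialClass hS.exact n le_rfl).comp
    (Ext.mk₀ (inv (imageProj S 0 (Nat.zero_le n)))) (add_zero n)) (zero_add n)

lemma yonedaClass_naturality (hS : IsLongExact S) (hT : IsLongExact T) (φ : S ⟶ T) :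
    (yonedaClass.{w} hS).comp (Ext.mk₀ (ComposableArrows.app' φ 0)) (add_zero n) =
      (Ext.mk₀ (ComposableArrows.app' φ (n + 1))).comp (yonedaClass hT) (zero_add n) := by
  have := hS.isIso_imageIncl
  have := hS.isIso_imageProj
  have := hT.isIso_imageIncl
  have := hT.isIso_imageProj
  have h1 : inv (imageProj S 0 (Nat.zero_le n)) ≫ ComposableArrows.app' φ 0 =
      imageMap φ 0 (Nat.zero_le n) ≫ inv (imageProj T 0 (Nat.zero_le n)) := by
    rw [IsIso.inv_comp_eq, ← Category.assoc, IsIso.eq_comp_inv, imageProj_comp_imageMap]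
  have h2 : ComposableArrows.app' φ (n + 1) le_rfl ≫ inv (imageIncl T n le_rfl) =
      inv (imageIncl S n le_rfl) ≫ imageMap φ n le_rfl := by
    rw [IsIso.eq_inv_comp, ← Category.assoc, IsIso.comp_inv_eq, imageMap_comp_imageIncl]
  simp only [yonedaClass, Ext.comp_assoc_of_third_deg_zero, Ext.mk₀_comp_mk₀, h1,
    Ext.mk₀_comp_mk₀_assoc, h2]
  rw [← Ext.mk₀_comp_mk₀, ← Ext.comp_assoc_of_third_deg_zero (partialClass _ _ _),
    partialClass_naturality hS.exact hT.exact φ, ← Ext.mk₀_comp_mk₀_assoc,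
    Ext.comp_assoc_of_third_deg_zero]

variable (hS : IsLongExact S)

lemma mk₀_comp_eq_zero_iff_of_isIso {X Y Z : A} (f : X ⟶ Y) [IsIso f] {k : ℕ} (z : Ext.{w} Y Z k) :
    (Ext.mk₀ f).comp z (zero_add k) = 0 ↔ z = 0 := by
  refine ⟨fun h => ?_, fun h => by rw [h, Ext.comp_zero]⟩
  have := congrArg (fun t => (Ext.mk₀ (inv f)).comp t (zero_add k)) h
  simpa using this

lemma comp_mk₀_eq_zero_iff_of_isIso {X Y Z : A} (f : Y ⟶ Z) [IsIso f] {k : ℕ} (z : Ext.{w} X Y k) :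
    z.comp (Ext.mk₀ f) (add_zero k) = 0 ↔ z = 0 := by
  refine ⟨fun h => ?_, fun h => by rw [h, Ext.zero_comp]⟩
  have := congrArg (fun t => t.comp (Ext.mk₀ (inv f)) (add_zero k)) h
  simpa using this

/-- Together with the next lemma this is the exactness of `Hom(S¹, Y) ⟶ Hom(S⁰, Y) ⟶ Extⁿ(Sⁿ⁺¹, Y) ⟶
Extⁿ(Sⁿ, Y)`; the two lemmas after that give the dual sequence. -/
lemma yonedaClass_comp_eq_zero_iff (hn : 1 ≤ n) {Y : A} (f : S.obj' 0 ⟶ Y)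
    (hY : ∀ i (hi : i ≤ n + 1) k, 0 < k → k < n → Subsingleton (Ext.{w} (S.obj' i) Y k)) :
    (yonedaClass.{w} hS).comp (Ext.mk₀ f) (add_zero n) = 0 ↔ ∃ h : S.obj' 1 ⟶ Y, S.map' 0 1 ≫ h = f := by
  have := hS.isIso_imageIncl
  have := hS.isIso_imageProj
  obtain ⟨m, rfl⟩ := Nat.exists_eq_add_of_le' hn
  simp only [yonedaClass, Ext.comp_assoc_of_third_deg_zero, mk₀_comp_eq_zero_iff_of_isIso,
    Ext.mk₀_comp_mk₀]
  constructor
  · intro h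
    obtain ⟨h, hh⟩ := partialClass_comp_eq_zero_imp hS.exact _ hY m le_rfl h
    exact ⟨h, by rw [← imageProj_comp_imageIncl 0 (by omega), Category.assoc, hh,
      IsIso.hom_inv_id_assoc]⟩
  · rintro ⟨h, rfl⟩
    rw [← imageProj_comp_imageIncl 0 (by omega), Category.assoc, IsIso.inv_hom_id_assoc]
    exact partialClass_comp_eq_zero hS.exact h m le_rfl

lemma exists_yonedaClass_comp_eq (hn : 1 ≤ n) {Y : A}
    (hY : ∀ i (hi : i ≤ n + 1) k, 0 < k → k < n → Subsingleton (Ext.{w} (S.obj' i) Y k))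
    (z : Ext.{w} (S.obj' (n + 1)) Y n)
    (hz : (Ext.mk₀ (S.map' n (n + 1))).comp z (zero_add n) = 0) :
    ∃ f, (yonedaClass.{w} hS).comp (Ext.mk₀ f) (add_zero n) = z := by
  have := hS.isIso_imageIncl
  have := hS.isIso_imageProj
  obtain ⟨m, rfl⟩ := Nat.exists_eq_add_of_le' hn
  obtain ⟨f, hf⟩ := exists_partialClass_comp_eq hS.exact hY m le_rfl
    ((Ext.mk₀ (imageIncl S (m + 1))).comp z (zero_add _)) (by
      rw [Ext.mk₀_comp_mk₀_assoc, imageProj_comp_imageIncl, hz])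
  refine ⟨imageProj S 0 ≫ f, ?_⟩
  simp only [yonedaClass, Ext.comp_assoc_of_third_deg_zero, Ext.mk₀_comp_mk₀,
    IsIso.inv_hom_id_assoc, hf]
  simp

lemma comp_yonedaClass_eq_zero_iff (hn : 1 ≤ n) {X : A} (g : X ⟶ S.obj' (n + 1))
    (hX : ∀ i (hi : i ≤ n + 1) k, 0 < k → k < n → Subsingleton (Ext.{w} X (S.obj' i) k)) :
    (Ext.mk₀ g).comp (yonedaClass.{w} hS) (zero_add n) = 0 ↔
      ∃ h : X ⟶ S.obj' n, h ≫ S.map' n (n + 1) = g := by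
  have := hS.isIso_imageIncl
  have := hS.isIso_imageProj
  obtain ⟨m, rfl⟩ := Nat.exists_eq_add_of_le' hn
  simp only [yonedaClass, ← Ext.comp_assoc_of_third_deg_zero, comp_mk₀_eq_zero_iff_of_isIso,
    Ext.mk₀_comp_mk₀_assoc]
  constructor
  · intro h
    obtain ⟨h, hh⟩ := mk₀_comp_partialClass_eq_zero_imp hS.exact hX m le_rfl _ h
    exact ⟨h, by rw [← imageProj_comp_imageIncl (m + 1) (by omega), ← Category.assoc, hh,
      Category.assoc, IsIso.inv_hom_id, Category.comp_id]⟩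
  · rintro ⟨h, rfl⟩
    rw [← imageProj_comp_imageIncl (m + 1) (by omega), Category.assoc, Category.assoc,
      IsIso.hom_inv_id, Category.comp_id]
    exact mk₀_comp_partialClass_eq_zero hS.exact m le_rfl h

lemma exists_comp_yonedaClass_eq {X : A}
    (hX : ∀ i (hi : i ≤ n + 1) k, 0 < k → k < n → Subsingleton (Ext.{w} X (S.obj' i) k))
    (z : Ext.{w} X (S.obj' 0) n)
    (hz : z.comp (Ext.mk₀ (S.map' 0 1)) (add_zero n) = 0) :
    ∃ g, (Ext.mk₀ g).comp (yonedaClass.{w} hS) (zero_add n) = z := by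
  have := hS.isIso_imageIncl
  have := hS.isIso_imageProj
  obtain ⟨g, hg⟩ := exists_comp_partialClass_eq hS.exact hX
    (z.comp (Ext.mk₀ (imageProj S 0 (Nat.zero_le n))) (add_zero n)) (by
      rw [Ext.comp_assoc_of_third_deg_zero, Ext.mk₀_comp_mk₀, imageProj_comp_imageIncl, hz])
    n le_rfl 0 (zero_add n)
  obtain ⟨g, rfl⟩ := (Ext.mk₀_bijective _ _).2 g
  refine ⟨g ≫ imageIncl S n le_rfl, ?_⟩
  simp only [yonedaClass, ← Ext.comp_assoc_of_third_deg_zero, Ext.mk₀_comp_mk₀_assoc,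
    Category.assoc, IsIso.hom_inv_id, Category.comp_id, hg]
  rw [Ext.comp_assoc_of_third_deg_zero, Ext.mk₀_comp_mk₀, IsIso.hom_inv_id, Ext.comp_mk₀_id]

end LongExact

/-! ### Artin algebras: finitely generated injective hulls and Fitting's lemma. -/

section ArtinAlgebra

section EssentialExtension

variable {Λ : Type*} [Ring Λ] {J : Type*} [AddCommGroup J] [Module Λ J]

/-- `E` is an essential extension of `E ⊓ A`. -/
def IsEssentialOver (A E : Submodule Λ J) : Prop := ∀ N ≤ E, Disjoint N A → N = ⊥

/-- The cyclic module on `y` is semisimple, being a module over `Λ` modulo its radical. A complement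
in it of its intersection with `A` is disjoint from `A`, hence zero by essentiality. -/
lemma mem_of_isEssentialOver [IsArtinianRing Λ] {A E : Submodule Λ J} (h : IsEssentialOver A E)
    {y : J} (hy : y ∈ E) (hy' : ∀ r ∈ Ring.jacobson Λ, r • y = 0) : y ∈ A := by
  let N := Submodule.span Λ {y}
  have hN : Module.IsTorsionBySet Λ N (Ring.jacobson Λ) := by
    rintro ⟨x, hx⟩ ⟨r, hr⟩
    obtain ⟨c, rfl⟩ := Submodule.mem_span_singleton.1 hx
    refine Subtype.ext ?_
    change r • c • y = 0
    rw [smul_smul]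
    exact hy' _ (Ideal.mul_mem_right c _ hr)
  have hss : IsSemisimpleModule Λ N := by
    let _ := hN.module
    exact (hN.semilinearMap.isSemisimpleModule_iff_of_bijective Function.bijective_id).2
      inferInstance
  obtain ⟨C, hC⟩ := exists_isCompl (A.comap N.subtype)
  have hC0 : C.map N.subtype = ⊥ := by
    refine h _ ?_ ?_
    · refine (Submodule.map_subtype_le N C).trans ?_
      rw [Submodule.span_singleton_le_iff_mem]
      exact hy
    · rw [Submodule.disjoint_def]
      rintro _ ⟨x, hx, rfl⟩ hxA
      have := Submodule.disjoint_def.1 hC.disjoint x hxA hx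
      simp [this]
  have hCbot : C = ⊥ := by
    rw [eq_bot_iff]
    intro x hx
    have : N.subtype x ∈ C.map N.subtype := ⟨x, hx, rfl⟩
    rw [hC0] at this
    exact Subtype.ext this
  have htop := hC.codisjoint.eq_top
  rw [hCbot, sup_bot_eq] at htop
  have : (⟨y, Submodule.mem_span_singleton_self y⟩ : N) ∈ A.comap N.subtype := htop ▸ trivial
  exact this

/-- Take `K` maximal among the submodules disjoint from `E`, and extend the inclusion of `E` to `h`
on `J ⧸ K`. The range of `h` is still essential over `A`, so it equals `E` by maximality, and `h`
becomes a retraction onto `E` with kernel zero. The hypothesis `hJ` is the instance of injectivity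
of `J` that is used. -/
lemma exists_isCompl_of_maximal_isEssentialOver {A E : Submodule Λ J}
    (hE : Maximal (IsEssentialOver A) E)
    (hJ : ∀ (K : Submodule Λ J) (f : E →ₗ[Λ] J ⧸ K), Function.Injective f →
      ∃ h : (J ⧸ K) →ₗ[Λ] J, h ∘ₗ f = E.subtype) : ∃ K, IsCompl E K := by
  obtain ⟨K, -, hK⟩ : ∃ K, (⊥ : Submodule Λ J) ≤ K ∧ Maximal (Disjoint E) K := by
    refine zorn_le_nonempty₀ {K | Disjoint E K} (fun c hc hch K hKc => ⟨sSup c, ?_,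
      fun z hz => le_sSup hz⟩) ⊥ disjoint_bot_right
    change Disjoint _ _
    rw [hch.directedOn.disjoint_sSup_right]
    exact fun b hb => hc hb
  obtain ⟨h, hh⟩ := hJ K (K.mkQ ∘ₗ E.subtype) (by
    rw [← LinearMap.ker_eq_bot, LinearMap.ker_eq_bot']
    rintro ⟨x, hx⟩ hx0
    have hxK : x ∈ K := (Submodule.Quotient.mk_eq_zero K).1 hx0
    exact Subtype.ext (Submodule.disjoint_def.1 hK.prop x hx hxK))
  have hh' : ∀ x ∈ E, h (K.mkQ x) = x := fun x hx => LinearMap.congr_fun hh ⟨x, hx⟩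
  have key : ∀ N : Submodule Λ J, Disjoint N E → N.comap (h ∘ₗ K.mkQ) = K := fun N hN => by
    refine (hK.eq_of_le ?_ ?_).symm
    · rw [Submodule.disjoint_def]
      intro x hx hxN
      have : h (K.mkQ x) ∈ N := hxN
      rw [hh' x hx] at this
      exact Submodule.disjoint_def.1 hN x this hx
    · intro x hx
      have : h (K.mkQ x) = 0 := by
        rw [(show K.mkQ x = 0 from (Submodule.Quotient.mk_eq_zero K).2 hx), map_zero]
      change h (K.mkQ x) ∈ N
      rw [this]
      exact N.zero_mem
  have hrange : E = LinearMap.range h := by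
    refine hE.eq_of_le ?_ fun x hx => ⟨K.mkQ x, hh' x hx⟩
    intro N hN hNA
    have hNE : Disjoint N E := by
      rw [disjoint_iff]
      exact hE.prop _ inf_le_right (hNA.mono_left inf_le_left)
    rw [eq_bot_iff]
    intro y hy
    obtain ⟨z, rfl⟩ := hN hy
    obtain ⟨x, rfl⟩ := K.mkQ_surjective z
    have hx : x ∈ N.comap (h ∘ₗ K.mkQ) := hy
    rw [key N hNE] at hx
    rw [(show K.mkQ x = 0 from (Submodule.Quotient.mk_eq_zero K).2 hx), map_zero]
    exact Submodule.zero_mem _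
  refine ⟨K, hK.prop, ?_⟩
  rw [codisjoint_iff, eq_top_iff]
  intro x _
  have hx : h (K.mkQ x) ∈ E := by rw [hrange]; exact ⟨_, rfl⟩
  refine Submodule.mem_sup.2 ⟨h (K.mkQ x), hx, x - h (K.mkQ x), ?_, by abel⟩
  refine (key ⊥ disjoint_bot_left).le ?_
  change h (K.mkQ (x - h (K.mkQ x))) = 0
  rw [map_sub, map_sub, hh' _ hx, sub_self]

lemma exists_maximal_isEssentialOver (A : Submodule Λ J) :
    ∃ E, A ≤ E ∧ Maximal (IsEssentialOver A) E := by
  refine zorn_le_nonempty₀ {E | IsEssentialOver A E} (fun c hc hch K hKc => ⟨sSup c, ?_,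
      fun z hz => le_sSup hz⟩) A fun N hN hd => ?_
  · intro N hN hd
    have hN' : N ⊓ sSup c = N := inf_eq_left.2 hN
    rw [hch.directedOn.inf_sSup_eq] at hN'
    rw [← hN']
    refine iSup₂_eq_bot.2 fun E hE => ?_
    exact hc hE _ inf_le_right (hd.mono_left inf_le_left)
  · exact (disjoint_self.1 (hd.mono_right hN))

/-- Essential extensions of finitely generated modules over an artin algebra are finitely
generated. -/
lemma isNoetherian_of_isEssentialOver (R : Type*) [CommRing R] [IsArtinianRing R] [Algebra R Λ]
    [Module.Finite R Λ] [Module R J] [IsScalarTower R Λ J] {A E : Submodule Λ J} (hA : A.FG)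
    (h : IsEssentialOver A E) : IsNoetherian R E := by
  have hΛ : IsArtinianRing Λ := isArtinian_of_tower R inferInstance
  have hΛ' : IsNoetherianRing Λ := isNoetherian_of_tower R inferInstance
  have : SMulCommClass R Λ J := IsScalarTower.to_smulCommClass
  have : Module.Finite Λ A := Module.Finite.iff_fg.2 hA
  have : Module.Finite R A := Module.Finite.trans Λ A
  -- `L i` is the part of `E` killed by the `i`-th power of the radical. Multiplication by
  -- generators of that power embeds `L (i + 1) ⧸ L i` in a finite power of `A`, because the
  -- products are killed by the radical and so lie in `A`. Nilpotency of the radical ends the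
  -- filtration at `E`.
  let L (i : ℕ) : Submodule R E :=
    { carrier := {x | ∀ r ∈ Ring.jacobson Λ ^ i, r • x = 0}
      add_mem' := fun {x y} hx hy r hr => by rw [smul_add, hx r hr, hy r hr, add_zero]
      zero_mem' := fun r _ => smul_zero r
      smul_mem' := fun c x hx r hr => by rw [smul_comm, hx r hr, smul_zero] }
  have hL : ∀ i, IsNoetherian R (L i) := by
    intro i
    induction i with
    | zero =>
      have : Subsingleton (L 0) := ⟨fun ⟨x, hx⟩ ⟨y, hy⟩ => Subtype.ext (by
        have hx1 := hx 1 (by rw [Submodule.pow_zero, Ideal.one_eq_top]; trivial)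
        have hy1 := hy 1 (by rw [Submodule.pow_zero, Ideal.one_eq_top]; trivial)
        rw [one_smul] at hx1 hy1
        change x = y
        rw [hx1, hy1])⟩
      infer_instance
    | succ i ih =>
      obtain ⟨s, hs⟩ := IsNoetherian.noetherian (Ring.jacobson Λ ^ i)
      have hle : L i ≤ L (i + 1) := fun x hx r hr => hx r (Ideal.pow_le_pow_right (Nat.le_succ i) hr)
      let f : L (i + 1) →ₗ[R] (s → A) :=
        { toFun := fun x r => ⟨(r.1 • x.1 : E), mem_of_isEssentialOver h (r.1 • x.1 : E).2
            fun t ht => by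
              have hr : r.1 ∈ Ring.jacobson Λ ^ i := by
                rw [← hs]; exact Submodule.subset_span r.2
              have := x.2 (t * r.1) (by
                obtain rfl | hi := Nat.eq_zero_or_pos i
                · rw [zero_add, Submodule.pow_one]
                  exact Ideal.mul_mem_right _ _ ht
                · rw [Submodule.pow_succ' _ hi.ne']
                  exact Ideal.mul_mem_mul ht hr)
              rw [← smul_smul] at this
              exact congrArg Subtype.val this⟩
          map_add' := fun x y => by
            funext r
            exact Subtype.ext (smul_add r.1 (x.1 : J) y.1)
          map_smul' := fun c x => by
            funext r
            exact Subtype.ext (smul_comm r.1 c (x.1 : J)) }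
      refine isNoetherian_of_range_eq_ker (Submodule.inclusion hle) f ?_
      ext x
      rw [Submodule.range_inclusion, LinearMap.mem_ker, Submodule.mem_comap]
      constructor
      · intro hx
        funext r
        have hr : r.1 ∈ Ring.jacobson Λ ^ i := by
          rw [← hs]; exact Submodule.subset_span r.2
        exact Subtype.ext (congrArg (fun z : E => (z : J)) (hx r.1 hr))
      · intro hx r hr
        rw [← hs] at hr
        induction hr using Submodule.span_induction with
        | mem r hr => exact Subtype.ext (congrArg (fun g : s → A => (g ⟨r, hr⟩ : J)) hx)
        | zero => exact zero_smul _ _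
        | add r t _ _ hr ht => rw [add_smul, hr, ht, add_zero]
        | smul c r _ hr => rw [smul_eq_mul, mul_smul, hr, smul_zero]
  obtain ⟨m, hm⟩ := IsSemiprimaryRing.isNilpotent (R := Λ)
  have htop : L m = ⊤ := by
    rw [eq_top_iff]
    intro x _ r hr
    rw [hm] at hr
    rw [(show r = 0 from hr), zero_smul]
  have := hL m
  rw [htop] at this
  exact isNoetherian_of_linearEquiv Submodule.topEquiv

end EssentialExtension

variable (R : Type w) [CommRing R] [IsArtinianRing R] (Λ : Type u) [Ring Λ] [Algebra R Λ]
  [Module.Finite R Λ]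

include R in
lemma isNoetherianRing_of_artin : IsNoetherianRing Λ := isNoetherian_of_tower R inferInstance

include R in
lemma isArtinianRing_of_artin : IsArtinianRing Λ := isArtinian_of_tower R inferInstance

variable {Λ}

include R in
/-- Finitely generated modules over an artin algebra embed into finitely generated injective
modules. -/
lemma exists_mono_injective (A : ModuleCat.{u} Λ) (hA : Module.Finite Λ A) :
    ∃ (I : ModuleCat.{u} Λ) (i : A ⟶ I), Module.Finite Λ I ∧ Injective I ∧ Mono i := by
  let J := Injective.under A
  let _ : Module R J := Module.compHom J (algebraMap R Λ)
  have : IsScalarTower R Λ J := ⟨fun r a x => by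
    rw [Algebra.smul_def, mul_smul]; rfl⟩
  let A' : Submodule Λ J := LinearMap.range (Injective.ι A).hom
  have hA' : A'.FG := Module.Finite.iff_fg.1 (Module.Finite.range _)
  -- `E` is an injective hull of `A`: a maximal essential extension inside the injective `J` is a
  -- direct summand of `J`.
  obtain ⟨E, hAE, hE⟩ := exists_maximal_isEssentialOver A'
  have hEn := isNoetherian_of_isEssentialOver R hA' hE.prop
  have hEfin : Module.Finite Λ E := Module.Finite.of_restrictScalars_finite R Λ E
  obtain ⟨K, hK⟩ := exists_isCompl_of_maximal_isEssentialOver hE fun K f hf => by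
    have : Mono (ModuleCat.ofHom f) := (ModuleCat.mono_iff_injective _).2 hf
    refine ⟨(Injective.factorThru (J := J) (ModuleCat.ofHom E.subtype) (ModuleCat.ofHom f)).hom, ?_⟩
    exact congrArg ModuleCat.Hom.hom
      (Injective.comp_factorThru (J := J) (ModuleCat.ofHom E.subtype) (ModuleCat.ofHom f))
  refine ⟨ModuleCat.of Λ E, ModuleCat.ofHom ((Injective.ι A).hom.codRestrict E
    fun x => hAE ⟨x, rfl⟩), hEfin, ?_, ?_⟩
  · refine Retract.injective (Y := J) ⟨ModuleCat.ofHom E.subtype,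
      ModuleCat.ofHom (E.projectionOnto K hK), ?_⟩
    ext x
    exact congrArg Subtype.val (Submodule.projectionOnto_apply_left hK x)
  · rw [ModuleCat.mono_iff_injective]
    intro x y hxy
    have := (ModuleCat.mono_iff_injective (Injective.ι A)).1 inferInstance
    exact this (congrArg Subtype.val hxy)

include R in
/-- Fitting's lemma for finitely generated modules over an artin algebra. -/
lemma exists_fitting (X : ModuleCat.{u} Λ) (hX : Module.Finite Λ X) (e : X ⟶ X) :
    ∃ (Y : ModuleCat.{u} Λ) (r : X ⟶ Y) (s : Y ⟶ X) (b b' : X ⟶ X) (N : ℕ), s ≫ r = 𝟙 Y ∧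
      r ≫ s = e ≫ b ∧ r ≫ s = b' ≫ e ∧
      ModuleCat.ofHom (e.hom ^ N) = ModuleCat.ofHom (e.hom ^ N) ≫ r ≫ s ∧
      ModuleCat.ofHom (e.hom ^ N) = r ≫ s ≫ ModuleCat.ofHom (e.hom ^ N) := by
  have := isNoetherianRing_of_artin R Λ
  have := isArtinianRing_of_artin R Λ
  set f := e.hom with hf
  obtain ⟨N, hN, hN1⟩ :=
    (f.eventually_isCompl_ker_pow_range_pow.and (Filter.eventually_ge_atTop 1)).exists
  -- The exponent is taken positive so that `f ^ (m + 1)` has a factor `f` on either side. Being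
  -- invertible on its range `L`, this power expresses the projection `p` as a multiple of `f` from
  -- both sides.
  obtain ⟨m, rfl⟩ := Nat.exists_eq_add_of_le' hN1
  set L := LinearMap.range (f ^ (m + 1))
  set p := L.projectionOnto _ hN.symm
  have hpL : ∀ y : L, p y = y := Submodule.projectionOnto_apply_left hN.symm
  have hker : ∀ x, (f ^ (m + 1)) (p x : X) = (f ^ (m + 1)) x := fun x => by
    have h : p (x - p x) = 0 := by rw [map_sub, hpL, sub_self]
    have h' : x - p x ∈ LinearMap.ker p := h
    rw [Submodule.ker_projectionOnto, LinearMap.mem_ker, map_sub, sub_eq_zero] at h'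
    exact h'.symm
  let g : L →ₗ[Λ] L := ((f ^ (m + 1)) ∘ₗ L.subtype).codRestrict L fun y => ⟨_, rfl⟩
  have hg : Function.Bijective g := by
    refine IsArtinian.bijective_of_injective_endomorphism g ?_
    rw [← LinearMap.ker_eq_bot, LinearMap.ker_eq_bot']
    intro y hy
    have hy' : (y : X) ∈ LinearMap.ker (f ^ (m + 1)) := congrArg Subtype.val hy
    exact Subtype.ext (Submodule.disjoint_def.1 hN.disjoint y hy' y.2)
  let g' : L ≃ₗ[Λ] L := LinearEquiv.ofBijective g hg
  have hgp : ∀ x, g (p x) = ⟨(f ^ (m + 1)) x, ⟨x, rfl⟩⟩ := fun x => Subtype.ext (hker x)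
  refine ⟨ModuleCat.of Λ L, ModuleCat.ofHom p, ModuleCat.ofHom L.subtype,
    ModuleCat.ofHom (L.subtype ∘ₗ g'.symm.toLinearMap ∘ₗ p ∘ₗ (f ^ m)),
    ModuleCat.ofHom ((f ^ m) ∘ₗ L.subtype ∘ₗ g'.symm.toLinearMap ∘ₗ p), m + 1, ?_, ?_, ?_, ?_, ?_⟩
  · ext y
    exact congrArg Subtype.val (hpL y)
  · ext x
    refine congrArg Subtype.val (?_ : p x = g'.symm (p ((f ^ m) (f x))))
    rw [LinearEquiv.eq_symm_apply]
    refine (hgp x).trans ?_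
    have : (f ^ m) (f x) = (f ^ (m + 1)) x := by rw [pow_succ]; rfl
    rw [this]
    exact (hpL ⟨_, ⟨x, rfl⟩⟩).symm
  · ext x
    change (p x : X) = f ((f ^ m) (g'.symm (p x) : X))
    have : f ((f ^ m) (g'.symm (p x) : X)) = (f ^ (m + 1)) (g'.symm (p x) : X) := by
      rw [pow_succ']; rfl
    rw [this]
    exact congrArg Subtype.val (g'.apply_symm_apply (p x)).symm
  · ext x
    exact congrArg Subtype.val (hpL ⟨_, ⟨x, rfl⟩⟩).symm
  · ext x
    exact (hker x).symm

end ArtinAlgebra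

/-! ### Extending a commutative square at one end to a ladder. -/

section Ladder

variable {C : Type u} [Category.{v} C] [Preadditive C] {n : ℕ} {S T : ComposableArrows C (n + 1)}

lemma IsNExact.exists_hom_of_last (hT : IsNExact T) (hS : S.IsComplex)
    (a : S.obj' n ⟶ T.obj' n) (b : S.obj' (n + 1) ⟶ T.obj' (n + 1))
    (w : S.map' n (n + 1) ≫ b = a ≫ T.map' n (n + 1)) :
    ∃ φ : S ⟶ T, ComposableArrows.app' φ n = a ∧ ComposableArrows.app' φ (n + 1) = b := by
  suffices ∀ k ≤ n, ∃ φ : ∀ i, S.obj i ⟶ T.obj i, φ ⟨n, by omega⟩ = a ∧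
      φ ⟨n + 1, by omega⟩ = b ∧ ∀ (i : ℕ) (hi : i + 1 ≤ n + 1), n ≤ i + k →
        S.map' i (i + 1) ≫ φ ⟨i + 1, by omega⟩ = φ ⟨i, by omega⟩ ≫ T.map' i (i + 1) by
    obtain ⟨φ, h1, h2, h3⟩ := this n le_rfl
    exact ⟨ComposableArrows.homMk φ fun i hi => h3 i hi (by omega), h1, h2⟩
  intro k
  induction k with
  | zero =>
    intro _
    refine ⟨Function.update (Function.update (fun _ => 0) ⟨n, by omega⟩ a) ⟨n + 1, by omega⟩ b,
      ?_, Function.update_self _ _ _, ?_⟩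
    · rw [Function.update_of_ne (by simp), Function.update_self]
    · intro i hi hi'
      obtain rfl : i = n := by omega
      rw [Function.update_self, Function.update_of_ne (by simp), Function.update_self]
      exact w
  | succ k ih =>
    intro hk
    obtain ⟨φ, h1, h2, h3⟩ := ih (by omega)
    obtain ⟨j, hj⟩ : ∃ j, n = j + (k + 1) := ⟨n - (k + 1), by omega⟩
    obtain ⟨g, hg⟩ := hT.kernel_exact j (by omega) _ (S.map' j (j + 1) ≫ φ ⟨j + 1, by omega⟩) (by
      rw [Category.assoc, ← h3 (j + 1) (by omega) (by omega), ← Category.assoc, hS.zero j,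
        zero_comp])
    refine ⟨Function.update φ ⟨j, by omega⟩ g, ?_, ?_, fun i hi hi' => ?_⟩
    · rw [Function.update_of_ne (by simp; omega), h1]
    · rw [Function.update_of_ne (by simp; omega), h2]
    · rw [Function.update_of_ne (by simp; omega)]
      obtain rfl | hij := eq_or_ne i j
      · rw [Function.update_self, hg]
      · rw [Function.update_of_ne (by simpa using hij), h3 i hi (by omega)]

lemma IsNExact.exists_hom_of_first (hS : IsNExact S) (hT : T.IsComplex)
    (a : S.obj' 0 ⟶ T.obj' 0) (b : S.obj' 1 ⟶ T.obj' 1)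
    (w : S.map' 0 1 ≫ b = a ≫ T.map' 0 1) :
    ∃ φ : S ⟶ T, ComposableArrows.app' φ 0 = a ∧ ComposableArrows.app' φ 1 = b := by
  suffices ∀ k ≤ n, ∃ φ : ∀ i, S.obj i ⟶ T.obj i, φ ⟨0, by omega⟩ = a ∧
      φ ⟨1, by omega⟩ = b ∧ ∀ (i : ℕ) (hi : i + 1 ≤ n + 1), i ≤ k →
        S.map' i (i + 1) ≫ φ ⟨i + 1, by omega⟩ = φ ⟨i, by omega⟩ ≫ T.map' i (i + 1) by
    obtain ⟨φ, h1, h2, h3⟩ := this n le_rfl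
    exact ⟨ComposableArrows.homMk φ fun i hi => h3 i hi (by omega), h1, h2⟩
  intro k
  induction k with
  | zero =>
    intro _
    refine ⟨Function.update (Function.update (fun _ => 0) ⟨0, by omega⟩ a) ⟨1, by omega⟩ b,
      ?_, Function.update_self _ _ _, ?_⟩
    · rw [Function.update_of_ne (by simp), Function.update_self]
    · intro i hi hi'
      obtain rfl : i = 0 := by omega
      rw [Function.update_self, Function.update_of_ne (by simp), Function.update_self]
      exact w
  | succ k ih =>
    intro hk
    obtain ⟨φ, h1, h2, h3⟩ := ih (by omega)
    obtain ⟨g, hg⟩ := hS.cokernel_exact k (by omega) _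
      (φ ⟨k + 1, by omega⟩ ≫ T.map' (k + 1) (k + 2)) (by
      rw [← Category.assoc, h3 k (by omega) le_rfl, Category.assoc, hT.zero k, comp_zero])
    refine ⟨Function.update φ ⟨k + 2, by omega⟩ g, ?_, ?_, fun i hi hi' => ?_⟩
    · rw [Function.update_of_ne (by simp), h1]
    · rw [Function.update_of_ne (by simp), h2]
    · have e1 : Function.update φ ⟨k + 2, by omega⟩ g ⟨i, by omega⟩ = φ ⟨i, by omega⟩ :=
        Function.update_of_ne (by simp; omega) _ _
      rw [e1]
      obtain rfl | hij := eq_or_ne i (k + 1)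
      · rw [Function.update_self, hg]
      · rw [Function.update_of_ne (by simpa using hij), h3 i hi (by omega)]

end Ladder

/-! ### Closure properties and approximations in a cluster tilting subcategory. -/

section ClusterTiltingClosure

variable {R : Type w} [CommRing R] [IsArtinianRing R] {Λ : Type u} [Ring Λ]
    [Algebra R Λ] [Module.Finite R Λ] {n : ℕ} {M : ObjectProperty (ModuleCat.{u} Λ)}
    (hM : IsNClusterTilting n M)

lemma module_finite_of_epi {X Y : ModuleCat.{u} Λ} (f : X ⟶ Y) [Epi f] (hX : Module.Finite Λ X) :
    Module.Finite Λ Y :=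
  Module.Finite.of_surjective f.hom ((ModuleCat.epi_iff_surjective _).1 inferInstance)

include R in
lemma module_finite_of_mono {X Y : ModuleCat.{u} Λ} (f : X ⟶ Y) [Mono f]
    (hY : Module.Finite Λ Y) : Module.Finite Λ X := by
  have := isNoetherianRing_of_artin R Λ
  exact Module.Finite.of_injective f.hom ((ModuleCat.mono_iff_injective _).1 inferInstance)

namespace IsNClusterTilting

include hM

lemma subsingleton_ext {X Y : ModuleCat.{u} Λ} (hX : M X) (hY : M Y) {i : ℕ} (hi : 0 < i)
    (hin : i < n) : Subsingleton (Abelian.Ext X Y i) :=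
  (hM.mem_iff_right Y (hM.finite Y hY)).1 hY X hX i hi hin

lemma mem_of_projective (P : ModuleCat.{u} Λ) [Projective P] (hP : Module.Finite Λ P) : M P := by
  refine (hM.mem_iff_left P hP).2 fun X _ i hi _ => ?_
  obtain ⟨i, rfl⟩ := Nat.exists_eq_add_of_le' hi
  exact Ext.subsingleton_of_projective P X i

lemma mem_of_injective (I : ModuleCat.{u} Λ) [Injective I] (hI : Module.Finite Λ I) : M I := by
  refine (hM.mem_iff_right I hI).2 fun X _ i hi _ => ?_
  obtain ⟨i, rfl⟩ := Nat.exists_eq_add_of_le' hi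
  exact Ext.subsingleton_of_injective X I i

lemma mem_of_retract {X Y : ModuleCat.{u} Λ} (r : X ⟶ Y) (s : Y ⟶ X) (h : s ≫ r = 𝟙 Y)
    (hX : M X) : M Y := by
  have : Epi r := (SplitEpi.mk s h).epi
  refine (hM.mem_iff_right Y (module_finite_of_epi r (hM.finite X hX))).2 fun Z hZ i hi hin => ?_
  have := hM.subsingleton_ext hZ hX hi hin
  refine ⟨fun a b => ?_⟩
  rw [← a.comp_mk₀_id, ← b.comp_mk₀_id, ← h, ← Ext.mk₀_comp_mk₀,
    ← Ext.comp_assoc_of_third_deg_zero, ← Ext.comp_assoc_of_third_deg_zero,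
    Subsingleton.elim (a.comp (Ext.mk₀ s) (add_zero i)) (b.comp (Ext.mk₀ s) (add_zero i))]

lemma mem_biprod {X Y : ModuleCat.{u} Λ} (hX : M X) (hY : M Y) : M (X ⊞ Y) := by
  have := hM.finite X hX
  have := hM.finite Y hY
  have hfin : Module.Finite Λ (X ⊞ Y : ModuleCat.{u} Λ) :=
    Module.Finite.equiv (ModuleCat.biprodIsoProd X Y).symm.toLinearEquiv
  refine (hM.mem_iff_right _ hfin).2 fun Z hZ i hi hin => ?_
  have := hM.subsingleton_ext hZ hX hi hin
  have := hM.subsingleton_ext hZ hY hi hin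
  exact Ext.addEquivBiprod.toEquiv.subsingleton

lemma hasJointFactorization : HasJointFactorization M.FullSubcategory := fun {Y A B} g k => by
  refine ⟨⟨A.obj ⊞ B.obj, hM.mem_biprod A.property B.property⟩,
    ObjectProperty.homMk (biprod.lift g.hom k.hom), fun T f => ⟨?_, ?_⟩⟩
  · rintro ⟨h, rfl⟩
    refine ⟨ObjectProperty.homMk (biprod.inl ≫ h.hom), ObjectProperty.homMk (biprod.inr ≫ h.hom),
      ObjectProperty.hom_ext _ ?_⟩
    change _ = g.hom ≫ biprod.inl ≫ h.hom + k.hom ≫ biprod.inr ≫ h.hom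
    rw [← Category.assoc, ← Category.assoc, ← Preadditive.add_comp, ← biprod.lift_eq]
    rfl
  · rintro ⟨a, b, rfl⟩
    refine ⟨ObjectProperty.homMk (biprod.desc a.hom b.hom), ObjectProperty.hom_ext _ ?_⟩
    exact biprod.lift_desc

lemma hasJointFactorization_op : HasJointFactorization (M.FullSubcategory)ᵒᵖ := fun {Y A B} g k => by
  refine ⟨op ⟨A.unop.obj ⊞ B.unop.obj, hM.mem_biprod A.unop.property B.unop.property⟩,
    Quiver.Hom.op (ObjectProperty.homMk (biprod.desc g.unop.hom k.unop.hom)), fun T f => ⟨?_, ?_⟩⟩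
  · rintro ⟨h, rfl⟩
    refine ⟨Quiver.Hom.op (ObjectProperty.homMk (h.unop.hom ≫ biprod.fst)),
      Quiver.Hom.op (ObjectProperty.homMk (h.unop.hom ≫ biprod.snd)),
      Quiver.Hom.unop_inj (ObjectProperty.hom_ext _ ?_)⟩
    change _ = (h.unop.hom ≫ biprod.fst) ≫ g.unop.hom + (h.unop.hom ≫ biprod.snd) ≫ k.unop.hom
    rw [Category.assoc, Category.assoc, ← Preadditive.comp_add, ← biprod.desc_eq]
    rfl
  · rintro ⟨a, b, rfl⟩
    refine ⟨Quiver.Hom.op (ObjectProperty.homMk (biprod.lift a.unop.hom b.unop.hom)),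
      Quiver.Hom.unop_inj (ObjectProperty.hom_ext _ ?_)⟩
    exact biprod.lift_desc

omit hM in
lemma hom_hom_pow {X : M.FullSubcategory} (e : End X) (N : ℕ) :
    (HPow.hPow (α := End X) e N : X ⟶ X).hom = ModuleCat.ofHom ((InducedCategory.Hom.hom e).hom ^ N) := by
  induction N with
  | zero => rfl
  | succ N ih =>
    rw [pow_succ', End.mul_def, ObjectProperty.FullSubcategory.comp_hom, ih, pow_succ']
    rfl

-- Both one-sided forms are recorded because they are exchanged by passing to the opposite category,
-- where the decomposition is needed as well.
include R in
lemma exists_fitting_fullSubcategory {X : M.FullSubcategory} (e : End X) :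
    ∃ (Y : M.FullSubcategory) (r : X ⟶ Y) (s : Y ⟶ X) (b b' : X ⟶ X) (N : ℕ), s ≫ r = 𝟙 Y ∧
      r ≫ s = e ≫ b ∧ r ≫ s = b' ≫ e ∧
      e ^ N = (e ^ N : X ⟶ X) ≫ r ≫ s ∧ e ^ N = r ≫ s ≫ (e ^ N : X ⟶ X) := by
  obtain ⟨Y, r, s, b, b', N, h1, h2, h3, h4, h5⟩ :=
    exists_fitting (R := R) X.obj (hM.finite _ X.property) (InducedCategory.Hom.hom e)
  refine ⟨⟨Y, hM.mem_of_retract r s h1 X.property⟩, ObjectProperty.homMk r, ObjectProperty.homMk s,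
    ObjectProperty.homMk b, ObjectProperty.homMk b', N, ObjectProperty.hom_ext _ h1,
    ObjectProperty.hom_ext _ h2, ObjectProperty.hom_ext _ h3, ObjectProperty.hom_ext _ ?_,
    ObjectProperty.hom_ext _ ?_⟩
  · exact (hom_hom_pow e N).trans (h4.trans (by rw [← hom_hom_pow]; rfl))
  · exact (hom_hom_pow e N).trans (h5.trans (by rw [← hom_hom_pow]; rfl))

include R in
lemma hasFittingDecomposition : HasFittingDecomposition M.FullSubcategory := fun {X} e => by
  obtain ⟨Y, r, s, b, b', N, h1, h2, h3, h4, h5⟩ := hM.exists_fitting_fullSubcategory (R := R) e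
  exact ⟨Y, r, s, h1, ⟨b, h2⟩, N, h4⟩

omit hM in
lemma unop_pow {C : Type*} [Category* C] {X : Cᵒᵖ} (e : End X) (N : ℕ) :
    Quiver.Hom.unop (HPow.hPow (α := End X) e N) =
      HPow.hPow (α := End X.unop) (Quiver.Hom.unop e) N := by
  induction N with
  | zero => rfl
  | succ N ih =>
    rw [pow_succ', pow_succ, End.mul_def, End.mul_def, unop_comp, ih]

include R in
lemma hasFittingDecomposition_op : HasFittingDecomposition (M.FullSubcategory)ᵒᵖ := fun {X} e => by
  obtain ⟨Y, r, s, b, b', N, h1, h2, h3, h4, h5⟩ :=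
    hM.exists_fitting_fullSubcategory (R := R) (X := X.unop) (Quiver.Hom.unop e)
  refine ⟨op Y, s.op, r.op, congrArg Quiver.Hom.op h1, ⟨b'.op, congrArg Quiver.Hom.op h3⟩, N, ?_⟩
  refine Quiver.Hom.unop_inj ?_
  rw [unop_comp, unop_comp, unop_pow]
  exact h5.trans (Category.assoc _ _ _).symm

lemma exists_projective (X : M.FullSubcategory) :
    ∃ (P : M.FullSubcategory) (p : P ⟶ X), projObj M P ∧ Epi p.hom := by
  have := hM.finite _ X.property
  obtain ⟨m, f, hf⟩ := Module.Finite.exists_fin' Λ X.obj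
  have hP : Projective (ModuleCat.of Λ (Fin m → Λ)) := ModuleCat.projective_of_free (Pi.basisFun Λ _)
  refine ⟨⟨ModuleCat.of Λ (Fin m → Λ), hM.mem_of_projective _ (inferInstanceAs
    (Module.Finite Λ (Fin m → Λ)))⟩, ObjectProperty.homMk (ModuleCat.ofHom f), hP, ?_⟩
  exact (ModuleCat.epi_iff_surjective _).2 hf

include R in
lemma exists_injective (X : M.FullSubcategory) :
    ∃ (I : M.FullSubcategory) (i : X ⟶ I), injObj M I ∧ Mono i.hom := by
  obtain ⟨I, i, hI, hI', hi⟩ := exists_mono_injective R X.obj (hM.finite _ X.property)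
  exact ⟨⟨I, hM.mem_of_injective I hI⟩, ObjectProperty.homMk i, hI', hi⟩

omit hM in
lemma isLeftApprox_op_of_epi {P X : M.FullSubcategory} (p : P ⟶ X) (hP : projObj M P)
    (hp : Epi p.hom) : IsLeftApprox (projObj M).op p.op := by
  refine ⟨hP, fun P' f hP' => ?_⟩
  have : Projective P'.unop.obj := hP'
  refine ⟨Quiver.Hom.op (ObjectProperty.homMk (Projective.factorThru f.unop.hom p.hom)),
    Quiver.Hom.unop_inj (ObjectProperty.hom_ext _ ?_)⟩
  exact Projective.factorThru_comp f.unop.hom p.hom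

omit hM in
lemma isLeftApprox_of_mono {X I : M.FullSubcategory} (i : X ⟶ I) (hI : injObj M I)
    (hi : Mono i.hom) : IsLeftApprox (injObj M) i := by
  refine ⟨hI, fun I' f hI' => ?_⟩
  have : Injective I'.obj := hI'
  refine ⟨ObjectProperty.homMk (Injective.factorThru f.hom i.hom), ObjectProperty.hom_ext _ ?_⟩
  exact Injective.comp_factorThru f.hom i.hom

/-- The approximation is an epimorphism because some epimorphism from an object of `M` factors
through it. -/
lemma exists_right_approximation (K : ModuleCat.{u} Λ) (hK : Module.Finite Λ K) :
    ∃ (X : M.FullSubcategory) (p : X.obj ⟶ K), Epi p ∧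
      ∀ (Y : ModuleCat.{u} Λ) (g : Y ⟶ K), M Y → ∃ h : Y ⟶ X.obj, h ≫ p = g := by
  obtain ⟨X, p, hX, hp⟩ := hM.contravariantlyFinite K hK
  obtain ⟨Y, q, hY, hq⟩ := hM.generating K hK
  obtain ⟨h, rfl⟩ := hp Y q hY
  exact ⟨⟨X, hX⟩, p, epi_of_epi h p, hp⟩

lemma exists_left_approximation (K : ModuleCat.{u} Λ) (hK : Module.Finite Λ K) :
    ∃ (X : M.FullSubcategory) (p : K ⟶ X.obj), Mono p ∧
      ∀ (Y : ModuleCat.{u} Λ) (g : K ⟶ Y), M Y → ∃ h : X.obj ⟶ Y, p ≫ h = g := by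
  obtain ⟨X, p, hX, hp⟩ := hM.covariantlyFinite K hK
  obtain ⟨Y, q, hY, hq⟩ := hM.cogenerating K hK
  obtain ⟨h, rfl⟩ := hp Y q hY
  exact ⟨⟨X, hX⟩, p, mono_of_mono p h, hp⟩

/-- Exactness in the category of modules can be tested on `M`. -/
lemma exact_of_forall {X Y Z : ModuleCat.{u} Λ} (f : X ⟶ Y) (g : Y ⟶ Z) (w : f ≫ g = 0)
    (h : ∀ (A : M.FullSubcategory) (k : A.obj ⟶ Y), k ≫ g = 0 → ∃ l, l ≫ f = k) :
    (ShortComplex.mk f g w).Exact := by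
  rw [ShortComplex.moduleCat_exact_iff]
  intro y hy
  -- An element `y` is a map out of `Λ`; an epimorphism `p` from an object of `M` onto `Λ` brings it
  -- within reach of `h`, and a preimage of `1` under `p` recovers `y`.
  obtain ⟨A, p, hA, hp⟩ := hM.generating (ModuleCat.of Λ Λ) (Module.Finite.self Λ)
  let k : ModuleCat.of Λ Λ ⟶ Y := ModuleCat.ofHom (LinearMap.toSpanSingleton Λ _ y)
  have hk : k ≫ g = 0 := by
    ext
    simpa [k] using hy
  obtain ⟨l, hl⟩ := h ⟨A, hA⟩ (p ≫ k) (by rw [Category.assoc, hk, comp_zero])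
  obtain ⟨a, ha⟩ := (ModuleCat.epi_iff_surjective p).1 hp (1 : Λ)
  refine ⟨l.hom a, ?_⟩
  have h1 : (l ≫ f).hom a = (p ≫ k).hom a := by rw [hl]
  have h2 : k.hom (p.hom a) = y := by
    rw [show p.hom a = (1 : Λ) from ha]
    exact one_smul Λ y
  exact h1.trans h2

/-- The exact sequence of modules underlying an `n`-exact sequence. -/
lemma isLongExact (S : NExactSeq M.FullSubcategory n) :
    IsLongExact ((M.ι.mapComposableArrows (n + 1)).obj S.obj) where
  exact :=
    { zero := fun i hi => congrArg (fun f => f.hom) (S.property.isComplex.zero i hi)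
      exact := fun i hi => hM.exact_of_forall _ _ _ fun A k hk => by
        obtain ⟨l, hl⟩ := S.property.kernel_exact i hi A (ObjectProperty.homMk k)
          (ObjectProperty.hom_ext _ hk)
        exact ⟨l.hom, congrArg (fun f => f.hom) hl⟩ }
  mono := mono_firstArrow hM S
  epi := epi_lastArrow hM S

end IsNClusterTilting

end ClusterTiltingClosure

/-! ### Exactness of Hom sequences from Ext vanishing. -/

section HomExact

variable {A : Type u} [Category.{v} A] [Abelian A] [HasExt.{w} A] {n : ℕ}
  {S : ComposableArrows A (n + 1)}

lemma subsingleton_ext_of_isIso_left {X X' Y : A} (f : X ⟶ X') [IsIso f] {k : ℕ}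
    (h : Subsingleton (Ext.{w} X' Y k)) : Subsingleton (Ext.{w} X Y k) := by
  refine ⟨fun a b => sub_eq_zero.1 ?_⟩
  rw [← mk₀_comp_eq_zero_iff_of_isIso (inv f)]
  exact Subsingleton.elim _ _

lemma subsingleton_ext_of_isIso_right {X Y Y' : A} (f : Y ⟶ Y') [IsIso f] {k : ℕ}
    (h : Subsingleton (Ext.{w} X Y' k)) : Subsingleton (Ext.{w} X Y k) := by
  refine ⟨fun a b => sub_eq_zero.1 ?_⟩
  rw [← comp_mk₀_eq_zero_iff_of_isIso f]
  exact Subsingleton.elim _ _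

lemma subsingleton_ext_X₃ {E : ShortComplex A} (hE : E.ShortExact) (X : A) {k k' : ℕ}
    (hk : k + 1 = k') (h₂ : Subsingleton (Ext.{w} X E.X₂ k))
    (h₁ : Subsingleton (Ext.{w} X E.X₁ k')) : Subsingleton (Ext.{w} X E.X₃ k) := by
  refine subsingleton_of_forall_eq 0 fun z => ?_
  obtain ⟨y, rfl⟩ := Ext.covariant_sequence_exact₃ X hE z hk (Subsingleton.elim _ _)
  rw [Subsingleton.elim y 0, Ext.zero_comp]

lemma subsingleton_ext_X₁ {E : ShortComplex A} (hE : E.ShortExact) (X : A) {k k' : ℕ}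
    (hk : k + 1 = k') (h₂ : Subsingleton (Ext.{w} X E.X₂ k'))
    (h₃ : ∀ z : Ext.{w} X E.X₃ k, ∃ y : Ext X E.X₂ k, y.comp (Ext.mk₀ E.g) (add_zero k) = z) :
    Subsingleton (Ext.{w} X E.X₁ k') := by
  refine subsingleton_of_forall_eq 0 fun z => ?_
  obtain ⟨y, rfl⟩ := Ext.covariant_sequence_exact₁ X hE z (Subsingleton.elim _ _) hk
  obtain ⟨x, rfl⟩ := h₃ y
  rw [Ext.comp_assoc_of_second_deg_zero, hE.comp_extClass, Ext.comp_zero]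

lemma subsingleton_ext_X₁_left {E : ShortComplex A} (hE : E.ShortExact) (Y : A) {k k' : ℕ}
    (hk : 1 + k = k') (h₂ : Subsingleton (Ext.{w} E.X₂ Y k))
    (h₃ : Subsingleton (Ext.{w} E.X₃ Y k')) : Subsingleton (Ext.{w} E.X₁ Y k) := by
  refine subsingleton_of_forall_eq 0 fun z => ?_
  obtain ⟨y, rfl⟩ := Ext.contravariant_sequence_exact₁ hE Y z hk (Subsingleton.elim _ _)
  rw [Subsingleton.elim y 0, Ext.comp_zero]

lemma subsingleton_ext_X₃_left {E : ShortComplex A} (hE : E.ShortExact) (Y : A) {k k' : ℕ}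
    (hk : 1 + k = k') (h₂ : Subsingleton (Ext.{w} E.X₂ Y k'))
    (h₁ : ∀ z : Ext.{w} E.X₁ Y k, ∃ y : Ext E.X₂ Y k, (Ext.mk₀ E.f).comp y (zero_add k) = z) :
    Subsingleton (Ext.{w} E.X₃ Y k') := by
  refine subsingleton_of_forall_eq 0 fun z => ?_
  obtain ⟨y, rfl⟩ := Ext.contravariant_sequence_exact₃ hE Y z (Subsingleton.elim _ _) hk
  obtain ⟨x, rfl⟩ := h₁ y
  exact hE.extClass_comp_assoc x

/-- Dimension shift: `Extᵏ(X, Im dⁱ⁺¹)` embeds in `Extᵏ⁺¹(X, Im dⁱ)`. Each step to the right costs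
one degree, whence the bound `k + i < n`. -/
lemma IsLongExact.subsingleton_ext_imageObj_right (hS : IsLongExact S) {X : A}
    (hX : ∀ i (hi : i ≤ n + 1) k, 0 < k → k < n → Subsingleton (Ext.{w} X (S.obj' i) k)) :
    ∀ (i : ℕ) (hi : i ≤ n) (k : ℕ), 0 < k → k + i < n →
      Subsingleton (Ext.{w} X (imageObj S i) k)
  | 0, _, k, hk, hkn => by
    have := hS.isIso_imageProj
    exact subsingleton_ext_of_isIso_right (inv (imageProj S 0 (Nat.zero_le n)))
      (hX 0 (by omega) k hk hkn)
  | i + 1, hi, k, hk, hkn =>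
    subsingleton_ext_X₃ (imageSC_shortExact hS.exact i hi) X rfl
      (hX (i + 1) (by omega) k hk (by omega))
      (hS.subsingleton_ext_imageObj_right hX i (by omega) (k + 1) (by omega) (by omega))

lemma IsLongExact.subsingleton_ext_imageObj_left (hS : IsLongExact S) {Y : A}
    (hY : ∀ i (hi : i ≤ n + 1) k, 0 < k → k < n → Subsingleton (Ext.{w} (S.obj' i) Y k)) :
    ∀ (r i : ℕ) (hi : i + r = n) (k : ℕ), 0 < k → k < i →
      Subsingleton (Ext.{w} (imageObj S i) Y k)
  | 0, i, hi, k, hk, hki => by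
    obtain rfl : i = n := hi
    have := hS.isIso_imageIncl
    exact subsingleton_ext_of_isIso_left (imageIncl S i le_rfl) (hY (i + 1) le_rfl k hk hki)
  | r + 1, i, hi, k, hk, hki =>
    subsingleton_ext_X₁_left (imageSC_shortExact hS.exact i (by omega)) Y (add_comm 1 k)
      (hY (i + 1) (by omega) k hk (by omega))
      (hS.subsingleton_ext_imageObj_left hY r (i + 1) (by omega) (k + 1) (by omega) (by omega))

lemma exists_lift_of_ext {E : ShortComplex A} (hE : E.ShortExact) {X : A}
    (h : Subsingleton (Ext.{w} X E.X₁ 1)) (g : X ⟶ E.X₃) : ∃ l, l ≫ E.g = g := by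
  obtain ⟨y, hy⟩ := Ext.covariant_sequence_exact₃ X hE (Ext.mk₀ g) (zero_add 1)
    (Subsingleton.elim _ _)
  obtain ⟨y, rfl⟩ := (Ext.mk₀_bijective _ _).2 y
  rw [Ext.mk₀_comp_mk₀] at hy
  exact ⟨y, (Ext.mk₀_bijective _ _).1 hy⟩

lemma exists_extension_of_ext {E : ShortComplex A} (hE : E.ShortExact) {Y : A}
    (h : Subsingleton (Ext.{w} E.X₃ Y 1)) (g : E.X₁ ⟶ Y) : ∃ l, E.f ≫ l = g := by
  obtain ⟨y, hy⟩ := Ext.contravariant_sequence_exact₁ hE Y (Ext.mk₀ g) (add_zero 1)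
    (Subsingleton.elim _ _)
  obtain ⟨y, rfl⟩ := (Ext.mk₀_bijective _ _).2 y
  rw [Ext.mk₀_comp_mk₀] at hy
  exact ⟨y, (Ext.mk₀_bijective _ _).1 hy⟩

/-- A map killed by the next differential lands in `Im dⁱ`. For `i > 0`, lifting it to `Sⁱ` is
obstructed by `Ext¹(X, Im dⁱ⁻¹)`, which is in the vanishing range; for `i = 0` the projection to the
image is invertible. -/
lemma IsLongExact.exists_comp_map_eq (hS : IsLongExact S) {X : A}
    (hX : ∀ i (hi : i ≤ n + 1) k, 0 < k → k < n → Subsingleton (Ext.{w} X (S.obj' i) k))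
    (i : ℕ) (hi : i + 1 ≤ n) (g : X ⟶ S.obj' (i + 1)) (hg : g ≫ S.map' (i + 1) (i + 2) = 0) :
    ∃ h : X ⟶ S.obj' i, h ≫ S.map' i (i + 1) = g := by
  have hE := imageSC_shortExact hS.exact i hi
  have := hE.mono_f
  have hg' : g ≫ imageProj S (i + 1) = 0 := by
    rw [← cancel_mono (imageIncl S (i + 1)), Category.assoc, imageProj_comp_imageIncl, zero_comp]
    exact hg
  obtain ⟨k, hk⟩ : ∃ k : X ⟶ imageObj S i, k ≫ imageIncl S i = g :=
    ⟨hE.exact.lift g hg', hE.exact.lift_f g hg'⟩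
  obtain ⟨h, hh⟩ : ∃ h : X ⟶ S.obj' i, h ≫ imageProj S i = k := by
    cases i with
    | zero =>
      have := hS.isIso_imageProj
      exact ⟨k ≫ inv (imageProj S 0 (Nat.zero_le n)),
        (Category.assoc _ _ _).trans (by rw [IsIso.inv_hom_id, Category.comp_id])⟩
    | succ i =>
      exact exists_lift_of_ext (imageSC_shortExact hS.exact i (by omega))
        (hS.subsingleton_ext_imageObj_right hX i (by omega) 1 one_pos (by omega)) k
  exact ⟨h, by rw [← imageProj_comp_imageIncl i (by omega), ← Category.assoc, hh, hk]⟩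

lemma IsLongExact.exists_map_comp_eq (hS : IsLongExact S) {Y : A}
    (hY : ∀ i (hi : i ≤ n + 1) k, 0 < k → k < n → Subsingleton (Ext.{w} (S.obj' i) Y k))
    (i : ℕ) (hi : i + 1 ≤ n) (g : S.obj' (i + 1) ⟶ Y) (hg : S.map' i (i + 1) ≫ g = 0) :
    ∃ h : S.obj' (i + 2) ⟶ Y, S.map' (i + 1) (i + 2) ≫ h = g := by
  have hE := imageSC_shortExact hS.exact i hi
  have := hE.epi_g
  have hg' : imageIncl S i ≫ g = 0 := by
    rw [← cancel_epi (imageProj S i), ← Category.assoc, imageProj_comp_imageIncl, comp_zero]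
    exact hg
  obtain ⟨k, hk⟩ : ∃ k : imageObj S (i + 1) ⟶ Y, imageProj S (i + 1) ≫ k = g :=
    ⟨hE.exact.desc g hg', hE.exact.g_desc g hg'⟩
  obtain ⟨h, hh⟩ : ∃ h : S.obj' (i + 2) ⟶ Y, imageIncl S (i + 1) ≫ h = k := by
    obtain rfl | hin := hi.eq_or_lt
    · have := hS.isIso_imageIncl
      exact ⟨inv (imageIncl S (i + 1) le_rfl) ≫ k, by simp⟩
    · exact exists_extension_of_ext (imageSC_shortExact hS.exact (i + 1) (by omega))
        (hS.subsingleton_ext_imageObj_left hY (n - (i + 2)) (i + 2) (by omega) 1 one_pos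
          (by omega)) k
  exact ⟨h, by rw [← imageProj_comp_imageIncl (i + 1) (by omega), Category.assoc, hh, hk]⟩

end HomExact

/-! ### Splicing exact sequences. -/

section Splice

variable {A : Type u} [Category.{v} A] [Abelian A]

lemma exact_precomp_iff {m : ℕ} (T : ComposableArrows A (m + 1)) {K : A} (k : K ⟶ T.left) :
    (T.precomp k).Exact ↔
      (∃ w : k ≫ T.map' 0 1 = 0, (ShortComplex.mk k (T.map' 0 1) w).Exact) ∧ T.Exact := by
  refine (ComposableArrows.exact_iff_δ₀ (T.precomp k)).trans (and_congr ?_ Iff.rfl)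
  exact ⟨fun h => ⟨h.zero 0, h.exact 0⟩, fun ⟨w, h⟩ => h.exact_toComposableArrows⟩

lemma exact_precomp_epi_comp {m : ℕ} (T : ComposableArrows A m) {K L : A} (k : K ⟶ T.left)
    (p : L ⟶ K) [Epi p] (h : (T.precomp k).Exact) : (T.precomp (p ≫ k)).Exact := by
  cases m with
  | zero => exact ComposableArrows.exact₁ _
  | succ m =>
    obtain ⟨⟨w, h⟩, hT⟩ := (exact_precomp_iff T k).1 h
    refine (exact_precomp_iff T _).2 ⟨⟨by rw [Category.assoc, w, comp_zero], ?_⟩, hT⟩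
    let φ : ShortComplex.mk (p ≫ k) (T.map' 0 1) (by rw [Category.assoc, w, comp_zero]) ⟶
        ShortComplex.mk k (T.map' 0 1) w := {
      τ₁ := p
      τ₂ := 𝟙 _
      τ₃ := 𝟙 _
      comm₂₃ := (Category.id_comp _).trans (Category.comp_id _).symm }
    have : Epi φ.τ₁ := ‹_›
    have : IsIso φ.τ₂ := inferInstanceAs (IsIso (𝟙 _))
    have : Mono φ.τ₃ := inferInstanceAs (Mono (𝟙 _))
    exact (ShortComplex.exact_iff_of_epi_of_isIso_of_mono φ).2 h

/-- Exactness at the middle term of `E` survives because `l` is a monomorphism, and exactness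
further right because `E.g` is an epimorphism. -/
lemma exact_splice {E : ShortComplex A} (hE : E.ShortExact) {m : ℕ} (T : ComposableArrows A m)
    (l : E.X₃ ⟶ T.left) [Mono l] (h : (T.precomp l).Exact) :
    ((T.precomp (E.g ≫ l)).precomp E.f).Exact := by
  have := hE.epi_g
  refine (exact_precomp_iff _ _).2 ⟨⟨by
    change E.f ≫ E.g ≫ l = 0
    rw [E.zero_assoc, zero_comp], ?_⟩, exact_precomp_epi_comp T l E.g h⟩
  let φ : E ⟶ ShortComplex.mk E.f (E.g ≫ l) (by rw [E.zero_assoc, zero_comp]) :=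
    { τ₁ := 𝟙 _, τ₂ := 𝟙 _, τ₃ := l }
  have : Epi φ.τ₁ := inferInstanceAs (Epi (𝟙 _))
  have : IsIso φ.τ₂ := inferInstanceAs (IsIso (𝟙 _))
  have : Mono φ.τ₃ := ‹_›
  exact (ShortComplex.exact_iff_of_epi_of_isIso_of_mono φ).1 hE.exact

omit [Abelian A] in
lemma epi_precomp_epi_comp {m : ℕ} (T : ComposableArrows A m) {K L : A} (k : K ⟶ T.left)
    (p : L ⟶ K) [Epi p] (h : Epi ((T.precomp k).map' m (m + 1))) :
    Epi ((T.precomp (p ≫ k)).map' m (m + 1)) := by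
  cases m with
  | zero =>
    have : Epi k := h
    exact inferInstanceAs (Epi (p ≫ k))
  | succ m => exact h

end Splice

/-! ### Completing epimorphisms and monomorphisms to `n`-exact sequences. -/

section Existence

variable {R : Type w} [CommRing R] [IsArtinianRing R] {Λ : Type u} [Ring Λ]
    [Algebra R Λ] [Module.Finite R Λ] {n : ℕ} {M : ObjectProperty (ModuleCat.{u} Λ)}
    (hM : IsNClusterTilting n M)

lemma forall_precomp_obj {A : Type u} [Category.{v} A] {P : ObjectProperty A} {m : ℕ}
    {T : ComposableArrows A m} {K : A} (k : K ⟶ T.left) (hK : P K) (hT : ∀ i, P (T.obj i)) :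
    ∀ i, P ((T.precomp k).obj i) :=
  Fin.cases hK hT

/-- Arrows of a full subcategory that are isomorphic in the ambient category are isomorphic. -/
lemma nonempty_arrow_iso {A : Type u} [Category.{v} A] {P : ObjectProperty A}
    {f g : Arrow P.FullSubcategory} (e : Arrow.mk f.hom.hom ≅ Arrow.mk g.hom.hom) :
    Nonempty (f ≅ g) :=
  ⟨Arrow.isoMk (P.fullyFaithfulι.preimageIso (Arrow.leftFunc.mapIso e))
    (P.fullyFaithfulι.preimageIso (Arrow.rightFunc.mapIso e))
    (ObjectProperty.hom_ext _ (Arrow.w e.hom))⟩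

namespace IsNClusterTilting

include hM

lemma isNExact_lift (S : ComposableArrows (ModuleCat.{u} Λ) (n + 1)) (hS : ∀ i, M (S.obj i))
    (h : IsLongExact S) : IsNExact (C := M.FullSubcategory) (M.lift S hS) where
  isComplex := ⟨fun i hi => ObjectProperty.hom_ext _ (h.exact.zero i hi)⟩
  kernel_zero X g hg := by
    have := h.mono
    exact ObjectProperty.hom_ext _ (zero_of_comp_mono (f := g.hom)
      (S.map' 0 1 (Nat.zero_le 1) (Nat.le_add_left 1 n))
      (congrArg (fun f => f.hom) hg))
  kernel_exact i hi X g hg := by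
    obtain ⟨l, hl⟩ := h.exists_comp_map_eq (fun i hi k hk hkn =>
      hM.subsingleton_ext X.property (hS _) hk hkn) i (by omega) g.hom
      (congrArg (fun f => f.hom) hg)
    exact ⟨ObjectProperty.homMk l, ObjectProperty.hom_ext _ hl⟩
  cokernel_zero X g hg := by
    have := h.epi
    exact ObjectProperty.hom_ext _ (zero_of_epi_comp (g := g.hom)
      (S.map' n (n + 1) n.le_succ le_rfl)
      (congrArg (fun f => f.hom) hg))
  cokernel_exact i hi X g hg := by
    obtain ⟨l, hl⟩ := h.exists_map_comp_eq (fun i hi k hk hkn =>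
      hM.subsingleton_ext (hS _) X.property hk hkn) i (by omega) g.hom
      (congrArg (fun f => f.hom) hg)
    exact ⟨ObjectProperty.homMk l, ObjectProperty.hom_ext _ hl⟩

-- The invariant is that `Extⁱ(M, K)` vanishes for `0 < i < n` except possibly at `i = m + 1`. The
-- kernel of an approximation has this exceptional degree moved up by one, the approximation
-- property itself killing `Ext¹`. At `m + 1 = n` the exception is out of range, so `K` is in `M`.
include R in
lemma exists_left_resolution {X Y : M.FullSubcategory} (f : X ⟶ Y) (hf : Epi f.hom) (m : ℕ) :
    ∃ (S : ComposableArrows (ModuleCat.{u} Λ) (m + 1)) (K : ModuleCat.{u} Λ) (k : K ⟶ S.left),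
      (∀ i, M (S.obj i)) ∧ Mono k ∧ Module.Finite Λ K ∧ (S.precomp k).Exact ∧
      (arrowAt m le_rfl).obj S = Arrow.mk f.hom ∧
      ∀ (Z : ModuleCat.{u} Λ) (i : ℕ), M Z → 0 < i → i < n → i ≠ m + 1 →
        Subsingleton (Ext Z K i) := by
  induction m with
  | zero =>
    have hE : (ShortComplex.mk (kernel.ι f.hom) f.hom (kernel.condition _)).ShortExact :=
      { exact := ShortComplex.exact_kernel f.hom }
    refine ⟨ComposableArrows.mk₁ f.hom, kernel f.hom, kernel.ι f.hom, ?_,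
      inferInstanceAs (Mono (kernel.ι f.hom)),
      module_finite_of_mono (R := R) (kernel.ι f.hom) (hM.finite _ X.property), ?_, rfl,
      fun Z i hZ hi hin him => ?_⟩
    · exact fun i => by fin_cases i; exacts [X.property, Y.property]
    · exact hE.exact.exact_toComposableArrows
    · obtain ⟨i, rfl⟩ : ∃ j, i = j + 2 := ⟨i - 2, by omega⟩
      have := hM.subsingleton_ext hZ Y.property (i := i + 1) (by omega) (by omega)
      exact subsingleton_ext_X₁ hE Z (k := i + 1) rfl
        (hM.subsingleton_ext hZ X.property (by omega) hin)
        fun z => ⟨0, by rw [Subsingleton.elim z 0, Ext.zero_comp]⟩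
  | succ m ih =>
    obtain ⟨S, K, k, hS, hk, hK, hexact, harrow, hext⟩ := ih
    obtain ⟨B, p, hp, hB⟩ := hM.exists_right_approximation K hK
    have hE : (ShortComplex.mk (kernel.ι p) p (kernel.condition _)).ShortExact :=
      { exact := ShortComplex.exact_kernel p }
    refine ⟨S.precomp (p ≫ k), kernel p, kernel.ι p, forall_precomp_obj _ B.property hS,
      inferInstanceAs (Mono (kernel.ι p)), module_finite_of_mono (R := R) (kernel.ι p) (hM.finite _ B.property),
      exact_splice hE S k hexact, harrow, fun Z i hZ hi hin him => ?_⟩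
    have h₂ := hM.subsingleton_ext hZ B.property hi hin
    obtain rfl | ⟨i, rfl⟩ : i = 1 ∨ ∃ j, i = j + 2 :=
      (Nat.eq_or_lt_of_le hi).imp Eq.symm fun h => ⟨i - 2, by omega⟩
    · refine subsingleton_ext_X₁ hE Z (zero_add 1) h₂ fun z => ?_
      obtain ⟨z, rfl⟩ := (Ext.mk₀_bijective _ _).2 z
      obtain ⟨l, hl⟩ := hB Z z hZ
      exact ⟨Ext.mk₀ l, by rw [Ext.mk₀_comp_mk₀]; exact congrArg _ hl⟩
    · have := hext Z (i + 1) hZ (by omega) (by omega) (by omega)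
      exact subsingleton_ext_X₁ hE Z (k := i + 1) rfl h₂
        fun z => ⟨0, by rw [Subsingleton.elim z 0, Ext.zero_comp]⟩

/-- Here the exceptional degree is `n - r`, with `r` the number of steps left. At `r = 0` it is out
of range, so `L` lies in `M` and serves as the last term. -/
lemma exists_right_resolution (r : ℕ) : ∀ (L : ModuleCat.{u} Λ), Module.Finite Λ L →
    (∀ (Y : ModuleCat.{u} Λ) (i : ℕ), M Y → 0 < i → i < n → i + r ≠ n →
      Subsingleton (Ext L Y i)) →
    ∃ (T : ComposableArrows (ModuleCat.{u} Λ) r) (l : L ⟶ T.left), (∀ i, M (T.obj i)) ∧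
      Mono l ∧ (T.precomp l).Exact ∧ Epi ((T.precomp l).map' r (r + 1)) := by
  induction r with
  | zero =>
    intro L hL h
    have hML : M L := (hM.mem_iff_left L hL).2 fun Y hY i hi hin => h Y i hY hi hin (by omega)
    exact ⟨ComposableArrows.mk₀ L, 𝟙 L, fun _ => hML, inferInstanceAs (Mono (𝟙 L)), ComposableArrows.exact₁ _,
      inferInstanceAs (Epi (𝟙 L))⟩
  | succ r ih =>
    intro L hL h
    obtain ⟨B, j, hj, hB⟩ := hM.exists_left_approximation L hL
    have hE : (ShortComplex.mk j (cokernel.π j) (cokernel.condition _)).ShortExact :=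
      { exact := ShortComplex.exact_cokernel j }
    obtain ⟨T, l, hT, hl, hexact, hepi⟩ := ih (cokernel j)
      (module_finite_of_epi (cokernel.π j) (hM.finite _ B.property)) fun Y i hY hi hin hir => by
        have h₂ := hM.subsingleton_ext B.property hY hi hin
        obtain rfl | ⟨i, rfl⟩ : i = 1 ∨ ∃ j, i = j + 2 :=
          (Nat.eq_or_lt_of_le hi).imp Eq.symm fun h => ⟨i - 2, by omega⟩
        · refine subsingleton_ext_X₃_left hE Y (add_zero 1) h₂ fun z => ?_
          obtain ⟨z, rfl⟩ := (Ext.mk₀_bijective _ _).2 z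
          obtain ⟨a, ha⟩ := hB Y z hY
          exact ⟨Ext.mk₀ a, by rw [Ext.mk₀_comp_mk₀]; exact congrArg _ ha⟩
        · have := h Y (i + 1) hY (by omega) (by omega) (by omega)
          exact subsingleton_ext_X₃_left hE Y (k := i + 1) (by omega) h₂
            fun z => ⟨0, by rw [Subsingleton.elim z 0, Ext.comp_zero]⟩
    exact ⟨T.precomp (cokernel.π j ≫ l), j, forall_precomp_obj _ B.property hT, hj,
      exact_splice hE T l hexact, epi_precomp_epi_comp T l (cokernel.π j) hepi⟩

include R in
/-- Every epimorphism in `M` is the last morphism of an `n`-exact sequence. -/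
lemma exists_lastArrow_iso (hn : 1 ≤ n) {X Y : M.FullSubcategory} (f : X ⟶ Y) (hf : Epi f.hom) :
    ∃ S : NExactSeq M.FullSubcategory n, Nonempty ((lastArrow n).obj S ≅ Arrow.mk f) := by
  obtain ⟨m, rfl⟩ := Nat.exists_eq_add_of_le' hn
  obtain ⟨S, K, k, hS, hk, hK, hexact, harrow, hext⟩ := hM.exists_left_resolution (R := R) f hf m
  have hMK : M K := (hM.mem_iff_right K hK).2 fun Z hZ i hi hin =>
    hext Z i hZ hi hin (by omega)
  refine ⟨⟨M.lift (S.precomp k) (forall_precomp_obj k hMK hS), hM.isNExact_lift _ _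
    { exact := hexact, mono := hk, epi := ?_ }⟩, nonempty_arrow_iso (eqToIso harrow)⟩
  have h : Epi ((arrowAt m le_rfl).obj S).hom := by rw [harrow]; exact hf
  exact h

/-- Every monomorphism in `M` is the first morphism of an `n`-exact sequence. -/
lemma exists_firstArrow_iso (hn : 1 ≤ n) {X Y : M.FullSubcategory} (f : X ⟶ Y) (hf : Mono f.hom) :
    ∃ S : NExactSeq M.FullSubcategory n, Nonempty ((firstArrow n).obj S ≅ Arrow.mk f) := by
  obtain ⟨m, rfl⟩ := Nat.exists_eq_add_of_le' hn
  have hE : (ShortComplex.mk f.hom (cokernel.π f.hom) (cokernel.condition _)).ShortExact :=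
    { exact := ShortComplex.exact_cokernel f.hom }
  obtain ⟨T, l, hT, hl, hexact, hepi⟩ := hM.exists_right_resolution m (cokernel f.hom)
    (module_finite_of_epi (cokernel.π f.hom) (hM.finite _ Y.property)) fun Z i hZ hi hin him => by
      obtain ⟨i, rfl⟩ : ∃ j, i = j + 2 := ⟨i - 2, by omega⟩
      have := hM.subsingleton_ext X.property hZ (i := i + 1) (by omega) (by omega)
      exact subsingleton_ext_X₃_left hE Z (k := i + 1) (by omega)
        (hM.subsingleton_ext Y.property hZ (by omega) hin)
        fun z => ⟨0, by rw [Subsingleton.elim z 0, Ext.comp_zero]⟩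
  exact ⟨⟨M.lift ((T.precomp (cokernel.π f.hom ≫ l)).precomp f.hom)
    (forall_precomp_obj _ X.property (forall_precomp_obj _ Y.property hT)), hM.isNExact_lift _ _
    { exact := exact_splice hE T l hexact
      mono := hf
      epi := epi_precomp_epi_comp T l (cokernel.π f.hom) hepi }⟩,
    nonempty_arrow_iso (Iso.refl _)⟩

end IsNClusterTilting

end Existence

/-! ### Morphisms between cokernel functors. -/

section Arrows

variable {C : Type u} [Category.{v} C] [Preadditive C]

lemma contraCoker_map_eq_iff {f g : Arrow C} (φ ψ : f ⟶ g) :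
    contraCoker.map φ = contraCoker.map ψ ↔
      ∃ h : f.right ⟶ g.left, h ≫ g.hom = φ.right - ψ.right := by
  have h1 : contraCoker.map φ = contraCoker.map ψ ↔
      (contraCoker.obj g).map φ.right.op (contraGen g) =
        (contraCoker.obj g).map ψ.right.op (contraGen g) := by
    rw [← contraCoker_map_app_contraGen, ← contraCoker_map_app_contraGen]
    exact ⟨fun h => by rw [h], fun h => (presents_contraCoker f).hom_ext h⟩
  rw [h1, (presents_contraCoker g).map_eq_iff]
  exact ⟨fun ⟨h, hh⟩ => ⟨h.unop, congrArg Quiver.Hom.unop hh⟩,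
    fun ⟨h, hh⟩ => ⟨h.op, congrArg Quiver.Hom.op hh⟩⟩

lemma coCoker_map_eq_iff {f g : Arrow C} (φ ψ : f ⟶ g) :
    coCoker.map φ.op = coCoker.map ψ.op ↔
      ∃ h : f.right ⟶ g.left, f.hom ≫ h = φ.left - ψ.left := by
  have h1 : coCoker.map φ.op = coCoker.map ψ.op ↔
      (coCoker.obj (op f)).map φ.left (coGen f) = (coCoker.obj (op f)).map ψ.left (coGen f) := by
    rw [← coCoker_map_app_coGen, ← coCoker_map_app_coGen]
    exact ⟨fun h => by rw [h], fun h => (presents_coCoker g).hom_ext h⟩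
  rw [h1, (presents_coCoker f).map_eq_iff]

/-- The image of the generator lifts to the right-hand component; that it kills the relation of `f`
yields the left-hand one. -/
instance : (contraCoker (C := C)).Full where
  map_surjective {f g} α := by
    have hf := presents_contraCoker f
    have hg := presents_contraCoker g
    obtain ⟨a, ha⟩ := hg.surj _ (α.app _ (contraGen f))
    obtain ⟨h, hh⟩ := (hg.zero_iff _ (a ≫ f.hom.op)).1 (by
      rw [Functor.map_comp, ConcreteCategory.comp_apply, ha, ← NatTrans.naturality_apply,
        hf.map_self, map_zero])
    refine ⟨Arrow.homMk h.unop a.unop (congrArg Quiver.Hom.unop hh), hf.hom_ext ?_⟩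
    exact (contraCoker_map_app_contraGen _).trans ha

instance : (coCoker (C := C)).Full where
  map_surjective {f g} α := by
    have hf := presents_coCoker f.unop
    have hg := presents_coCoker g.unop
    obtain ⟨a, ha⟩ := hg.surj _ (α.app _ (coGen f.unop))
    obtain ⟨h, hh⟩ := (hg.zero_iff _ (a ≫ f.unop.hom)).1 (by
      rw [Functor.map_comp, ConcreteCategory.comp_apply, ha, ← NatTrans.naturality_apply]
      exact (congrArg _ hf.map_self).trans (map_zero (α.app _).hom))
    refine ⟨Quiver.Hom.op (Arrow.homMk a h hh.symm), hf.hom_ext ?_⟩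
    exact (coCoker_map_app_coGen _).trans ha

variable {n : ℕ}

instance : (lastArrow (C := C) n).Full where
  map_surjective {S T} φ := by
    obtain ⟨ψ, h1, h2⟩ := T.property.exists_hom_of_last S.property.isComplex φ.left φ.right
      (Arrow.w φ).symm
    exact ⟨ObjectProperty.homMk ψ, Arrow.hom_ext _ _ h1 h2⟩

instance : (firstArrow (C := C) n).Full where
  map_surjective {S T} φ := by
    obtain ⟨ψ, h1, h2⟩ := S.property.exists_hom_of_first T.property.isComplex φ.left φ.right
      (Arrow.w φ).symm
    exact ⟨ObjectProperty.homMk ψ, Arrow.hom_ext _ _ h1 h2⟩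

end Arrows

/-! ### The two defects induce the same congruence. -/

section Defects

variable {R : Type w} [CommRing R] [IsArtinianRing R] {Λ : Type u} [Ring Λ]
    [Algebra R Λ] [Module.Finite R Λ] {n : ℕ} {M : ObjectProperty (ModuleCat.{u} Λ)}
    (hM : IsNClusterTilting n M)

instance : (contraDefect hM).Full where
  map_surjective {S T} α := by
    obtain ⟨φ, hφ⟩ := (lastArrow n ⋙ contraCoker).map_surjective α.hom
    exact ⟨φ, ObjectProperty.hom_ext _ hφ⟩

instance : (coDefect hM).Full := by
  unfold coDefect; infer_instance

lemma isPresentedVanishing_of_presents {D : Type u} [Category.{v} D] [Preadditive D]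
    {W : ObjectProperty D} {F : D ⥤ AddCommGrpCat.{v}} {X P : D} {i : X ⟶ P} {x : F.obj X}
    (hF : Presents F i x) (hi : IsLeftApprox W i) : IsPresentedVanishing W F := by
  refine ⟨⟨_, _, _, _, hF⟩, fun P' hP' => ?_⟩
  have : Subsingleton (F.obj P') := subsingleton_of_forall_eq 0 fun y => by
    obtain ⟨f, rfl⟩ := hF.surj _ y
    exact (hF.zero_iff _ f).2 (hi.2 _ f hP')
  exact AddCommGrpCat.isZero_of_subsingleton _

-- Vanishing at a projective that maps onto the target of `f` makes that epimorphism factor through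
-- `f`.
include hM in
lemma epi_of_isModUnder (f : Arrow M.FullSubcategory) 
    (h : ∀ P : M.FullSubcategory, projObj M P → IsZero ((contraCoker.obj f).obj (op P))) :
    Epi f.hom.hom := by
  obtain ⟨P, p, hP, hp⟩ := hM.exists_projective f.right
  obtain ⟨k, hk⟩ := ((presents_contraCoker f).zero_iff _ p.op).1
    ((AddCommGrpCat.subsingleton_of_isZero (h P hP)).elim _ _)
  have hk' : k.unop ≫ f.hom = p := congrArg Quiver.Hom.unop hk
  rw [← hk'] at hp
  have : Epi (k.unop.hom ≫ f.hom.hom) := hp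
  exact epi_of_epi k.unop.hom f.hom.hom

include R hM in
lemma mono_of_isOverMod (f : Arrow M.FullSubcategory) 
    (h : ∀ I : M.FullSubcategory, injObj M I → IsZero ((coCoker.obj (op f)).obj I)) :
    Mono f.hom.hom := by
  obtain ⟨I, i, hI, hi⟩ := hM.exists_injective (R := R) f.left
  obtain ⟨k, hk⟩ := ((presents_coCoker f).zero_iff _ i).1
    ((AddCommGrpCat.subsingleton_of_isZero (h I hI)).elim _ _)
  rw [← hk] at hi
  have : Mono (f.hom.hom ≫ k.hom) := hi
  exact mono_of_mono f.hom.hom k.hom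

include R in
lemma essSurj_contraDefect (hn : 1 ≤ n) : (contraDefect hM).EssSurj where
  mem_essImage F := by
    obtain ⟨f, ⟨e⟩⟩ := F.property.1
    have hf := epi_of_isModUnder hM f fun P hP => (F.property.2 P hP).of_iso (e.app _)
    obtain ⟨S, ⟨e'⟩⟩ := hM.exists_lastArrow_iso (R := R) hn f.hom hf
    exact ⟨S, ⟨ObjectProperty.isoMk _ (contraCoker.mapIso e' ≪≫ e)⟩⟩

include R in
lemma essSurj_coDefect (hn : 1 ≤ n) : (coDefect hM).EssSurj where
  mem_essImage F := by
    obtain ⟨f, ⟨e⟩⟩ := F.property.1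
    have hf := mono_of_isOverMod (R := R) hM f fun I hI => (F.property.2 I hI).of_iso (e.app _)
    obtain ⟨S, ⟨e'⟩⟩ := hM.exists_firstArrow_iso hn f.hom hf
    exact ⟨op S, ⟨ObjectProperty.isoMk _ (coCoker.mapIso e'.symm.op ≪≫ e)⟩⟩

/-- The class in `Extⁿ(Sⁿ⁺¹, S⁰)` of an `n`-exact sequence. -/
def extClass (S : NExactSeq M.FullSubcategory n) :
    Ext ((lastArrow n).obj S).right.obj ((firstArrow n).obj S).left.obj n :=
  yonedaClass (hM.isLongExact S)

lemma extClass_naturality {S T : NExactSeq M.FullSubcategory n} (φ : S ⟶ T) :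
    (extClass hM S).comp (Ext.mk₀ ((firstArrow n).map φ).left.hom) (add_zero n) =
      (Ext.mk₀ ((lastArrow n).map φ).right.hom).comp (extClass hM T) (zero_add n) :=
  yonedaClass_naturality (hM.isLongExact S) (hM.isLongExact T)
    ((M.ι.mapComposableArrows (n + 1)).map φ.hom)

variable (hn : 1 ≤ n) (S : NExactSeq M.FullSubcategory n)

include hn in
lemma extClass_comp_eq_zero_iff {Y : M.FullSubcategory} (f : ((firstArrow n).obj S).left ⟶ Y) :
    (extClass hM S).comp (Ext.mk₀ f.hom) (add_zero n) = 0 ↔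
      ∃ h, ((firstArrow n).obj S).hom ≫ h = f := by
  refine (yonedaClass_comp_eq_zero_iff (hM.isLongExact S) hn f.hom
    fun i hi k hk hkn => hM.subsingleton_ext (S.obj.obj _).property Y.property hk hkn).trans ?_
  exact ⟨fun ⟨h, hh⟩ => ⟨ObjectProperty.homMk h, ObjectProperty.hom_ext _ hh⟩,
    fun ⟨h, hh⟩ => ⟨h.hom, congrArg (fun f => f.hom) hh⟩⟩

include hn in
lemma comp_extClass_eq_zero_iff {X : M.FullSubcategory} (g : X ⟶ ((lastArrow n).obj S).right) :
    (Ext.mk₀ g.hom).comp (extClass hM S) (zero_add n) = 0 ↔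
      ∃ h, h ≫ ((lastArrow n).obj S).hom = g := by
  refine (comp_yonedaClass_eq_zero_iff (hM.isLongExact S) hn g.hom
    fun i hi k hk hkn => hM.subsingleton_ext X.property (S.obj.obj _).property hk hkn).trans ?_
  exact ⟨fun ⟨h, hh⟩ => ⟨ObjectProperty.homMk h, ObjectProperty.hom_ext _ hh⟩,
    fun ⟨h, hh⟩ => ⟨h.hom, congrArg (fun f => f.hom) hh⟩⟩

-- The crux: each equality says that a difference of end components kills a Yoneda class, and
-- `extClass_naturality` for `φ` and `ψ` identifies the two resulting elements of `Extⁿ(Sⁿ⁺¹, T⁰)`.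
include hn in
lemma contraDefect_map_eq_iff {S T : NExactSeq M.FullSubcategory n} (φ ψ : S ⟶ T) :
    (contraDefect hM).map φ = (contraDefect hM).map ψ ↔
      (coDefect hM).map φ.op = (coDefect hM).map ψ.op := by
  have h1 : (contraDefect hM).map φ = (contraDefect hM).map ψ ↔
      contraCoker.map ((lastArrow n).map φ) = contraCoker.map ((lastArrow n).map ψ) :=
    ⟨fun h => congrArg (fun f => f.hom) h, fun h => ObjectProperty.hom_ext _ h⟩
  have h2 : (coDefect hM).map φ.op = (coDefect hM).map ψ.op ↔
      coCoker.map ((firstArrow n).map φ).op = coCoker.map ((firstArrow n).map ψ).op :=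
    ⟨fun h => congrArg (fun f => f.hom) h, fun h => ObjectProperty.hom_ext _ h⟩
  rw [h1, h2, contraCoker_map_eq_iff, coCoker_map_eq_iff, ← comp_extClass_eq_zero_iff hM hn,
    ← extClass_comp_eq_zero_iff hM hn]
  have h3 : ∀ {X Y : M.FullSubcategory} (f g : X ⟶ Y), (f - g).hom = f.hom - g.hom :=
    fun _ _ => rfl
  rw [h3, h3, sub_eq_add_neg, sub_eq_add_neg, Ext.mk₀_add, Ext.mk₀_add, Ext.mk₀_neg, Ext.mk₀_neg,
    Ext.add_comp, Ext.comp_add, Ext.neg_comp, Ext.comp_neg, extClass_naturality,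
    extClass_naturality]

end Defects

/-! ### Projective objects are the stable Hom functors. -/

section Projectives

variable {R : Type w} [CommRing R] [IsArtinianRing R] {Λ : Type u} [Ring Λ]
    [Algebra R Λ] [Module.Finite R Λ] {n : ℕ} {M : ObjectProperty (ModuleCat.{u} Λ)}
    (hM : IsNClusterTilting n M)

include hM in
lemma isModUnder_underHom (X : M.FullSubcategory) : IsModUnder M ((underHom M).obj X) := by
  obtain ⟨P, p, hP, hp⟩ := hM.exists_projective X
  have h := IsNClusterTilting.isLeftApprox_op_of_epi p hP hp
  rw [isModUnder_eq]
  exact isPresentedVanishing_of_presents (presents_stableHom_flip h) h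

include R hM in
lemma isOverMod_overHom (X : M.FullSubcategoryᵒᵖ) : IsOverMod M ((overHom M).obj X) := by
  obtain ⟨I, i, hI, hi⟩ := hM.exists_injective (R := R) X.unop
  have h := IsNClusterTilting.isLeftApprox_of_mono i hI hi
  rw [isOverMod_eq]
  exact isPresentedVanishing_of_presents (presents_stableHom h) h

include R hM in
lemma projective_modUnder_iff (hU : ∀ X : M.FullSubcategory, IsModUnder M ((underHom M).obj X))
    (F : ModUnder M) : Projective F ↔
      ∃ X : M.FullSubcategory, Nonempty (F ≅ ((IsModUnder M).lift (underHom M) hU).obj X) := by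
  have key : ∀ X : M.FullSubcategory, ∃ (P : M.FullSubcategory) (p : P ⟶ X),
      IsLeftApprox (projObj M).op p.op := fun X => by
    obtain ⟨P, p, hP, hp⟩ := hM.exists_projective X
    exact ⟨P, p, IsNClusterTilting.isLeftApprox_op_of_epi p hP hp⟩
  constructor
  · intro hF
    obtain ⟨Y, hY⟩ := exists_presents_of_projective (isModUnder_eq M)
      (hM.hasFittingDecomposition_op (R := R)) F fun X => by
        obtain ⟨P, p, h⟩ := key X.unop
        exact ⟨op P, p.op, ⟨(underHom M).obj X.unop, hU _⟩, _, h, presents_stableHom_flip h⟩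
    obtain ⟨P, p, h⟩ := key Y.unop
    obtain ⟨y, hy⟩ := hY _ p.op h
    obtain ⟨e, -⟩ := hy.exists_iso (presents_stableHom_flip h)
    exact ⟨Y.unop, ⟨ObjectProperty.isoMk _ e⟩⟩
  · rintro ⟨X, ⟨e⟩⟩
    obtain ⟨P, p, h⟩ := key X
    exact Projective.of_iso e.symm (projective_of_presents (isModUnder_eq M)
      hM.hasJointFactorization_op _ h.1 (presents_stableHom_flip h))

include R hM in
lemma projective_overMod_iff (hO : ∀ X : M.FullSubcategoryᵒᵖ, IsOverMod M ((overHom M).obj X))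
    (G : OverMod M) : Projective G ↔
      ∃ X : M.FullSubcategory, Nonempty (G ≅ ((IsOverMod M).lift (overHom M) hO).obj (op X)) := by
  have key : ∀ X : M.FullSubcategory, ∃ (I : M.FullSubcategory) (i : X ⟶ I),
      IsLeftApprox (injObj M) i := fun X => by
    obtain ⟨I, i, hI, hi⟩ := hM.exists_injective (R := R) X
    exact ⟨I, i, IsNClusterTilting.isLeftApprox_of_mono i hI hi⟩
  constructor
  · intro hG
    obtain ⟨Y, hY⟩ := exists_presents_of_projective (isOverMod_eq M)
      (hM.hasFittingDecomposition (R := R)) G fun X => by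
        obtain ⟨I, i, h⟩ := key X
        exact ⟨I, i, ⟨(overHom M).obj (op X), hO _⟩, _, h, presents_stableHom h⟩
    obtain ⟨I, i, h⟩ := key Y
    obtain ⟨y, hy⟩ := hY _ i h
    obtain ⟨e, -⟩ := hy.exists_iso (presents_stableHom h)
    exact ⟨Y, ⟨ObjectProperty.isoMk _ e⟩⟩
  · rintro ⟨X, ⟨e⟩⟩
    obtain ⟨I, i, h⟩ := key X
    exact Projective.of_iso e.symm (projective_of_presents (isOverMod_eq M)
      hM.hasJointFactorization _ h.1 (presents_stableHom h))

end Projectives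

/-! ### Descending natural isomorphisms from sequences to objects. -/

section Transport

variable {N K A B C E : Type*} [Category* N] [Category* K] [Category* A] [Category* B]
  [Category* C] [Category* E]

/-- In the application `N` consists of sequences and `L` takes an end object. No functorial choice
of a sequence for each object is made; an isomorphism natural on `N` descends because `L` is full
and essentially surjective. -/
lemma nonempty_op_comp_iso (L : N ⥤ C) [L.Full] [L.EssSurj] {J : N ⥤ K} {D : K ⥤ A} {U : C ⥤ A}
    (α : L ⋙ U ≅ J ⋙ D) {S : Aᵒᵖ ⥤ B} {G : Kᵒᵖ ⥤ B} (e : D.op ⋙ S ≅ G) {I : B ⥤ E}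
    {X : Cᵒᵖ ⥤ E} (β : J.op ⋙ G ⋙ I ≅ L.op ⋙ X) : Nonempty (U.op ⋙ S ⋙ I ≅ X) :=
  ⟨isoOfPrecompIso L.op (Functor.isoWhiskerRight (NatIso.op α.symm) (S ⋙ I) ≪≫
    Functor.isoWhiskerLeft J.op (Functor.isoWhiskerRight e I) ≪≫ β)⟩

lemma nonempty_rightOp_comp_iso (L : N ⥤ C) [L.Full] [L.EssSurj] {J : N ⥤ K} {D : K ⥤ A}
    {U : Cᵒᵖ ⥤ B} {G : Kᵒᵖ ⥤ B} (α : L.op ⋙ U ≅ J.op ⋙ G) {S : B ⥤ Aᵒᵖ} (e : G ⋙ S ≅ D.op)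
    {I : A ⥤ E} {X : C ⥤ E} (β : J ⋙ D ⋙ I ≅ L ⋙ X) :
    Nonempty (U.rightOp ⋙ S.leftOp ⋙ I ≅ X) := by
  let e₁ : (J ⋙ D).op ≅ (L ⋙ U.rightOp ⋙ S.leftOp).op :=
    (Functor.isoWhiskerRight α S ≪≫ Functor.isoWhiskerLeft J.op e).symm
  exact ⟨isoOfPrecompIso L (Functor.isoWhiskerRight (NatIso.removeOp e₁) I ≪≫ β)⟩

end Transport

/-! ### Stable Hom and Ext functors as defects. -/

section ExtFunctors

variable {R : Type w} [CommRing R] [IsArtinianRing R] {Λ : Type u} [Ring Λ]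
    [Algebra R Λ] [Module.Finite R Λ] {n : ℕ} {M : ObjectProperty (ModuleCat.{u} Λ)}
    (hM : IsNClusterTilting n M) (hn : 1 ≤ n)

variable (M n) in
/-- The `n`-exact sequences such that `Sⁿ` is projective. -/
abbrev ProjSeq := ObjectProperty.FullSubcategory
  (fun S : NExactSeq M.FullSubcategory n => projObj M ((lastArrow n).obj S).left)

variable (M n) in
/-- The `n`-exact sequences such that `S¹` is injective. -/
abbrev InjSeq := ObjectProperty.FullSubcategory
  (fun S : NExactSeq M.FullSubcategory n => injObj M ((firstArrow n).obj S).right)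

variable (M n) in
/-- The last object of an `n`-exact sequence such that `Sⁿ` is projective. -/
def ProjSeq.last : ProjSeq n M ⥤ M.FullSubcategory :=
  ObjectProperty.ι _ ⋙ lastArrow n ⋙ Arrow.rightFunc

variable (M n) in
/-- The first object of an `n`-exact sequence such that `S¹` is injective. -/
def InjSeq.first : InjSeq n M ⥤ M.FullSubcategory :=
  ObjectProperty.ι _ ⋙ firstArrow n ⋙ Arrow.leftFunc

lemma exists_lift_of_projObj {P X Y : M.FullSubcategory} (hP : projObj M P) (f : P ⟶ Y)
    (e : X ⟶ Y) (he : Epi e.hom) : ∃ h : P ⟶ X, h ≫ e = f := by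
  have : Projective P.obj := hP
  exact ⟨ObjectProperty.homMk (Projective.factorThru f.hom e.hom),
    ObjectProperty.hom_ext _ (Projective.factorThru_comp f.hom e.hom)⟩

lemma exists_extension_of_injObj {I X Y : M.FullSubcategory} (hI : injObj M I) (f : X ⟶ I)
    (e : X ⟶ Y) (he : Mono e.hom) : ∃ h : Y ⟶ I, e ≫ h = f := by
  have : Injective I.obj := hI
  exact ⟨ObjectProperty.homMk (Injective.factorThru f.hom e.hom),
    ObjectProperty.hom_ext _ (Injective.comp_factorThru f.hom e.hom)⟩

include hM in
lemma ProjSeq.full_last : (ProjSeq.last n M).Full where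
  map_surjective {S T} f := by
    obtain ⟨h, hh⟩ := exists_lift_of_projObj S.property (((lastArrow n).obj S.obj).hom ≫ f)
      ((lastArrow n).obj T.obj).hom (epi_lastArrow hM T.obj)
    obtain ⟨φ, hφ⟩ := (lastArrow n).map_surjective (X := S.obj) (Y := T.obj) (Arrow.homMk h f hh)
    exact ⟨ObjectProperty.homMk φ, congrArg (fun t => t.right) hφ⟩

include hM in
lemma InjSeq.full_first : (InjSeq.first n M).Full where
  map_surjective {S T} f := by
    obtain ⟨h, hh⟩ := exists_extension_of_injObj T.property (f ≫ ((firstArrow n).obj T.obj).hom)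
      ((firstArrow n).obj S.obj).hom (mono_firstArrow hM S.obj)
    obtain ⟨φ, hφ⟩ := (firstArrow n).map_surjective (X := S.obj) (Y := T.obj)
      (Arrow.homMk f h hh.symm)
    exact ⟨ObjectProperty.homMk φ, congrArg (fun t => t.left) hφ⟩

include R hM hn in
lemma ProjSeq.essSurj_last : (ProjSeq.last n M).EssSurj where
  mem_essImage X := by
    obtain ⟨P, p, hP, hp⟩ := hM.exists_projective X
    obtain ⟨S, ⟨e⟩⟩ := hM.exists_lastArrow_iso (R := R) hn p hp
    have hP : Projective P.obj := hP
    exact ⟨⟨S, Projective.of_iso (M.ι.mapIso (Arrow.leftFunc.mapIso e)).symm hP⟩,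
      ⟨Arrow.rightFunc.mapIso e⟩⟩

include R hM hn in
lemma InjSeq.essSurj_first : (InjSeq.first n M).EssSurj where
  mem_essImage X := by
    obtain ⟨I, i, hI, hi⟩ := hM.exists_injective (R := R) X
    obtain ⟨S, ⟨e⟩⟩ := hM.exists_firstArrow_iso hn i hi
    have hI : Injective I.obj := hI
    exact ⟨⟨S, Injective.of_iso (M.ι.mapIso (Arrow.rightFunc.mapIso e)).symm hI⟩,
      ⟨Arrow.leftFunc.mapIso e⟩⟩

-- `Extⁿ(Sⁿ, Y) = 0` by projectivity, so `Hom(S¹, Y) ⟶ Hom(S⁰, Y) ⟶ Extⁿ(Sⁿ⁺¹, Y) ⟶ 0` is exact and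
-- the Yoneda class is a generator with relation `S⁰ ⟶ S¹`.
include hn in
lemma presents_extCo (S : NExactSeq M.FullSubcategory n)
    (hS : projObj M ((lastArrow n).obj S).left) :
    Presents ((extCo M n).obj (op ((lastArrow n).obj S).right)) ((firstArrow n).obj S).hom
      (extClass hM S) where
  map_add Y f f' := by
    change (extClass hM S).comp (Ext.mk₀ (f.hom + f'.hom)) (add_zero n) = _
    rw [Ext.mk₀_add, Ext.comp_add]
    rfl
  surj Y y := by
    obtain ⟨m, rfl⟩ := Nat.exists_eq_add_of_le' hn
    have : Projective ((lastArrow (m + 1)).obj S).left.obj := hS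
    have := Ext.subsingleton_of_projective ((lastArrow (m + 1)).obj S).left.obj Y.obj m
    obtain ⟨f, hf⟩ := exists_yonedaClass_comp_eq (hM.isLongExact S) hn
      (fun i hi k hk hkn => hM.subsingleton_ext (S.obj.obj _).property Y.property hk hkn) y
      (this.elim _ _)
    exact ⟨ObjectProperty.homMk f, hf⟩
  zero_iff Y f := extClass_comp_eq_zero_iff hM hn S f

include hn in
lemma presents_extContra (S : NExactSeq M.FullSubcategory n)
    (hS : injObj M ((firstArrow n).obj S).right) :
    Presents ((extContra M n).obj ((firstArrow n).obj S).left) ((lastArrow n).obj S).hom.op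
      (extClass hM S) where
  map_add Y f f' := by
    change (Ext.mk₀ (f.unop.hom + f'.unop.hom)).comp (extClass hM S) (zero_add n) = _
    rw [Ext.mk₀_add, Ext.add_comp]
    rfl
  surj Y y := by
    obtain ⟨m, rfl⟩ := Nat.exists_eq_add_of_le' hn
    have : Injective ((firstArrow (m + 1)).obj S).right.obj := hS
    have := Ext.subsingleton_of_injective Y.unop.obj ((firstArrow (m + 1)).obj S).right.obj m
    obtain ⟨f, hf⟩ := exists_comp_yonedaClass_eq (hM.isLongExact S)
      (fun i hi k hk hkn => hM.subsingleton_ext Y.unop.property (S.obj.obj _).property hk hkn) y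
      (this.elim _ _)
    exact ⟨Quiver.Hom.op (ObjectProperty.homMk f), hf⟩
  zero_iff Y f := (comp_extClass_eq_zero_iff hM hn S f.unop).trans
    ⟨fun ⟨h, hh⟩ => ⟨h.op, congrArg Quiver.Hom.op hh⟩,
      fun ⟨h, hh⟩ => ⟨h.unop, congrArg Quiver.Hom.unop hh⟩⟩

include hM in
lemma nonempty_contraCoker_iso_underHom :
    Nonempty ((ObjectProperty.ι _ ⋙ lastArrow n ⋙ contraCoker : ProjSeq n M ⥤ _) ≅
      ProjSeq.last n M ⋙ underHom M) :=
  nonempty_iso_of_presents (fun S => op ((lastArrow n).obj S.obj).right)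
    (fun S => op ((lastArrow n).obj S.obj).left) (fun S => ((lastArrow n).obj S.obj).hom.op)
    (fun _ => contraGen _) (fun _ => stableId (projObj M) _) (fun _ => presents_contraCoker _)
    (fun S => presents_stableHom_flip (IsNClusterTilting.isLeftApprox_op_of_epi _ S.property
      (epi_lastArrow hM S.obj)))
    fun φ => ⟨((lastArrow n).map φ.hom).right.op, contraCoker_map_app_contraGen _,
      stableHom_flip_map_app_stableId _ _⟩

include hM in
lemma nonempty_coCoker_iso_overHom :
    Nonempty (((ObjectProperty.ι _ ⋙ firstArrow n).op ⋙ coCoker : (InjSeq n M)ᵒᵖ ⥤ _) ≅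
      (InjSeq.first n M).op ⋙ overHom M) :=
  nonempty_iso_of_presents (fun S => ((firstArrow n).obj S.unop.obj).left)
    (fun S => ((firstArrow n).obj S.unop.obj).right) (fun S => ((firstArrow n).obj S.unop.obj).hom)
    (fun _ => coGen _) (fun _ => stableId (injObj M) _) (fun _ => presents_coCoker _)
    (fun S => presents_stableHom (IsNClusterTilting.isLeftApprox_of_mono _ S.unop.property
      (mono_firstArrow hM S.unop.obj)))
    fun φ => ⟨((firstArrow n).map φ.unop.hom).left, coCoker_map_app_coGen _,
      stableHom_map_app_stableId _ _⟩

include hM hn in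
lemma nonempty_coCoker_iso_extCo :
    Nonempty (((ObjectProperty.ι _ ⋙ firstArrow n).op ⋙ coCoker : (ProjSeq n M)ᵒᵖ ⥤ _) ≅
      (ProjSeq.last n M).op ⋙ extCo M n) :=
  nonempty_iso_of_presents (fun S => ((firstArrow n).obj S.unop.obj).left)
    (fun S => ((firstArrow n).obj S.unop.obj).right) (fun S => ((firstArrow n).obj S.unop.obj).hom)
    (fun _ => coGen _) (fun S => extClass hM S.unop.obj) (fun _ => presents_coCoker _)
    (fun S => presents_extCo hM hn S.unop.obj S.unop.property)
    fun φ => ⟨((firstArrow n).map φ.unop.hom).left, coCoker_map_app_coGen _,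
      (extClass_naturality hM φ.unop.hom).symm⟩

include hM hn in
lemma nonempty_contraCoker_iso_extContra :
    Nonempty ((ObjectProperty.ι _ ⋙ lastArrow n ⋙ contraCoker : InjSeq n M ⥤ _) ≅
      InjSeq.first n M ⋙ extContra M n) :=
  nonempty_iso_of_presents (fun S => op ((lastArrow n).obj S.obj).right)
    (fun S => op ((lastArrow n).obj S.obj).left) (fun S => ((lastArrow n).obj S.obj).hom.op)
    (fun _ => contraGen _) (fun S => extClass hM S.obj) (fun _ => presents_contraCoker _)
    (fun S => presents_extContra hM hn S.obj S.property)
    fun φ => ⟨((lastArrow n).map φ.hom).right.op, contraCoker_map_app_contraGen _,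
      extClass_naturality hM φ.hom⟩

include R hn in
lemma nonempty_underHom_comp_iso_extCo
    (hU : ∀ X : M.FullSubcategory, IsModUnder M ((underHom M).obj X))
    (S : (ModUnder M)ᵒᵖ ⥤ OverMod M) (e : (contraDefect hM).op ⋙ S ≅ coDefect hM) :
    Nonempty (((IsModUnder M).lift (underHom M) hU).op ⋙ S ⋙ (IsOverMod M).ι ≅ extCo M n) := by
  have := ProjSeq.full_last hM
  have := ProjSeq.essSurj_last (R := R) hM hn
  obtain ⟨α⟩ := nonempty_contraCoker_iso_underHom hM
  obtain ⟨β⟩ := nonempty_coCoker_iso_extCo hM hn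
  let α' : ProjSeq.last n M ⋙ (IsModUnder M).lift (underHom M) hU ≅
      ObjectProperty.ι _ ⋙ contraDefect hM :=
    Functor.fullyFaithfulCancelRight (IsModUnder M).ι (show
      ProjSeq.last n M ⋙ underHom M ≅ ObjectProperty.ι _ ⋙ lastArrow n ⋙ contraCoker from α.symm)
  exact nonempty_op_comp_iso (ProjSeq.last n M) α' e β

include R hn in
lemma nonempty_overHom_comp_iso_extContra
    (hO : ∀ X : M.FullSubcategoryᵒᵖ, IsOverMod M ((overHom M).obj X))
    (S : OverMod M ⥤ (ModUnder M)ᵒᵖ) (e : coDefect hM ⋙ S ≅ (contraDefect hM).op) :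
    Nonempty (((IsOverMod M).lift (overHom M) hO).rightOp ⋙ S.leftOp ⋙ (IsModUnder M).ι ≅
      extContra M n) := by
  have := InjSeq.full_first hM
  have := InjSeq.essSurj_first (R := R) hM hn
  obtain ⟨α⟩ := nonempty_coCoker_iso_overHom hM
  obtain ⟨β⟩ := nonempty_contraCoker_iso_extContra hM hn
  let α' : (InjSeq.first n M).op ⋙ (IsOverMod M).lift (overHom M) hO ≅
      (ObjectProperty.ι _).op ⋙ coDefect hM :=
    Functor.fullyFaithfulCancelRight (IsOverMod M).ι (show
      (InjSeq.first n M).op ⋙ overHom M ≅ (ObjectProperty.ι _ ⋙ firstArrow n).op ⋙ coCoker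
      from α.symm)
  exact nonempty_rightOp_comp_iso (InjSeq.first n M) α' e β

end ExtFunctors

/-! ### The duality and its uniqueness. -/

section Duality

variable {R : Type w} [CommRing R] [IsArtinianRing R] {Λ : Type u} [Ring Λ]
    [Algebra R Λ] [Module.Finite R Λ] {n : ℕ} {M : ObjectProperty (ModuleCat.{u} Λ)}
    (hM : IsNClusterTilting n M) (hn : 1 ≤ n)

include R hn in
lemma exists_duality :
    ∃ S : (ModUnder M)ᵒᵖ ≌ OverMod M,
      Nonempty ((contraDefect hM).op ⋙ S.functor ≅ coDefect hM) := by
  have := essSurj_contraDefect (R := R) hM hn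
  have := essSurj_coDefect (R := R) hM hn
  refine exists_equivalence_of_homRel_iff (contraDefect hM).op (coDefect hM) fun X Y f g => ?_
  refine Iff.trans ?_ (contraDefect_map_eq_iff hM hn f.unop g.unop)
  exact Quiver.Hom.op_inj.eq_iff

lemma isSigma_of_iso (S : (ModUnder M)ᵒᵖ ⥤ OverMod M)
    (e : (contraDefect hM).op ⋙ S ≅ coDefect hM) : IsSigma hM S :=
  ⟨(theta M).op ⋙ S, ⟨e⟩, ⟨Iso.refl _⟩⟩

include R hn in
lemma IsSigma.nonempty_iso {S S' : (ModUnder M)ᵒᵖ ⥤ OverMod M} (hS : IsSigma hM S)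
    (hS' : IsSigma hM S') : Nonempty (S ≅ S') := by
  have := essSurj_contraDefect (R := R) hM hn
  have key : ∀ {T : (ModUnder M)ᵒᵖ ⥤ OverMod M}, IsSigma hM T →
      Nonempty ((contraDefect hM).op ⋙ T ≅ coDefect hM) := by
    rintro T ⟨Ψ, ⟨e⟩, ⟨e'⟩⟩
    -- `lastEpi hM ⋙ theta M` is `contraDefect hM` by definition, so `Ψ` drops out and only the
    -- restriction of `T` to sequences matters.
    exact ⟨Functor.isoWhiskerLeft (lastEpi hM).op e' ≪≫ e⟩
  obtain ⟨e⟩ := key hS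
  obtain ⟨e'⟩ := key hS'
  exact ⟨isoOfPrecompIso (contraDefect hM).op (e ≪≫ e'.symm)⟩

end Duality

end HigherAuslander

end

open HigherAuslander CategoryTheory Opposite in
theorem mainTheorem11 (R : Type w) [CommRing R] [IsArtinianRing R] (Λ : Type u) [Ring Λ]
    [Algebra R Λ] [Module.Finite R Λ] (n : ℕ) (hn : 1 ≤ n)
    (M : ObjectProperty (ModuleCat.{u} Λ)) (hM : IsNClusterTilting n M) :
    -- there is a duality `S`, unique up to isomorphism, with `S = Ψ' ∘ Θ⁻¹`
    ∃ S : (ModUnder M)ᵒᵖ ≌ OverMod M,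
      IsSigma hM S.functor ∧
      (∀ S' : (ModUnder M)ᵒᵖ ⥤ OverMod M, IsSigma hM S' → Nonempty (S' ≅ S.functor)) ∧
      -- it exchanges the defects of `n`-exact sequences
      Nonempty ((contraDefect hM).op ⋙ S.functor ≅ coDefect hM) ∧
      Nonempty (coDefect hM ⋙ S.inverse ≅ (contraDefect hM).op) ∧
      -- (i) the projective objects of `mod-M̲`
      (∃ hU : ∀ X : M.FullSubcategory, IsModUnder M ((underHom M).obj X),
        (∀ F : ModUnder M, Projective F ↔
          ∃ X : M.FullSubcategory,
            Nonempty (F ≅ ((IsModUnder M).lift (underHom M) hU).obj X)) ∧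
        Nonempty (((IsModUnder M).lift (underHom M) hU).op ⋙ S.functor ⋙ (IsOverMod M).ι ≅
          extCo M n)) ∧
      (∃ hP : ∀ F : ModUnder M, Projective F → Injective (S.functor.obj (op F)),
        (projToInj S.functor hP).IsEquivalence) ∧
      -- (ii) the projective objects of `M̄-mod`
      (∃ hO : ∀ X : M.FullSubcategoryᵒᵖ, IsOverMod M ((overHom M).obj X),
        (∀ G : OverMod M, Projective G ↔
          ∃ X : M.FullSubcategory,
            Nonempty (G ≅ ((IsOverMod M).lift (overHom M) hO).obj (op X))) ∧
        Nonempty (((IsOverMod M).lift (overHom M) hO).rightOp ⋙ S.inverse.leftOp ⋙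
          (IsModUnder M).ι ≅ extContra M n)) ∧
      (∃ hP : ∀ G : OverMod M, Projective G → Injective (S.inverse.leftOp.obj (op G)),
        (projToInj S.inverse.leftOp hP).IsEquivalence) := by
  obtain ⟨S, ⟨e⟩⟩ := exists_duality (R := R) hM hn
  have e' : coDefect hM ⋙ S.inverse ≅ (contraDefect hM).op :=
    Functor.isoWhiskerRight e.symm S.inverse ≪≫
      Functor.isoWhiskerLeft (contraDefect hM).op S.unitIso.symm
  have hS : IsSigma hM S.functor := isSigma_of_iso hM S.functor e
  have hU := isModUnder_underHom hM
  have hO := isOverMod_overHom (R := R) hM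
  have hP : ∀ F : ModUnder M, Projective F → Injective (S.functor.obj (op F)) :=
    fun F => (injective_obj_op_iff S.functor F).2
  have hQ : ∀ G : OverMod M, Projective G → Injective (S.inverse.leftOp.obj (op G)) :=
    fun G => (injective_obj_op_iff S.inverse.leftOp G).2
  exact ⟨S, hS, fun S' hS' => IsSigma.nonempty_iso (R := R) hM hn hS' hS, ⟨e⟩, ⟨e'⟩,
    ⟨hU, projective_modUnder_iff (R := R) hM hU,
      nonempty_underHom_comp_iso_extCo (R := R) hM hn hU S.functor e⟩,
    ⟨hP, isEquivalence_projToInj S.functor hP⟩,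
    ⟨hO, projective_overMod_iff (R := R) hM hO,
      nonempty_overHom_comp_iso_extContra (R := R) hM hn hO S.inverse e'⟩,
    ⟨hQ, isEquivalence_projToInj S.inverse.leftOp hQ⟩⟩
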